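/- Let $\mathcal H$ be a complex Hilbert space, $T>0$, $n\ge 1$ an integer, and $(H(s))_{s\in[0,T)}$ a family of self-adjoint operators on $\mathcal H$ with common domain $D$, such that: (H1) $H(s)\ge 1$ for all $s\in[0,T)$. (H2) For each $\phi\in D$ the map $s\mapsto H(s)\phi$ is in $C^n([0,T),\mathcal H)$, and for all $1\le l\le n$ the operator $H^{(l)}(s):\phi\mapsto \frac{d^l}{ds^l}H(s)\phi$ on $D$ is (the restriction to $D$ of) a self-adjoint operator for all $s\in[0,T)$, with $\alpha_l:=\sup_{s\in[0,T)}\|H^{(l)}(s)H(s)^{-1}\|<\infty$. (H3) There are $M\ge 0$ and continuous functions $a_\pm:[0,T]\to\mathbb R$ with $0\le a_-\le a_+\le M$ such that, with $I(s)=[a_-(s),a_+(s)]$, for all $s\in[0,T)$ one has $\min\bigl(1,\mathrm{dist}(I(s),\sigma(H(s))\setminus I(s))\bigr)>0$ (with $\mathrm{dist}(I(s),\emptyset)=+\infty$), and the spectral projector $P(s)=\mathbf 1_{I(s)}(H(s))$ has a finite rank $\mathcal N\ge 1$ independent of $s$. For a bounded operator $A$, let $L^+(s)A$ be the bounded operator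 $B$ that is off-diagonal, i.e. $P(s)BP(s)=(1-P(s))B(1-P(s))=0$, preserves $D$, and satisfies $[H(s),B]=P(s)A(1-P(s))+(1-P(s))AP(s)$ on $D$ (the partial inverse of the Liouvillian $[H(s),\cdot]$). Dots and $\frac{d}{ds}$ applied to bounded operators denote derivatives in operator norm on $[0,T)$. Let $\varepsilon\ge 0$. Then there is a unique strongly continuous unitary propagator $(U^\varepsilon(t,t'))_{0\le t'\le t,\ \varepsilon t<T}$ that preserves $D$ and satisfies, strongly on $D$, $$ i\,\frac{\partial U^\varepsilon}{\partial t}(t,t')=H(\varepsilon t)U^\varepsilon(t,t'),\qquad U^\varepsilon(t',t')=\mathrm{Id}. $$ Write $U^\varepsilon(t)=U^\varepsilon(t,0)$. (i) If $n\ge 2$, then $P$ and $L^+\dot P$ are differentiable on $[0,T)$ in operator norm and, for all $t\ge 0$ with $\varepsilon t<T$, $$ U^\varepsilon(t)P(0)U^\varepsilon(t)^*=P(\varepsilon t)+i\varepsilon L^+(\varepsilon t)\dot P(\varepsilon t)-i\varepsilon U^\varepsilon(t)\bigl(L^+(0)\dot P(0)\bigr)U^\varepsilon(t)^*+R^\varepsilon(t),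 $$ $$ R^\varepsilon(t)=-i\varepsilon^2\int_0^t U^\varepsilon(t,t')\,\Bigl.\tfrac{d}{ds}\bigl(L^+(s)\dot P(s)\bigr)\Bigr|_{s=\varepsilon t'}\,U^\varepsilon(t,t')^*\,dt', $$ where the integrand is integrable in operator norm. (ii) For all $0\le t'\le t$ with $\varepsilon t<T$, the following operators are everywhere defined and bounded, with $$ \|H(\varepsilon t)U^\varepsilon(t,t')H(\varepsilon t')^{-1}\|\le e^{\alpha_1\varepsilon(t-t')},\qquad \|H(\varepsilon t)^{1/2}U^\varepsilon(t,t')H(\varepsilon t')^{-1/2}\|\le e^{\alpha_1\varepsilon(t-t')/2}. $$ -/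

import Mathlib

open scoped InnerProductSpace ENNReal

noncomputable section

namespace Adiabatic

variable {E : Type*} [NormedAddCommGroup E] [InnerProductSpace ℂ E]

/-! ### Unbounded operators -/

/-- The product `A B` of two partially defined operators, on its natural domain
`{x ∈ dom B | B x ∈ dom A}`. -/
def mul (A B : E →ₗ.[ℂ] E) : E →ₗ.[ℂ] E :=
  A.comp (B.domRestrict ((A.domain.comap B.toFun).map B.domain.subtype)) (by
    rintro ⟨x, hx⟩
    obtain ⟨⟨y, hy, rfl⟩, hx2⟩ := hx
    exact hy)

/-- A bounded operator, seen as an operator with domain the whole space. -/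
def ofBounded (B : E →L[ℂ] E) : E →ₗ.[ℂ] E := (B : E →ₗ[ℂ] E).toPMap ⊤

open Classical in
/-- The operator norm in `[0, ∞]`: it is `∞` unless the operator is everywhere defined
and bounded. -/
def opENorm (A : E →ₗ.[ℂ] E) : ℝ≥0∞ :=
  if A.domain = ⊤ then ⨆ x : A.domain, ⨆ _ : ‖(x : E)‖ ≤ 1, ‖A x‖ₑ else ⊤

/-- `R` is the bounded everywhere defined two-sided inverse of `T : dom T → E`. -/
def IsBoundedInverse (T : E →ₗ.[ℂ] E) (R : E →L[ℂ] E) : Prop :=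
  (∀ x : E, ∃ h : R x ∈ T.domain, T ⟨R x, h⟩ = x) ∧ ∀ φ : T.domain, R (T φ) = φ

open Classical in
/-- The bounded inverse `T⁻¹` (with the value `0` if there is none). -/
def boundedInverse (T : E →ₗ.[ℂ] E) : E →L[ℂ] E :=
  if h : ∃ R, IsBoundedInverse T R then h.choose else 0

/-- The operator `z - T` on `dom T`. -/
def shift (z : ℂ) (T : E →ₗ.[ℂ] E) : E →ₗ.[ℂ] E :=
  ⟨T.domain, z • T.domain.subtype - T.toFun⟩

/-- The spectrum of an unbounded operator: the `z` for which `z - T` has no bounded inverse. -/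
def opSpectrum (T : E →ₗ.[ℂ] E) : Set ℂ :=
  {z | ¬ ∃ R, IsBoundedInverse (shift z T) R}

/-- The gap `min (1, dist (I, σ(T) \ (σ(T) ∩ I)))`; the distance to the empty set is `∞`. -/
def gap (T : E →ₗ.[ℂ] E) (I : Set ℝ) : ℝ≥0∞ :=
  min 1 (⨅ x ∈ I, Metric.infEDist (x : ℂ)
    (opSpectrum T \ (opSpectrum T ∩ (fun y : ℝ => (y : ℂ)) '' I)))

section Functional

variable [CompleteSpace E]

open Classical in
/-- The spectral projector `1_I(T)` of a self-adjoint operator `T` with bounded inverse, obtained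
from the functional calculus of the bounded self-adjoint operator `T⁻¹`, as `f(T⁻¹)` with
`f(μ) = 1` if `μ ≠ 0` and `1 / μ ∈ I`, and `f(μ) = 0` otherwise. If `I` is bounded and separated
from the rest of the spectrum of `T`, then `f` is continuous on the spectrum of `T⁻¹`. -/
def spectralProjector (T : E →ₗ.[ℂ] E) (I : Set ℝ) : E →L[ℂ] E :=
  cfc (fun μ : ℝ => if μ ≠ 0 ∧ μ⁻¹ ∈ I then (1 : ℝ) else 0) (boundedInverse T)

/-- `T^{-1/2}`, the square root of the inverse of a positive operator `T` with bounded inverse. -/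
def invSqrt (T : E →ₗ.[ℂ] E) : E →L[ℂ] E :=
  cfc Real.sqrt (boundedInverse T)

/-- `T^{1/2}`, the (in general unbounded) inverse of `T^{-1/2}`. -/
def sqrtOp (T : E →ₗ.[ℂ] E) : E →ₗ.[ℂ] E :=
  (ofBounded (invSqrt T)).inverse

end Functional

/-! ### The Liouvillian and its partial inverse -/

/-- `B` is in the domain of the Liouvillian `L_T = [T, ·]` and `L_T B = C`: the bounded operator `B`
preserves the domain of `T`, and the commutator `T B - B T`, defined on `dom T`, is the
restriction of the bounded operator `C`. -/
def IsLiouvillian (T : E →ₗ.[ℂ] E) (B C : E →L[ℂ] E) : Prop :=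
  ∀ φ : T.domain, ∃ h : B φ ∈ T.domain, T ⟨B φ, h⟩ - B (T φ) = C φ

/-- Off-diagonal operators with respect to the projector `P`. -/
def IsOffDiagonal (P B : E →L[ℂ] E) : Prop :=
  P * B * P = 0 ∧ (1 - P) * B * (1 - P) = 0

/-- The off-diagonal part of `A` with respect to the projector `P`. -/
def offDiagonalPart (P A : E →L[ℂ] E) : E →L[ℂ] E :=
  P * A * (1 - P) + (1 - P) * A * P

open Classical in
/-- The partial inverse `L⁺` of the Liouvillian `L_T`: the inverse of `L_T` on off-diagonal
operators with respect to `P`, extended by zero on diagonal operators. Thus `L⁺ A` is the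
off-diagonal `B` in the domain of `L_T` such that `L_T B` is the off-diagonal part of `A`. -/
def liouvillianInv (T : E →ₗ.[ℂ] E) (P A : E →L[ℂ] E) : E →L[ℂ] E :=
  if h : ∃ B, IsOffDiagonal P B ∧ IsLiouvillian T B (offDiagonalPart P A) then h.choose else 0

/-! ### Families of Hamiltonians with a common domain -/

variable {D : Submodule ℂ E}

/-- The operator `H(s)` with domain `D`. -/
def ham (H : ℝ → D →ₗ[ℂ] E) (s : ℝ) : E →ₗ.[ℂ] E := ⟨D, H s⟩

open Classical in
/-- The operator `H^{(l)}(s)` with domain `D`, `φ ↦ (d/ds)^l H(s) φ`, the derivatives being taken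
on `[0, T)`. This map is linear when all `s ↦ H(s) φ` are of class `C^l`. -/
def hamDeriv (H : ℝ → D →ₗ[ℂ] E) (T : ℝ) (l : ℕ) (s : ℝ) : E →ₗ.[ℂ] E :=
  ⟨D, if h : IsLinearMap ℂ
        (fun φ : D => iteratedDerivWithin l (fun r => H r φ) (Set.Ico 0 T) s)
      then h.mk' _ else 0⟩

/-- `α_l`, the supremum over `s ∈ [0, T)` of the operator norm of `H^{(l)}(s) H(s)⁻¹`. -/
def alpha (H : ℝ → D →ₗ[ℂ] E) (T : ℝ) (l : ℕ) : ℝ≥0∞ :=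
  ⨆ s ∈ Set.Ico 0 T, opENorm (mul (hamDeriv H T l s) (ofBounded (boundedInverse (ham H s))))

/-- `H(s) ≥ 1` for all `s ∈ [0, T)`. -/
def HypH1 (H : ℝ → D →ₗ[ℂ] E) (T : ℝ) : Prop :=
  ∀ s ∈ Set.Ico 0 T, ∀ φ : D, ‖(φ : E)‖ ^ 2 ≤ (⟪(φ : E), H s φ⟫_ℂ).re

section Complete

variable [CompleteSpace E]

/-- Strong `C^n` regularity, (restrictions to `D` of) self-adjoint derivatives, relative
boundedness. -/
def HypH2 (H : ℝ → D →ₗ[ℂ] E) (T : ℝ) (n : ℕ) : Prop :=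
  (∀ φ : D, ContDiffOn ℝ n (fun s => H s φ) (Set.Ico 0 T)) ∧
  ∀ l : ℕ, 1 ≤ l → l ≤ n →
    (∀ s ∈ Set.Ico 0 T, ∃ S : E →ₗ.[ℂ] E, IsSelfAdjoint S ∧ hamDeriv H T l s ≤ S) ∧
    alpha H T l < ⊤

/-- The spectral projector `P(s) = 1_{[a(s), b(s)]}(H(s))`. -/
def proj (H : ℝ → D →ₗ[ℂ] E) (a b : ℝ → ℝ) (s : ℝ) : E →L[ℂ] E :=
  spectralProjector (ham H s) (Set.Icc (a s) (b s))

/-- Gap condition, and constant finite nonzero rank `N` of the spectral projector. -/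
def HypH3 (H : ℝ → D →ₗ[ℂ] E) (T : ℝ) (a b : ℝ → ℝ) (M : ℝ) (N : ℕ) : Prop :=
  ContinuousOn a (Set.Icc 0 T) ∧ ContinuousOn b (Set.Icc 0 T) ∧
  (∀ s ∈ Set.Icc 0 T, 0 ≤ a s ∧ a s ≤ b s ∧ b s ≤ M) ∧
  1 ≤ N ∧
  ∀ s ∈ Set.Ico 0 T, 0 < gap (ham H s) (Set.Icc (a s) (b s)) ∧
    Module.finrank ℂ (LinearMap.range (proj H a b s : E →ₗ[ℂ] E)) = N

/-- The derivative `Ṗ(s)` in operator norm, on `[0, T)`. -/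
def projDeriv (H : ℝ → D →ₗ[ℂ] E) (T : ℝ) (a b : ℝ → ℝ) (s : ℝ) : E →L[ℂ] E :=
  derivWithin (proj H a b) (Set.Ico 0 T) s

/-- The operator `L⁺(s) Ṗ(s)`. -/
def corrector (H : ℝ → D →ₗ[ℂ] E) (T : ℝ) (a b : ℝ → ℝ) (s : ℝ) : E →L[ℂ] E :=
  liouvillianInv (ham H s) (proj H a b s) (projDeriv H T a b s)

/-- `U` is a strongly continuous unitary propagator for the time-scaled family `H(ε t)`, where
`0 ≤ t' ≤ t` and `ε t < T`: it satisfies `i ∂U/∂t (t,t') = H(ε t) U(t,t')` strongly on `D`, and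
`U(t',t') = Id`. -/
structure IsPropagator (H : ℝ → D →ₗ[ℂ] E) (T ε : ℝ) (U : ℝ → ℝ → E →L[ℂ] E) : Prop where
  unitary_mem : ∀ t' t, 0 ≤ t' → t' ≤ t → ε * t < T → U t t' ∈ unitary (E →L[ℂ] E)
  apply_self : ∀ t, 0 ≤ t → ε * t < T → U t t = 1
  comp : ∀ t' r t, 0 ≤ t' → t' ≤ r → r ≤ t → ε * t < T → U t r * U r t' = U t t'
  strong_continuous : ∀ x : E, ContinuousOn (fun p : ℝ × ℝ => U p.1 p.2 x)
    {p | 0 ≤ p.2 ∧ p.2 ≤ p.1 ∧ ε * p.1 < T}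
  schrodinger : ∀ t' t, 0 ≤ t' → t' ≤ t → ε * t < T → ∀ φ : D, ∃ h : U t t' φ ∈ D,
    HasDerivWithinAt (fun τ => U τ t' φ) (-Complex.I • H (ε * t) ⟨U t t' φ, h⟩)
      {τ | t' ≤ τ ∧ ε * τ < T} t

end Complete

end Adiabatic

end

/-!
Everything is expressed through the bounded inverses `R s = (H s)⁻¹`, which satisfy `0 ≤ R s ≤ 1`,
since domains then disappear: `ψ ∈ D` with `H s ψ = χ` means `ψ = R s χ`, and `[H, B] = C` means
`[R, B] = -R C R`.

**Propagator and its bounds.** The equation `i ψ' = H(ε t) ψ` is approximated by the equations with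
the bounded generators `(R + δ)⁻¹`. For these, `χ = (R + δ)⁻¹ ψ` satisfies
`|d/dt ‖χ‖²| ≤ 2 ε α₁ ‖χ‖²`, because the skew-adjoint part of the equation drops out of the
derivative of the norm. This energy estimate (`norm_yosida_apply_le`) is uniform in `δ`, and it shows
at the same time that solutions with initial values in `D` converge as `δ → 0`, that the limit stays
in `D`, by Douglas' lemma, and that `‖H(ε t) ψ(t)‖ ≤ e^{α₁ ε |t - r|} ‖H(ε r) ψ(r)‖` for all `t`, `r`.
Used for both orders of `t` and `r`, the last bound turns the weak continuity of `H(ε t) ψ(t)` into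
continuity, so that the limit is a strong solution (`IsLimitSolution.exists_isStrongSolution`). Strong
solutions conserve the norm, which gives uniqueness and the unitary propagator
(`exists_isPropagator`). The energy bound is the first bound in the statement; operator monotonicity
of the square root gives the second one (`exists_cfc_sqrt_apply_eq`).

**Smoothness of the projectors.** The projector `P s` is a function of `R s`, for a part of the
spectrum that is enclosed in a disc which avoids the rest of it. Hence `B ↦ [R, B]` is invertible on
off-diagonal operators, by a Neumann series (`IsGapProjection.isUnit_sylvester`). Constancy of the
rank gives norm continuity of `P`, then the identity `[R₀, P - P₀] = [P, R - R₀]` on off-diagonal parts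
gives its derivative: `Ṗ` solves `[R, Ṗ] = [P, Ṙ]`. For `n = 2` the second derivative of `R` exists
only strongly; but `P` has finite rank, and a product `Ṙ P` is then differentiable in norm, so that
`Ṗ` is of class `C¹` in norm (`contDiffOn_derivWithin_projection`). The corrector `X = L⁺ Ṗ` is the
off-diagonal solution of `[R, X] = -R Ṗ R`, so it is of class `C¹` too.

**Expansion.** The observable `Y = P + i ε X` has the total derivative
`ε Ẏ + i [H, Y] = ε Ṗ + i ε² Ẋ + i (i ε Ṗ) = i ε² Ẋ` along the evolution, and the Duhamel formula
`IsPropagator.sub_conj_eq_integral` is the claim. The integrand is norm continuous because `Ẋ` has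
finite rank.
-/

namespace Adiabatic

open Filter Topology

/-! ### Grönwall's inequality, Douglas' lemma and weak convergence -/

section Hilbert

variable {E : Type*} [NormedAddCommGroup E] [InnerProductSpace ℂ E]

theorem hasDerivWithinAt_norm_sq {u : ℝ → E} {u' : E} {S : Set ℝ} {t : ℝ}
    (h : HasDerivWithinAt u u' S t) :
    HasDerivWithinAt (fun r => ‖u r‖ ^ 2) (2 * (⟪u t, u'⟫_ℂ).re) S t := by
  have h1 := (Complex.reCLM.hasFDerivAt (x := ⟪u t, u t⟫_ℂ)).comp_hasDerivWithinAt t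
    (h.inner ℂ h)
  have e1 : (⟪u', u t⟫_ℂ).re = (⟪u t, u'⟫_ℂ).re := inner_re_symm (𝕜 := ℂ) _ _
  have e2 : Complex.reCLM (⟪u t, u'⟫_ℂ + ⟪u', u t⟫_ℂ) = 2 * (⟪u t, u'⟫_ℂ).re := by
    simp only [Complex.reCLM_apply, Complex.add_re]
    rw [e1]; ring
  rw [e2] at h1
  refine h1.congr (fun r _ => ?_) ?_
  · exact norm_sq_eq_re_inner (𝕜 := ℂ) (u r)
  · exact norm_sq_eq_re_inner (𝕜 := ℂ) (u t)

/-- Two-sided Grönwall estimate, in terms of the logarithmic derivative of the norm. -/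
theorem norm_le_exp_mul_norm {u u' : ℝ → E} {S : Set ℝ} (hS : Convex ℝ S) {β : ℝ}
    (hu : ∀ t ∈ S, HasDerivWithinAt u (u' t) S t)
    (hb : ∀ t ∈ S, |(⟪u t, u' t⟫_ℂ).re| ≤ β * ‖u t‖ ^ 2) {s t : ℝ} (hs : s ∈ S) (ht : t ∈ S) :
    ‖u t‖ ≤ Real.exp (β * |t - s|) * ‖u s‖ := by
  have key : ∀ c : ℝ, ∀ r ∈ S, HasDerivWithinAt (fun r => Real.exp (c * r) * ‖u r‖ ^ 2)
      (Real.exp (c * r) * (c * ‖u r‖ ^ 2 + 2 * (⟪u r, u' r⟫_ℂ).re)) S r := by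
    intro c r hr
    have h1 : HasDerivWithinAt (fun r => Real.exp (c * r)) (Real.exp (c * r) * (c * 1)) S r :=
      ((hasDerivWithinAt_id r S).const_mul c).exp
    exact (h1.mul (hasDerivWithinAt_norm_sq (hu r hr))).congr_deriv (by ring)
  have hd : ∀ c : ℝ, ∀ r ∈ interior S, HasDerivAt (fun r => Real.exp (c * r) * ‖u r‖ ^ 2)
      (Real.exp (c * r) * (c * ‖u r‖ ^ 2 + 2 * (⟪u r, u' r⟫_ℂ).re)) r := fun c r hr =>
    (key c r (interior_subset hr)).hasDerivAt (mem_interior_iff_mem_nhds.1 hr)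
  have hanti : AntitoneOn (fun r => Real.exp ((-2 * β) * r) * ‖u r‖ ^ 2) S := by
    refine antitoneOn_of_deriv_nonpos hS (fun r hr => (key _ r hr).continuousWithinAt)
      (fun r hr => (hd _ r hr).differentiableAt.differentiableWithinAt) (fun r hr => ?_)
    rw [(hd _ r hr).deriv]
    have := (abs_le.1 (hb r (interior_subset hr))).2
    exact mul_nonpos_of_nonneg_of_nonpos (Real.exp_pos _).le (by linarith)
  have hmono : MonotoneOn (fun r => Real.exp ((2 * β) * r) * ‖u r‖ ^ 2) S := by
    refine monotoneOn_of_deriv_nonneg hS (fun r hr => (key _ r hr).continuousWithinAt)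
      (fun r hr => (hd _ r hr).differentiableAt.differentiableWithinAt) (fun r hr => ?_)
    rw [(hd _ r hr).deriv]
    have := (abs_le.1 (hb r (interior_subset hr))).1
    exact mul_nonneg (Real.exp_pos _).le (by linarith)
  have hsq : ‖u t‖ ^ 2 ≤ (Real.exp (β * |t - s|) * ‖u s‖) ^ 2 := by
    rw [mul_pow, ← Real.exp_nat_mul]
    rcases le_total s t with h | h
    · have h2 : Real.exp ((-2 * β) * t) * ‖u t‖ ^ 2 ≤ Real.exp ((-2 * β) * s) * ‖u s‖ ^ 2 :=
        hanti hs ht h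
      rw [abs_of_nonneg (sub_nonneg.2 h)]
      have e : ((2 : ℕ) : ℝ) * (β * (t - s)) = (2 * β * t) + (-2 * β * s) := by push_cast; ring
      rw [e, Real.exp_add, mul_assoc]
      calc ‖u t‖ ^ 2 = Real.exp (2 * β * t) * (Real.exp ((-2 * β) * t) * ‖u t‖ ^ 2) := by
            rw [← mul_assoc, ← Real.exp_add]; simp
        _ ≤ _ := by gcongr
    · have h2 : Real.exp ((2 * β) * t) * ‖u t‖ ^ 2 ≤ Real.exp ((2 * β) * s) * ‖u s‖ ^ 2 :=
        hmono ht hs h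
      rw [abs_of_nonpos (sub_nonpos.2 h)]
      have e : ((2 : ℕ) : ℝ) * (β * -(t - s)) = (-2 * β * t) + (2 * β * s) := by push_cast; ring
      rw [e, Real.exp_add, mul_assoc]
      calc ‖u t‖ ^ 2 = Real.exp (-2 * β * t) * (Real.exp ((2 * β) * t) * ‖u t‖ ^ 2) := by
            rw [← mul_assoc, ← Real.exp_add]; simp
        _ ≤ _ := by gcongr
  exact le_of_sq_le_sq hsq (by positivity)

theorem norm_eq_of_re_inner_deriv_eq_zero {u u' : ℝ → E} {S : Set ℝ} (hS : Convex ℝ S)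
    (hu : ∀ t ∈ S, HasDerivWithinAt u (u' t) S t)
    (hb : ∀ t ∈ S, (⟪u t, u' t⟫_ℂ).re = 0) {s t : ℝ} (hs : s ∈ S) (ht : t ∈ S) :
    ‖u t‖ = ‖u s‖ := by
  have h := fun {s t : ℝ} (hs : s ∈ S) (ht : t ∈ S) =>
    norm_le_exp_mul_norm (β := 0) hS hu (fun r hr => by simp [hb r hr]) hs ht
  simp only [zero_mul, Real.exp_zero, one_mul] at h
  exact le_antisymm (h hs ht) (h ht hs)

/-- Douglas' lemma for one vector: `ψ` is in the range of `T*` as soon as the functional `⟪ψ, ·⟫`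
is bounded with respect to `‖T ·‖`. -/
theorem exists_adjoint_apply_eq [CompleteSpace E] (T : E →L[ℂ] E)
    (hT : Function.Injective T) {C : ℝ} (hC : 0 ≤ C) (ψ : E)
    (h : ∀ z, ‖⟪ψ, z⟫_ℂ‖ ≤ C * ‖T z‖) :
    ∃ χ : E, ‖χ‖ ≤ C ∧ ContinuousLinearMap.adjoint T χ = ψ := by
  let e : E ≃ₗ[ℂ] LinearMap.range (T : E →ₗ[ℂ] E) := LinearEquiv.ofInjective (T : E →ₗ[ℂ] E) hT
  let f : StrongDual ℂ (LinearMap.range (T : E →ₗ[ℂ] E)) :=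
    LinearMap.mkContinuous ((innerSL ℂ ψ : E →ₗ[ℂ] ℂ) ∘ₗ e.symm.toLinearMap) C (by
      intro y
      obtain ⟨z, rfl⟩ := e.surjective y
      have h1 : ‖e z‖ = ‖T z‖ := rfl
      rw [h1]
      simpa using h z)
  obtain ⟨g, hg, hgn⟩ := exists_extension_norm_eq _ f
  refine ⟨(InnerProductSpace.toDual ℂ E).symm g, ?_, ?_⟩
  · rw [LinearIsometryEquiv.norm_map, hgn]
    exact LinearMap.mkContinuous_norm_le _ hC _
  · refine ext_inner_right ℂ fun z => ?_
    rw [ContinuousLinearMap.adjoint_inner_left, InnerProductSpace.toDual_symm_apply]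
    have h1 := hg (e z)
    have h2 : f (e z) = ⟪ψ, z⟫_ℂ := by
      simp [f, LinearMap.mkContinuous_apply]
    rw [h2] at h1
    exact h1

/-- Weakly continuous vectors whose norms converge are strongly continuous. -/
theorem tendsto_of_tendsto_inner_of_norm_le {ι : Type*} {l : Filter ι} {u : ι → E} {x : E}
    {g : ι → ℝ} (hw : Tendsto (fun i => ⟪x, u i⟫_ℂ) l (nhds ⟪x, x⟫_ℂ))
    (hn : ∀ᶠ i in l, ‖u i‖ ≤ g i) (hg : Tendsto g l (nhds ‖x‖)) :
    Tendsto u l (nhds x) := by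
  rw [tendsto_iff_norm_sub_tendsto_zero]
  have hre : Tendsto (fun i => (⟪x, u i⟫_ℂ).re) l (nhds (‖x‖ ^ 2)) := by
    have := (Complex.continuous_re.tendsto _).comp hw
    rwa [show (⟪x, x⟫_ℂ).re = ‖x‖ ^ 2 from (norm_sq_eq_re_inner (𝕜 := ℂ) x).symm] at this
  have h2 : Tendsto (fun i => g i ^ 2 - 2 * (⟪x, u i⟫_ℂ).re + ‖x‖ ^ 2) l (nhds 0) := by
    have := ((hg.pow 2).sub (hre.const_mul 2)).add (tendsto_const_nhds (x := ‖x‖ ^ 2))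
    convert this using 2
    ring
  have h3 : Tendsto (fun i => ‖u i - x‖ ^ 2) l (nhds 0) := by
    refine tendsto_of_tendsto_of_tendsto_of_le_of_le' tendsto_const_nhds h2
      (Eventually.of_forall fun i => sq_nonneg _) ?_
    filter_upwards [hn] with i hi
    have e := norm_sub_sq (𝕜 := ℂ) (u i) x
    have e1 : RCLike.re ⟪u i, x⟫_ℂ = (⟪x, u i⟫_ℂ).re := inner_re_symm (𝕜 := ℂ) _ _
    rw [e1] at e
    rw [e]
    have : ‖u i‖ ^ 2 ≤ g i ^ 2 := by gcongr
    linarith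
  have h4 := (Real.continuous_sqrt.tendsto 0).comp h3
  simpa [Function.comp_def, Real.sqrt_sq] using h4

/-- Radial retraction onto a ball, as a globally Lipschitz map. -/
theorem lipschitzWith_radial {r : ℝ} (hr : 0 < r) :
    LipschitzWith 2 (fun u : E => (((r / max r ‖u‖ : ℝ) : ℂ)) • u) := by
  refine LipschitzWith.of_dist_le_mul fun u v => ?_
  rw [dist_eq_norm, dist_eq_norm]
  set mu := max r ‖u‖ with hmu
  set mv := max r ‖v‖ with hmv
  have hmu0 : 0 < mu := lt_max_of_lt_left hr
  have hmv0 : 0 < mv := lt_max_of_lt_left hr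
  have hd : |mv - mu| ≤ ‖u - v‖ := by
    rw [abs_sub_comm]
    calc |mu - mv| ≤ |‖u‖ - ‖v‖| := by
          have := abs_max_sub_max_le_max r ‖u‖ r ‖v‖
          simpa using this
      _ ≤ ‖u - v‖ := abs_norm_sub_norm_le u v
  have e : (((r / mu : ℝ) : ℂ)) • u - (((r / mv : ℝ) : ℂ)) • v
      = (((r / mu : ℝ) : ℂ)) • (u - v) + (((r * (mv - mu) / (mu * mv) : ℝ) : ℂ)) • v := by
    rw [show r * (mv - mu) / (mu * mv) = r / mu - r / mv by field_simp]
    push_cast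
    module
  rw [e]
  refine (norm_add_le _ _).trans ?_
  rw [norm_smul, norm_smul, Complex.norm_real, Complex.norm_real, Real.norm_eq_abs,
    Real.norm_eq_abs, abs_of_nonneg (by positivity : 0 ≤ r / mu), abs_div, abs_mul,
    abs_of_pos hr, abs_of_pos (mul_pos hmu0 hmv0)]
  have h1 : r / mu ≤ 1 := (div_le_one hmu0).2 (le_max_left _ _)
  have h2 : ‖v‖ ≤ mv := le_max_right _ _
  have h3 : r * |mv - mu| / (mu * mv) * ‖v‖ ≤ ‖u - v‖ := by
    calc r * |mv - mu| / (mu * mv) * ‖v‖ = (r / mu) * |mv - mu| * (‖v‖ / mv) := by field_simp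
      _ ≤ 1 * ‖u - v‖ * 1 := by
          gcongr
          exact (div_le_one hmv0).2 h2
      _ = ‖u - v‖ := by ring
  have h4 : r / mu * ‖u - v‖ ≤ 1 * ‖u - v‖ := by gcongr
  rw [NNReal.coe_ofNat]
  linarith

end Hilbert

/-! ### Bounded inverses of unbounded operators -/

section Unbounded

variable {E : Type*} [NormedAddCommGroup E] [InnerProductSpace ℂ E]

theorem mem_mul_domain {A B : E →ₗ.[ℂ] E} {x : E} :
    x ∈ (mul A B).domain ↔ ∃ h : x ∈ B.domain, B ⟨x, h⟩ ∈ A.domain := by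
  constructor
  · rintro ⟨⟨y, hy, rfl⟩, hx⟩
    exact ⟨hx, hy⟩
  · rintro ⟨h, h'⟩
    exact ⟨⟨⟨x, h⟩, h', rfl⟩, h⟩

theorem mul_apply {A B : E →ₗ.[ℂ] E} {x : E} (hx : x ∈ (mul A B).domain) (h : x ∈ B.domain)
    (h' : B ⟨x, h⟩ ∈ A.domain) : mul A B ⟨x, hx⟩ = A ⟨B ⟨x, h⟩, h'⟩ := rfl

theorem mem_mul_ofBounded_domain {A : E →ₗ.[ℂ] E} {B : E →L[ℂ] E} {x : E} :
    x ∈ (mul A (ofBounded B)).domain ↔ B x ∈ A.domain := by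
  rw [mem_mul_domain]
  exact ⟨fun ⟨_, h⟩ => h, fun h => ⟨trivial, h⟩⟩

theorem opENorm_le_ofReal {A : E →ₗ.[ℂ] E} {c : ℝ} (hc : 0 ≤ c)
    (h : ∀ x : E, ∃ hx : x ∈ A.domain, ‖A ⟨x, hx⟩‖ ≤ c * ‖x‖) : opENorm A ≤ ENNReal.ofReal c := by
  have htop : A.domain = ⊤ := Submodule.eq_top_iff'.2 fun x => (h x).1
  rw [opENorm, if_pos htop]
  refine iSup_le fun x => iSup_le fun hx => ?_
  obtain ⟨hx', hle⟩ := h x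
  rw [← ofReal_norm]
  refine ENNReal.ofReal_le_ofReal (hle.trans ?_)
  calc c * ‖(x : E)‖ ≤ c * 1 := by gcongr
    _ = c := mul_one c

theorem norm_le_of_opENorm_lt_top {A : E →ₗ.[ℂ] E} {c : ℝ≥0∞} (hc : c < ⊤) (h : opENorm A ≤ c)
    (x : A.domain) : ‖A x‖ ≤ c.toReal * ‖(x : E)‖ := by
  have htop : A.domain = ⊤ := by
    by_contra hne
    rw [opENorm, if_neg hne] at h
    exact absurd h (not_le.2 hc)
  rw [opENorm, if_pos htop] at h
  by_cases hx : (x : E) = 0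
  · have : x = 0 := Subtype.ext hx
    simp [this]
  have hpos : 0 < ‖(x : E)‖ := norm_pos_iff.2 hx
  set y : A.domain := ((‖(x : E)‖⁻¹ : ℝ) : ℂ) • x with hy
  have hyn : ‖(y : E)‖ ≤ 1 := by
    rw [hy, Submodule.coe_smul, norm_smul, Complex.norm_real, norm_inv, norm_norm,
      inv_mul_cancel₀ hpos.ne']
  have h1 : ‖A y‖ₑ ≤ c := (le_iSup₂_of_le (f := fun (x : A.domain) (_ : ‖(x : E)‖ ≤ 1) => ‖A x‖ₑ)
    y hyn le_rfl).trans h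
  have h2 : ‖A y‖ ≤ c.toReal := by
    have := ENNReal.toReal_mono hc.ne h1
    simpa using this
  rw [hy, LinearPMap.map_smul, norm_smul, Complex.norm_real, norm_inv, norm_norm] at h2
  rwa [inv_mul_le_iff₀ hpos, mul_comm] at h2

theorem IsBoundedInverse.unique {T : E →ₗ.[ℂ] E} {R R' : E →L[ℂ] E} (h : IsBoundedInverse T R)
    (h' : IsBoundedInverse T R') : R = R' := by
  ext x
  obtain ⟨hx, e⟩ := h'.1 x
  have := h.2 ⟨R' x, hx⟩
  rw [e] at this
  exact this

theorem boundedInverse_eq {T : E →ₗ.[ℂ] E} {R : E →L[ℂ] E} (h : IsBoundedInverse T R) :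
    boundedInverse T = R := by
  have hex : ∃ R, IsBoundedInverse T R := ⟨R, h⟩
  rw [boundedInverse, dif_pos hex]
  exact hex.choose_spec.unique h

variable [CompleteSpace E]

theorem inner_apply_left_of_isSelfAdjoint {T : E →ₗ.[ℂ] E} (hT : IsSelfAdjoint T) (x y : T.domain) :
    ⟪T x, (y : E)⟫_ℂ = ⟪(x : E), T y⟫_ℂ := by
  have h := T.adjoint_isFormalAdjoint hT.dense_domain
  rw [LinearPMap.isSelfAdjoint_def.1 hT] at h
  exact h x y

/-- A self-adjoint operator `T ≥ 1` has a bounded everywhere defined inverse. -/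
theorem exists_isBoundedInverse {T : E →ₗ.[ℂ] E} (hT : IsSelfAdjoint T)
    (h1 : ∀ φ : T.domain, ‖(φ : E)‖ ^ 2 ≤ (⟪(φ : E), T φ⟫_ℂ).re) :
    ∃ R : E →L[ℂ] E, IsBoundedInverse T R := by
  have hlow : ∀ φ : T.domain, ‖(φ : E)‖ ≤ ‖T φ‖ := by
    intro φ
    have h2 := (h1 φ).trans ((Complex.re_le_norm _).trans (norm_inner_le_norm _ _))
    rcases (norm_nonneg (φ : E)).eq_or_lt with h0 | h0
    · rw [← h0]; positivity
    · rw [sq] at h2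
      exact le_of_mul_le_mul_left h2 h0
  -- the range is closed because `T` is closed and bounded below
  have hclosed : IsClosed (LinearMap.range T.toFun : Set E) := by
    rw [← isSeqClosed_iff_isClosed]
    intro y x hy hx
    choose φ hφ using hy
    have hc : CauchySeq (fun n => (φ n : E)) := by
      have hyc := hx.cauchySeq
      rw [Metric.cauchySeq_iff'] at hyc ⊢
      intro e he
      obtain ⟨N, hN⟩ := hyc e he
      refine ⟨N, fun n hn => lt_of_le_of_lt ?_ (hN n hn)⟩
      rw [dist_eq_norm, dist_eq_norm, ← hφ, ← hφ, ← map_sub]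
      exact hlow (φ n - φ N)
    obtain ⟨z, hz⟩ := cauchySeq_tendsto_of_complete hc
    have hg : (z, x) ∈ T.graph := by
      refine hT.isClosed.mem_of_tendsto (hz.prodMk_nhds hx) (Eventually.of_forall fun n => ?_)
      rw [SetLike.mem_coe, LinearPMap.mem_graph_iff]
      exact ⟨φ n, rfl, hφ n⟩
    rw [LinearPMap.mem_graph_iff] at hg
    obtain ⟨w, -, hw⟩ := hg
    exact ⟨w, hw⟩
  have hperp : (LinearMap.range T.toFun)ᗮ = ⊥ := by
    rw [Submodule.eq_bot_iff]
    intro y hy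
    rw [Submodule.mem_orthogonal'] at hy
    have hz : ∀ x : T.domain, ⟪(0 : E), (x : E)⟫_ℂ = ⟪y, T x⟫_ℂ := fun x => by
      rw [inner_zero_left]; exact (hy _ ⟨x, rfl⟩).symm
    have hmem : y ∈ T.domain := by
      have := T.mem_adjoint_domain_of_exists y ⟨0, hz⟩
      rwa [LinearPMap.isSelfAdjoint_def.1 hT] at this
    have h3 := h1 ⟨y, hmem⟩
    rw [← inner_apply_left_of_isSelfAdjoint hT ⟨y, hmem⟩ ⟨y, hmem⟩] at h3
    have h4 : ⟪T ⟨y, hmem⟩, y⟫_ℂ = 0 := by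
      rw [← inner_conj_symm]
      simp [hy _ (⟨⟨y, hmem⟩, rfl⟩ : T ⟨y, hmem⟩ ∈ LinearMap.range T.toFun)]
    rw [h4] at h3
    have h5 : ‖y‖ ^ 2 ≤ 0 := h3
    exact norm_eq_zero.1 (pow_eq_zero_iff two_ne_zero |>.1 (le_antisymm h5 (sq_nonneg _)))
  have htop : LinearMap.range T.toFun = ⊤ := by
    have : CompleteSpace (LinearMap.range T.toFun) := hclosed.completeSpace_coe
    exact (Submodule.orthogonal_eq_bot_iff).1 hperp
  have hinj : Function.Injective T.toFun := by
    rw [injective_iff_map_eq_zero]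
    intro φ hφ
    have := hlow φ
    rw [show T φ = 0 from hφ, norm_zero] at this
    exact Subtype.ext (norm_le_zero_iff.1 this)
  let e : T.domain ≃ₗ[ℂ] E := LinearEquiv.ofBijective T.toFun ⟨hinj, LinearMap.range_eq_top.1 htop⟩
  let R : E →L[ℂ] E := LinearMap.mkContinuous (T.domain.subtype ∘ₗ e.symm.toLinearMap) 1 (by
    intro x
    obtain ⟨φ, rfl⟩ := e.surjective x
    simpa using! hlow φ)
  refine ⟨R, fun x => ⟨(e.symm x).2, ?_⟩, fun φ => ?_⟩
  · exact e.apply_symm_apply x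
  · have : e.symm (T φ) = φ := e.symm_apply_apply φ
    exact congrArg Subtype.val this

end Unbounded

/-! ### Strong derivatives and regularized inverses -/

section StrongCalculus

variable {E : Type*} [NormedAddCommGroup E] [InnerProductSpace ℂ E]

/-- Strong convergence of uniformly bounded operators may be combined with convergence of vectors. -/
theorem tendsto_clm_apply_of_norm_le {ι : Type*} {l : Filter ι} {B : ι → E →L[ℂ] E} {v : ι → E}
    {x y : E} {C : ℝ} (hB : ∀ᶠ i in l, ∀ z, ‖B i z‖ ≤ C * ‖z‖)
    (hx : Tendsto (fun i => B i x) l (nhds y)) (hv : Tendsto v l (nhds x)) :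
    Tendsto (fun i => B i (v i)) l (nhds y) := by
  have h1 : Tendsto (fun i => B i (v i - x)) l (nhds 0) := by
    refine squeeze_zero_norm' (hB.mono fun i hi => hi _) ?_
    have := (tendsto_iff_norm_sub_tendsto_zero.1 hv).const_mul C
    simpa using this
  have := h1.add hx
  simpa using this

/-- If `B` is only strongly continuous, then `r ↦ B r (f r - f t)` still has the derivative
`B t f'` at `t`. -/
theorem hasDerivWithinAt_clm_apply_sub {S : Set ℝ} {t : ℝ} {B : ℝ → E →L[ℂ] E} {f : ℝ → E}
    {f' : E} {C : ℝ} (hB : ∀ r ∈ S, ∀ z, ‖B r z‖ ≤ C * ‖z‖)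
    (hc : ContinuousWithinAt (fun r => B r f') S t) (hf : HasDerivWithinAt f f' S t) :
    HasDerivWithinAt (fun r => B r (f r - f t)) (B t f') S t := by
  rw [hasDerivWithinAt_iff_tendsto_slope] at hf ⊢
  have e : slope (fun r => B r (f r - f t)) t = fun r => B r (slope f t r) := by
    funext r
    simp only [slope_def_module, sub_self, map_zero, sub_zero]
    exact ((B r).map_smul_of_tower _ _).symm
  rw [e]
  refine tendsto_clm_apply_of_norm_le (C := C) ?_
    (hc.mono_left (nhdsWithin_mono _ Set.sdiff_subset)) hf
  filter_upwards [self_mem_nhdsWithin] with r hr using hB r hr.1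

/-- Product rule for a bounded family of operators that is only strongly differentiable. -/
theorem hasDerivWithinAt_strong_clm_apply {S : Set ℝ} {t : ℝ} {B : ℝ → E →L[ℂ] E} {f : ℝ → E}
    {f' b' : E} {C : ℝ} (hB : ∀ r ∈ S, ∀ z, ‖B r z‖ ≤ C * ‖z‖)
    (hc : ContinuousWithinAt (fun r => B r f') S t)
    (hb : HasDerivWithinAt (fun r => B r (f t)) b' S t) (hf : HasDerivWithinAt f f' S t) :
    HasDerivWithinAt (fun r => B r (f r)) (b' + B t f') S t := by
  have := hb.add (hasDerivWithinAt_clm_apply_sub hB hc hf)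
  refine this.congr (fun r _ => ?_) ?_ <;> simp

theorem inner_apply_left_of_isPositive {R : E →L[ℂ] E} (hR : R.IsPositive) (x y : E) :
    ⟪R x, y⟫_ℂ = ⟪x, R y⟫_ℂ := hR.1 x y

theorem re_inner_neg_I_smul_eq_zero {R : E →L[ℂ] E} (hs : ∀ x y, ⟪R x, y⟫_ℂ = ⟪x, R y⟫_ℂ)
    (x : E) : (⟪x, -Complex.I • R x⟫_ℂ).re = 0 := by
  have h : (⟪x, R x⟫_ℂ).im = 0 := by
    have := hs x x
    rw [← inner_conj_symm] at this
    have h2 := congrArg Complex.im this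
    rw [Complex.conj_im] at h2
    linarith
  rw [inner_smul_right]
  simp [h]

/-- The bounded approximation `(T⁻¹ + δ)⁻¹` of a positive operator `T`, in terms of `R = T⁻¹`. -/
noncomputable def yosida (δ : ℝ) (R : E →L[ℂ] E) : E →L[ℂ] E :=
  Ring.inverse (R + algebraMap ℝ (E →L[ℂ] E) δ)

end StrongCalculus

section Regularization

variable {E : Type*} [NormedAddCommGroup E] [InnerProductSpace ℂ E] [CompleteSpace E]

theorem isUnit_add_algebraMap {R : E →L[ℂ] E} (hR : R.IsPositive) {δ : ℝ}
    (hδ : 0 < δ) : IsUnit (R + algebraMap ℝ (E →L[ℂ] E) δ) := by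
  by_contra h
  have hmem : -δ ∈ spectrum ℝ R := by
    rw [spectrum.mem_iff]
    intro hu
    apply h
    have := hu.neg
    rwa [map_neg, neg_sub, sub_neg_eq_add] at this
  have := spectrum_nonneg_of_nonneg (ContinuousLinearMap.nonneg_iff_isPositive _ |>.2 hR) hmem
  linarith

theorem apply_yosida_add {R : E →L[ℂ] E} (hR : R.IsPositive) {δ : ℝ}
    (hδ : 0 < δ) (x : E) : R (yosida δ R x) + (δ : ℂ) • yosida δ R x = x := by
  have := congrArg (fun B : E →L[ℂ] E => B x)
    (Ring.mul_inverse_cancel _ (isUnit_add_algebraMap hR hδ))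
  simpa [Algebra.algebraMap_eq_smul_one, yosida] using this

theorem yosida_apply_add {R : E →L[ℂ] E} (hR : R.IsPositive) {δ : ℝ}
    (hδ : 0 < δ) (x : E) : yosida δ R (R x) + (δ : ℂ) • yosida δ R x = x := by
  have := congrArg (fun B : E →L[ℂ] E => B x)
    (Ring.inverse_mul_cancel _ (isUnit_add_algebraMap hR hδ))
  simpa [Algebra.algebraMap_eq_smul_one, yosida] using this

theorem yosida_comm {R : E →L[ℂ] E} (hR : R.IsPositive) {δ : ℝ}
    (hδ : 0 < δ) (x : E) : yosida δ R (R x) = R (yosida δ R x) :=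
  add_right_cancel ((yosida_apply_add hR hδ x).trans (apply_yosida_add hR hδ x).symm)

theorem yosida_symm {R : E →L[ℂ] E} (hR : R.IsPositive) {δ : ℝ}
    (hδ : 0 < δ) (x y : E) : ⟪yosida δ R x, y⟫_ℂ = ⟪x, yosida δ R y⟫_ℂ := by
  nth_rw 1 [← apply_yosida_add hR hδ y]
  nth_rw 2 [← apply_yosida_add hR hδ x]
  rw [inner_add_left, inner_add_right, inner_apply_left_of_isPositive hR, inner_smul_left, inner_smul_right]
  simp

theorem norm_sq_yosida_le {R : E →L[ℂ] E} (hR : R.IsPositive) {δ : ℝ}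
    (hδ : 0 < δ) (x : E) :
    ‖R (yosida δ R x)‖ ^ 2 + (δ * ‖yosida δ R x‖) ^ 2 ≤ ‖x‖ ^ 2 := by
  nth_rw 3 [← apply_yosida_add hR hδ x]
  have e := norm_add_sq (𝕜 := ℂ) (R (yosida δ R x)) ((δ : ℂ) • yosida δ R x)
  rw [e, norm_smul, Complex.norm_real, Real.norm_eq_abs, abs_of_pos hδ, inner_smul_right, inner_apply_left_of_isPositive hR]
  have h2 : 0 ≤ (⟪yosida δ R x, R (yosida δ R x)⟫_ℂ).re := hR.re_inner_nonneg_right _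
  have h3 : RCLike.re ((δ : ℂ) * ⟪yosida δ R x, R (yosida δ R x)⟫_ℂ)
      = δ * (⟪yosida δ R x, R (yosida δ R x)⟫_ℂ).re := by simp
  rw [h3]
  have := mul_nonneg hδ.le h2
  linarith

theorem norm_apply_yosida_le {R : E →L[ℂ] E} (hR : R.IsPositive) {δ : ℝ}
    (hδ : 0 < δ) (x : E) : ‖R (yosida δ R x)‖ ≤ ‖x‖ := by
  have h := norm_sq_yosida_le hR hδ x
  exact le_of_sq_le_sq (by nlinarith [sq_nonneg (δ * ‖yosida δ R x‖)]) (norm_nonneg _)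

theorem norm_yosida_le {R : E →L[ℂ] E} (hR : R.IsPositive) {δ : ℝ}
    (hδ : 0 < δ) (x : E) : ‖yosida δ R x‖ ≤ δ⁻¹ * ‖x‖ := by
  have h := norm_sq_yosida_le hR hδ x
  rw [inv_mul_eq_div, le_div_iff₀ hδ, mul_comm]
  exact le_of_sq_le_sq (by nlinarith [sq_nonneg (‖R (yosida δ R x)‖)]) (norm_nonneg _)

end Regularization

/-! ### Families with a common domain, and the approximating equations -/

section Family

variable {E : Type*} [NormedAddCommGroup E] [InnerProductSpace ℂ E]

/-- A family `A t`, `t ∈ S`, of operators with common dense domain `D` and positive bounded inverses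
`R t` of norm at most `1`, strongly differentiable on `D`, whose derivative `A' t` is bounded by `β`
relative to `A t`. -/
structure InvertibleFamily {D : Submodule ℂ E} (S : Set ℝ) (β : ℝ) (A : ℝ → D →ₗ[ℂ] E)
    (A' : ℝ → D → E) (R : ℝ → E →L[ℂ] E) : Prop where
  dense : Dense (D : Set E)
  mem : ∀ t ∈ S, ∀ x, R t x ∈ D
  right : ∀ t ∈ S, ∀ x (h : R t x ∈ D), A t ⟨R t x, h⟩ = x
  left : ∀ t ∈ S, ∀ φ : D, R t (A t φ) = φ
  pos : ∀ t ∈ S, (R t).IsPositive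
  norm_le : ∀ t ∈ S, ∀ x, ‖R t x‖ ≤ ‖x‖
  deriv : ∀ t ∈ S, ∀ φ : D, HasDerivWithinAt (fun r => A r φ) (A' t φ) S t
  bound : ∀ t ∈ S, ∀ φ : D, ‖A' t φ‖ ≤ β * ‖A t φ‖

namespace InvertibleFamily

variable {D : Submodule ℂ E} {S : Set ℝ} {β : ℝ} {A : ℝ → D →ₗ[ℂ] E} {A' : ℝ → D → E}
  {R : ℝ → E →L[ℂ] E}

theorem mono (h : InvertibleFamily S β A A' R) {S' : Set ℝ} (hS : S' ⊆ S) :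
    InvertibleFamily S' β A A' R where
  dense := h.dense
  mem t ht := h.mem t (hS ht)
  right t ht := h.right t (hS ht)
  left t ht := h.left t (hS ht)
  pos t ht := h.pos t (hS ht)
  norm_le t ht := h.norm_le t (hS ht)
  deriv t ht φ := (h.deriv t (hS ht) φ).mono hS
  bound t ht := h.bound t (hS ht)

/-- Second resolvent identity. -/
theorem resolvent_sub (h : InvertibleFamily S β A A' R) {t r : ℝ} (ht : t ∈ S) (hr : r ∈ S)
    (x : E) : R r x - R t x
      = -R r (A r ⟨R t x, h.mem t ht x⟩ - A t ⟨R t x, h.mem t ht x⟩) := by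
  rw [map_sub, h.left r hr, h.right t ht x]
  simp

theorem continuousWithinAt_inv (h : InvertibleFamily S β A A' R) {t : ℝ} (ht : t ∈ S) (x : E) :
    ContinuousWithinAt (fun r => R r x) S t := by
  have hf := (h.deriv t ht ⟨R t x, h.mem t ht x⟩).continuousWithinAt
  rw [ContinuousWithinAt, tendsto_iff_norm_sub_tendsto_zero] at hf ⊢
  refine squeeze_zero' (Eventually.of_forall fun _ => norm_nonneg _) ?_ hf
  filter_upwards [self_mem_nhdsWithin] with r hr
  rw [h.resolvent_sub ht hr, norm_neg]
  exact h.norm_le r hr _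

theorem hasDerivWithinAt_inv (h : InvertibleFamily S β A A' R) {t : ℝ} (ht : t ∈ S) (x : E) :
    HasDerivWithinAt (fun r => R r x) (-R t (A' t ⟨R t x, h.mem t ht x⟩)) S t := by
  have h1 := hasDerivWithinAt_clm_apply_sub (B := R) (C := 1)
    (fun r hr z => by simpa using h.norm_le r hr z) (h.continuousWithinAt_inv ht _)
    (h.deriv t ht ⟨R t x, h.mem t ht x⟩)
  have h2 := h1.neg.add_const (R t x)
  refine h2.congr_of_mem (fun r hr => ?_) ht
  exact sub_eq_iff_eq_add.1 (h.resolvent_sub ht hr x)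

variable {δ : ℝ}

/-- Solutions of the Schrödinger equation for the bounded approximations. -/
def IsApproxSolution (S : Set ℝ) (R : ℝ → E →L[ℂ] E) (δ : ℝ) (ψ : ℝ → E) : Prop :=
  ∀ t ∈ S, HasDerivWithinAt ψ (-Complex.I • yosida δ (R t) (ψ t)) S t

theorem IsApproxSolution.sub {ψ ψ' : ℝ → E} (h : IsApproxSolution S R δ ψ)
    (h' : IsApproxSolution S R δ ψ') : IsApproxSolution S R δ (ψ - ψ') := fun t ht => by
  have := (h t ht).sub (h' t ht)
  rwa [← smul_sub, ← map_sub] at this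

variable [CompleteSpace E]

theorem yosida_sub (h : InvertibleFamily S β A A' R) (hδ : 0 < δ) {t r : ℝ} (ht : t ∈ S)
    (hr : r ∈ S) (x : E) : yosida δ (R r) x - yosida δ (R t) x
      = -yosida δ (R r) (R r (yosida δ (R t) x) - R t (yosida δ (R t) x)) := by
  have h1 := apply_yosida_add (h.pos t ht) hδ x
  have h2 := yosida_apply_add (h.pos r hr) hδ (yosida δ (R t) x)
  nth_rw 1 [← h1]
  rw [map_sub, map_add, map_smul]
  nth_rw 3 [← h2]
  abel

theorem continuousWithinAt_yosida (h : InvertibleFamily S β A A' R) (hδ : 0 < δ) {t : ℝ}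
    (ht : t ∈ S) (x : E) : ContinuousWithinAt (fun r => yosida δ (R r) x) S t := by
  have hf := h.continuousWithinAt_inv ht (yosida δ (R t) x)
  rw [ContinuousWithinAt, tendsto_iff_norm_sub_tendsto_zero] at hf ⊢
  have hf' := hf.const_mul δ⁻¹
  rw [mul_zero] at hf'
  refine squeeze_zero' (Eventually.of_forall fun _ => norm_nonneg _) ?_ hf'
  filter_upwards [self_mem_nhdsWithin] with r hr
  rw [h.yosida_sub hδ ht hr, norm_neg]
  exact norm_yosida_le (h.pos r hr) hδ _

theorem hasDerivWithinAt_yosida (h : InvertibleFamily S β A A' R) (hδ : 0 < δ) {t : ℝ} (ht : t ∈ S)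
    (x : E) : HasDerivWithinAt (fun r => yosida δ (R r) x)
      (yosida δ (R t) (R t (A' t ⟨R t (yosida δ (R t) x), h.mem t ht _⟩))) S t := by
  have h1 := hasDerivWithinAt_clm_apply_sub (B := fun r => yosida δ (R r)) (C := δ⁻¹)
    (fun r hr z => norm_yosida_le (h.pos r hr) hδ z) (h.continuousWithinAt_yosida hδ ht _)
    (h.hasDerivWithinAt_inv ht (yosida δ (R t) x))
  have h2 := h1.neg.add_const (yosida δ (R t) x)
  rw [map_neg, neg_neg] at h2
  refine h2.congr_of_mem (fun r hr => ?_) ht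
  exact sub_eq_iff_eq_add.1 (h.yosida_sub hδ ht hr x)

/-- The derivative of the approximating generator is relatively bounded with the constant `β` of the
family, uniformly in `δ`. -/
theorem norm_deriv_yosida_le (h : InvertibleFamily S β A A' R) (hδ : 0 < δ) {t : ℝ} (ht : t ∈ S)
    (x : E) : ‖yosida δ (R t) (R t (A' t ⟨R t (yosida δ (R t) x), h.mem t ht _⟩))‖
      ≤ β * ‖yosida δ (R t) x‖ := by
  rw [yosida_comm (h.pos t ht) hδ]
  refine (norm_apply_yosida_le (h.pos t ht) hδ _).trans ?_
  have := h.bound t ht ⟨R t (yosida δ (R t) x), h.mem t ht _⟩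
  rwa [h.right t ht] at this

/-- Solutions of the approximating equations exist on the whole interval, for initial values at any
time. -/
theorem exists_isApproxSolution {L : ℝ} (hL : 0 ≤ L)
    (h : InvertibleFamily (Set.Icc 0 L) β A A' R) (hδ : 0 < δ) {s : ℝ} (hs : s ∈ Set.Icc 0 L)
    (x : E) : ∃ ψ : ℝ → E, ψ s = x ∧ IsApproxSolution (Set.Icc 0 L) R δ ψ := by
  set r : ℝ := ‖x‖ + 1 with hr
  have hr0 : 0 < r := by positivity
  let ρ : E → E := fun u => (((r / max r ‖u‖ : ℝ) : ℂ)) • u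
  have hρ : ∀ u, ‖ρ u‖ ≤ r := fun u => by
    have h0 : 0 < max r ‖u‖ := lt_max_of_lt_left hr0
    simp only [ρ, norm_smul, Complex.norm_real, Real.norm_eq_abs]
    rw [abs_of_nonneg (by positivity), div_mul_eq_mul_div, div_le_iff₀ h0]
    gcongr
    exact le_max_right _ _
  -- the vector field is truncated outside a ball that the solution does not leave, which gives a
  -- solution on the whole interval at once
  have hpl : IsPicardLindelof (fun t u => -Complex.I • yosida δ (R t) (ρ u)) (⟨s, hs⟩ : Set.Icc 0 L)
      x (Real.toNNReal (δ⁻¹ * r * L)) 0 (Real.toNNReal (δ⁻¹ * r)) (Real.toNNReal (δ⁻¹ * 2)) := by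
    refine ⟨fun t ht => ?_, fun u _ => ?_, fun t ht u _ => ?_, ?_⟩
    · refine LipschitzOnWith.of_dist_le_mul fun u _ v _ => ?_
      rw [dist_eq_norm, ← smul_sub, ← map_sub, norm_smul, norm_neg, Complex.norm_I, one_mul,
        Real.coe_toNNReal _ (by positivity)]
      refine (norm_yosida_le (h.pos t ht) hδ _).trans ?_
      have := (lipschitzWith_radial (E := E) hr0).dist_le_mul u v
      rw [dist_eq_norm] at this
      rw [mul_assoc]
      gcongr
      exact this
    · intro t ht
      exact (h.continuousWithinAt_yosida hδ ht _).const_smul _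
    · rw [norm_smul, norm_neg, Complex.norm_I, one_mul, Real.coe_toNNReal _ (by positivity)]
      refine (norm_yosida_le (h.pos t ht) hδ _).trans ?_
      gcongr
      exact hρ u
    · rw [Real.coe_toNNReal _ (by positivity), Real.coe_toNNReal _ (by positivity)]
      simp only [NNReal.coe_zero, sub_zero]
      gcongr
      exact max_le (by linarith [hs.1]) hs.2
  obtain ⟨ψ, hψs, hψ⟩ := hpl.exists_eq_forall_mem_Icc_hasDerivWithinAt₀
  have hn : ∀ t ∈ Set.Icc 0 L, ‖ψ t‖ = ‖x‖ := fun t ht => by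
    have := norm_eq_of_re_inner_deriv_eq_zero (convex_Icc 0 L) hψ (fun t ht => ?_) hs ht
    · rw [this]; exact congrArg _ hψs
    · have h1 := re_inner_neg_I_smul_eq_zero
        (fun x y => yosida_symm (h.pos t ht) hδ x y) (ψ t)
      simp only [ρ]
      rw [map_smul, smul_comm, inner_smul_right, Complex.re_ofReal_mul, h1, mul_zero]
  refine ⟨ψ, hψs, fun t ht => ?_⟩
  have hρt : ρ (ψ t) = ψ t := by
    simp only [ρ]
    rw [max_eq_left (by rw [hn t ht, hr]; linarith), div_self hr0.ne']
    simp
  have := hψ t ht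
  rwa [hρt] at this

theorem norm_eq_of_isApproxSolution (hS : Convex ℝ S) (h : InvertibleFamily S β A A' R)
    (hδ : 0 < δ) {ψ : ℝ → E} (hψ : IsApproxSolution S R δ ψ) {s t : ℝ} (hs : s ∈ S) (ht : t ∈ S) :
    ‖ψ t‖ = ‖ψ s‖ :=
  norm_eq_of_re_inner_deriv_eq_zero hS hψ
    (fun t ht => re_inner_neg_I_smul_eq_zero (fun x y => yosida_symm (h.pos t ht) hδ x y) (ψ t))
    hs ht

/-- The energy estimate for the approximate solutions. -/
theorem norm_yosida_apply_le (hS : Convex ℝ S) (h : InvertibleFamily S β A A' R) (hδ : 0 < δ)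
    {ψ : ℝ → E} (hψ : IsApproxSolution S R δ ψ) {s t : ℝ} (hs : s ∈ S) (ht : t ∈ S) :
    ‖yosida δ (R t) (ψ t)‖ ≤ Real.exp (β * |t - s|) * ‖yosida δ (R s) (ψ s)‖ := by
  have key : ∀ t, ∃ v, t ∈ S → HasDerivWithinAt (fun t => yosida δ (R t) (ψ t)) v S t ∧
      |(⟪yosida δ (R t) (ψ t), v⟫_ℂ).re| ≤ β * ‖yosida δ (R t) (ψ t)‖ ^ 2 := by
    intro t
    by_cases ht : t ∈ S
    swap
    · exact ⟨0, fun h => absurd h ht⟩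
    refine ⟨_, fun _ => ⟨hasDerivWithinAt_strong_clm_apply (B := fun t => yosida δ (R t))
      (fun r hr z => norm_yosida_le (h.pos r hr) hδ z) (h.continuousWithinAt_yosida hδ ht _)
      (h.hasDerivWithinAt_yosida hδ ht (ψ t)) (hψ t ht), ?_⟩⟩
    have h0 : (⟪yosida δ (R t) (ψ t),
        yosida δ (R t) (-Complex.I • yosida δ (R t) (ψ t))⟫_ℂ).re = 0 := by
      rw [map_smul]
      exact re_inner_neg_I_smul_eq_zero (fun x y => yosida_symm (h.pos t ht) hδ x y) _
    rw [inner_add_right, Complex.add_re, h0, add_zero]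
    refine (Complex.abs_re_le_norm _).trans ((norm_inner_le_norm _ _).trans ?_)
    have := h.norm_deriv_yosida_le hδ ht (ψ t)
    rw [sq, mul_left_comm]
    gcongr
  choose v hv using key
  exact norm_le_exp_mul_norm (u := fun t => yosida δ (R t) (ψ t)) hS (fun t ht => (hv t ht).1)
    (fun t ht => (hv t ht).2) hs ht

theorem norm_yosida_apply_le_of_mem (h : InvertibleFamily S β A A' R) (hδ : 0 < δ) {t : ℝ}
    (ht : t ∈ S) (φ : D) : ‖yosida δ (R t) φ‖ ≤ ‖A t φ‖ := by
  nth_rw 1 [← h.left t ht φ]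
  rw [yosida_comm (h.pos t ht) hδ]
  exact norm_apply_yosida_le (h.pos t ht) hδ _

end InvertibleFamily

end Family

/-! ### Strong solutions as limits of approximate solutions -/

/-- For bounded families, weak convergence may be tested on a dense set. -/
theorem tendsto_inner_of_dense {E : Type*} [NormedAddCommGroup E] [InnerProductSpace ℂ E]
    {ι : Type*} {l : Filter ι} {D : Set E} (hD : Dense D) {u : ι → E} {x : E} {C : ℝ}
    (hu : ∀ᶠ i in l, ‖u i‖ ≤ C) (h : ∀ y ∈ D, Tendsto (fun i => ⟪y, u i⟫_ℂ) l (𝓝 ⟪y, x⟫_ℂ))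
    (y : E) : Tendsto (fun i => ⟪y, u i⟫_ℂ) l (𝓝 ⟪y, x⟫_ℂ) := by
  rw [Metric.tendsto_nhds]
  intro e he
  set K : ℝ := |C| + ‖x‖ + 1 with hK
  have hK0 : 0 < K := by positivity
  obtain ⟨z, hzD, hz⟩ := hD.exists_dist_lt y (show 0 < e / 3 / K by positivity)
  rw [dist_eq_norm] at hz
  filter_upwards [hu, Metric.tendsto_nhds.1 (h z hzD) (e / 3) (by positivity)] with i hi hzi
  rw [dist_eq_norm] at hzi ⊢
  have e1 : ⟪y, u i⟫_ℂ - ⟪y, x⟫_ℂ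
      = ⟪y - z, u i⟫_ℂ + (⟪z, u i⟫_ℂ - ⟪z, x⟫_ℂ) - ⟪y - z, x⟫_ℂ := by
    rw [inner_sub_left, inner_sub_left]; ring
  rw [e1]
  have h1 : ‖⟪y - z, u i⟫_ℂ‖ ≤ e / 3 / K * K := (norm_inner_le_norm _ _).trans <| by
    gcongr
    linarith [le_abs_self C, norm_nonneg x]
  have h2 : ‖⟪y - z, x⟫_ℂ‖ ≤ e / 3 / K * K := (norm_inner_le_norm _ _).trans <| by
    gcongr
    linarith [abs_nonneg C]
  rw [div_mul_cancel₀ _ hK0.ne'] at h1 h2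
  have h3 := norm_sub_le (⟪y - z, u i⟫_ℂ + (⟪z, u i⟫_ℂ - ⟪z, x⟫_ℂ)) ⟪y - z, x⟫_ℂ
  have h4 := norm_add_le ⟪y - z, u i⟫_ℂ (⟪z, u i⟫_ℂ - ⟪z, x⟫_ℂ)
  linarith

namespace InvertibleFamily

variable {E : Type*} [NormedAddCommGroup E] [InnerProductSpace ℂ E]
  {D : Submodule ℂ E} {β : ℝ} {A : ℝ → D →ₗ[ℂ] E} {A' : ℝ → D → E} {R : ℝ → E →L[ℂ] E}

/-- Pointwise limits of solutions of the approximating equations, with parameters `1 / (k + 1)`. -/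
def IsLimitSolution (S : Set ℝ) (R : ℝ → E →L[ℂ] E) (ψ : ℝ → E) : Prop :=
  ∃ u : ℕ → ℝ → E, (∀ k : ℕ, IsApproxSolution S R (1 / ((k : ℝ) + 1)) (u k)) ∧
    ∀ t ∈ S, Tendsto (fun k => u k t) atTop (𝓝 (ψ t))

theorem injective_inv {S : Set ℝ} (h : InvertibleFamily S β A A' R) {t : ℝ} (ht : t ∈ S) :
    Function.Injective (R t) := fun x y hxy => by
  rw [← h.right t ht x (h.mem t ht x), ← h.right t ht y (h.mem t ht y)]
  congr 2

variable [CompleteSpace E]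

/-- Approximate solutions for two parameters that agree at one time stay close, if their energies are
bounded. -/
theorem norm_sub_sq_le {L : ℝ} (h : InvertibleFamily (Set.Icc 0 L) β A A' R) {δ δ' : ℝ}
    (hδ : 0 < δ) (hδ' : 0 < δ') {ψ ψ' : ℝ → E} (hψ : IsApproxSolution (Set.Icc 0 L) R δ ψ)
    (hψ' : IsApproxSolution (Set.Icc 0 L) R δ' ψ') {C : ℝ}
    (hC : ∀ t ∈ Set.Icc 0 L, ‖yosida δ (R t) (ψ t)‖ ≤ C)
    (hC' : ∀ t ∈ Set.Icc 0 L, ‖yosida δ' (R t) (ψ' t)‖ ≤ C) {s t : ℝ} (hs : s ∈ Set.Icc 0 L)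
    (ht : t ∈ Set.Icc 0 L) (he : ψ s = ψ' s) :
    ‖ψ t - ψ' t‖ ^ 2 ≤ 4 * C ^ 2 * (δ + δ') * L := by
  have hC0 : 0 ≤ C := (norm_nonneg _).trans (hC s hs)
  have hd : ∀ r ∈ Set.Icc 0 L, HasDerivWithinAt (fun r => ‖ψ r - ψ' r‖ ^ 2)
      (2 * (⟪ψ r - ψ' r, -Complex.I • (yosida δ (R r) (ψ r) - yosida δ' (R r) (ψ' r))⟫_ℂ).re)
      (Set.Icc 0 L) r := fun r hr => by
    have := hasDerivWithinAt_norm_sq ((hψ r hr).sub (hψ' r hr))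
    rwa [← smul_sub] at this
  have hb : ∀ r ∈ Set.Icc 0 L,
      ‖2 * (⟪ψ r - ψ' r, -Complex.I • (yosida δ (R r) (ψ r) - yosida δ' (R r) (ψ' r))⟫_ℂ).re‖
        ≤ 4 * C ^ 2 * (δ + δ') := fun r hr => by
    set χ := yosida δ (R r) (ψ r) with hχ
    set χ' := yosida δ' (R r) (ψ' r) with hχ'
    have e1 : ψ r - ψ' r = R r (χ - χ') + ((δ : ℂ) • χ - (δ' : ℂ) • χ') := by
      have h1 := apply_yosida_add (h.pos r hr) hδ (ψ r)
      have h2 := apply_yosida_add (h.pos r hr) hδ' (ψ' r)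
      nth_rw 1 [← h1]
      nth_rw 1 [← h2]
      rw [map_sub]; abel
    -- up to terms of order `δ` and `δ'`, the difference is `R (χ - χ')`, which does not contribute
    have e2 : (⟪R r (χ - χ'), -Complex.I • (χ - χ')⟫_ℂ).re = 0 := by
      rw [inner_apply_left_of_isPositive (h.pos r hr), map_smul]
      exact re_inner_neg_I_smul_eq_zero (inner_apply_left_of_isPositive (h.pos r hr)) _
    rw [e1, inner_add_left, Complex.add_re, e2, zero_add, norm_mul, Real.norm_two,
      Real.norm_eq_abs]
    have h3 : ‖(δ : ℂ) • χ - (δ' : ℂ) • χ'‖ ≤ (δ + δ') * C := by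
      refine (norm_sub_le _ _).trans ?_
      rw [norm_smul, norm_smul, Complex.norm_real, Complex.norm_real, Real.norm_eq_abs,
        Real.norm_eq_abs, abs_of_pos hδ, abs_of_pos hδ', add_mul]
      gcongr
      · exact hC r hr
      · exact hC' r hr
    have h4 : ‖-Complex.I • (χ - χ')‖ ≤ C + C := by
      rw [norm_smul, norm_neg, Complex.norm_I, one_mul]
      exact (norm_sub_le _ _).trans (add_le_add (hC r hr) (hC' r hr))
    calc 2 * |(⟪(δ : ℂ) • χ - (δ' : ℂ) • χ', -Complex.I • (χ - χ')⟫_ℂ).re|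
        ≤ 2 * (((δ + δ') * C) * (C + C)) := by
          gcongr
          refine (Complex.abs_re_le_norm _).trans ((norm_inner_le_norm _ _).trans ?_)
          gcongr
      _ = 4 * C ^ 2 * (δ + δ') := by ring
  have hfin := Convex.norm_image_sub_le_of_norm_hasDerivWithin_le hd hb (convex_Icc 0 L) hs ht
  simp only [he, sub_self, norm_zero, ne_eq, OfNat.ofNat_ne_zero, not_false_eq_true, zero_pow,
    sub_zero, norm_pow, norm_norm] at hfin
  refine hfin.trans ?_
  gcongr
  rw [Real.norm_eq_abs, abs_le]
  constructor <;> linarith [hs.1, hs.2, ht.1, ht.2]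

theorem exp_le_exp_of_mem_Icc {L s t : ℝ} (hs : s ∈ Set.Icc 0 L) (ht : t ∈ Set.Icc 0 L) :
    Real.exp (β * |t - s|) ≤ Real.exp (|β| * L) := by
  rw [Real.exp_le_exp]
  have h1 : |t - s| ≤ L := abs_le.2 ⟨by linarith [hs.1, hs.2, ht.1, ht.2],
    by linarith [hs.1, hs.2, ht.1, ht.2]⟩
  have h2 := le_abs_self β
  have h3 := abs_nonneg (t - s)
  have h4 := abs_nonneg β
  nlinarith

theorem exists_isLimitSolution {L : ℝ} (hL : 0 ≤ L)
    (h : InvertibleFamily (Set.Icc 0 L) β A A' R) {s : ℝ} (hs : s ∈ Set.Icc 0 L) (φ : D) :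
    ∃ ψ : ℝ → E, ψ s = φ ∧ IsLimitSolution (Set.Icc 0 L) R ψ := by
  have hδ : ∀ k : ℕ, (0 : ℝ) < 1 / ((k : ℝ) + 1) := fun k => Nat.one_div_pos_of_nat
  choose u hus hu using fun k : ℕ => exists_isApproxSolution hL h (hδ k) hs (φ : E)
  set C := Real.exp (|β| * L) * ‖A s φ‖ with hC
  have hb : ∀ k : ℕ, ∀ t ∈ Set.Icc 0 L, ‖yosida (1 / ((k : ℝ) + 1)) (R t) (u k t)‖ ≤ C :=
    fun k t ht => by
      refine (norm_yosida_apply_le (convex_Icc 0 L) h (hδ k) (hu k) hs ht).trans ?_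
      rw [hus, hC]
      gcongr ?_ * ?_
      · exact exp_le_exp_of_mem_Icc hs ht
      · exact norm_yosida_apply_le_of_mem h (hδ k) hs φ
  have hcau : ∀ t ∈ Set.Icc 0 L, CauchySeq fun k => u k t := fun t ht => by
    have hlim : Tendsto (fun N : ℕ => √(4 * C ^ 2 * (1 / ((N : ℝ) + 1) + 1 / ((N : ℝ) + 1)) * L))
        atTop (𝓝 0) := by
      have h0 := tendsto_one_div_add_atTop_nhds_zero_nat (𝕜 := ℝ)
      have h1 := (((h0.add h0).const_mul (4 * C ^ 2)).mul_const L).sqrt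
      simpa using h1
    refine cauchySeq_of_le_tendsto_0' _ (fun n m hnm => ?_) hlim
    rw [dist_eq_norm]
    refine Real.le_sqrt_of_sq_le ?_
    refine (norm_sub_sq_le h (hδ n) (hδ m) (hu n) (hu m) (hb n) (hb m) hs ht
      ((hus n).trans (hus m).symm)).trans ?_
    gcongr
  choose! ψ hψ using fun t ht => cauchySeq_tendsto_of_complete (hcau t ht)
  refine ⟨ψ, ?_, u, hu, hψ⟩
  refine tendsto_nhds_unique (hψ s hs) ?_
  simp [hus]

/-- A limit solution that is in the domain at one time is so at all times, with a bound that is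
exact in the limit of short times. The domain at time `t` is here the range of `R t`. -/
theorem IsLimitSolution.exists_eq_inv_apply {L : ℝ} (hL : 0 ≤ L)
    (h : InvertibleFamily (Set.Icc 0 L) β A A' R) {ψ : ℝ → E}
    (hψ : IsLimitSolution (Set.Icc 0 L) R ψ) {s t : ℝ} (hs : s ∈ Set.Icc 0 L)
    (ht : t ∈ Set.Icc 0 L) {x : E} (hx : ψ s = R s x) :
    ∃ z : E, ψ t = R t z ∧ ‖z‖ ≤ Real.exp (β * |t - s|) * ‖x‖ := by
  have hδ : ∀ k : ℕ, (0 : ℝ) < 1 / ((k : ℝ) + 1) := fun k => Nat.one_div_pos_of_nat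
  obtain ⟨u, hu, hlim⟩ := hψ
  -- restart the approximate solutions from the exact value at time `s`, so that `ψ s = R s x` can be
  -- used for the initial bound
  choose v hvs hv using fun k : ℕ => exists_isApproxSolution hL h (hδ k) hs (ψ s)
  have hvlim : Tendsto (fun k => v k t) atTop (𝓝 (ψ t)) := by
    have h1 : Tendsto (fun k => v k t - u k t) atTop (𝓝 0) := by
      have h2 := tendsto_iff_norm_sub_tendsto_zero.1 (hlim s hs)
      refine squeeze_zero_norm (fun k => le_of_eq ?_) h2
      have := norm_eq_of_isApproxSolution (convex_Icc 0 L) h (hδ k)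
        ((hv k).sub (hu k)) hs ht
      simp only [Pi.sub_apply] at this
      rw [this, hvs, norm_sub_rev]
    simpa using h1.add (hlim t ht)
  set C := Real.exp (β * |t - s|) * ‖x‖ with hC
  have hC0 : 0 ≤ C := by positivity
  have hb : ∀ k : ℕ, ‖yosida (1 / ((k : ℝ) + 1)) (R t) (v k t)‖ ≤ C := fun k => by
    refine (norm_yosida_apply_le (convex_Icc 0 L) h (hδ k) (hv k) hs ht).trans ?_
    rw [hvs, hx, yosida_comm (h.pos s hs) (hδ k), hC]
    gcongr
    exact norm_apply_yosida_le (h.pos s hs) (hδ k) _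
  have hR : Tendsto (fun k : ℕ => R t (yosida (1 / ((k : ℝ) + 1)) (R t) (v k t))) atTop
      (𝓝 (ψ t)) := by
    have h1 : Tendsto (fun k : ℕ => ((1 / ((k : ℝ) + 1) : ℝ) : ℂ) •
        yosida (1 / ((k : ℝ) + 1)) (R t) (v k t)) atTop (𝓝 0) := by
      have h0 := (tendsto_one_div_add_atTop_nhds_zero_nat (𝕜 := ℝ)).mul_const C
      rw [zero_mul] at h0
      refine squeeze_zero_norm (fun k => ?_) h0
      rw [norm_smul, Complex.norm_real, Real.norm_eq_abs, abs_of_pos (hδ k)]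
      gcongr
      exact hb k
    have h2 := hvlim.sub h1
    rw [sub_zero] at h2
    refine h2.congr fun k => ?_
    rw [sub_eq_iff_eq_add]
    exact (apply_yosida_add (h.pos t ht) (hδ k) _).symm
  obtain ⟨z, hz, hze⟩ := exists_adjoint_apply_eq (R t) (h.injective_inv ht) hC0 (ψ t)
    (fun w => by
      refine le_of_tendsto (hR.inner tendsto_const_nhds).norm (Eventually.of_forall fun k => ?_)
      rw [inner_apply_left_of_isPositive (h.pos t ht)]
      refine (norm_inner_le_norm _ _).trans ?_
      gcongr
      exact hb k)
  rw [(h.pos t ht).isSelfAdjoint.adjoint_eq] at hze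
  exact ⟨z, hze.symm, hz⟩

/-- Strong solutions of the Schrödinger equation: `ψ t = R t (χ t)` means that `ψ t ∈ D` and
`A t (ψ t) = χ t`. -/
structure IsStrongSolution (S : Set ℝ) (R : ℝ → E →L[ℂ] E) (ψ χ : ℝ → E) : Prop where
  eq_inv_apply : ∀ t ∈ S, ψ t = R t (χ t)
  hasDeriv : ∀ t ∈ S, HasDerivWithinAt ψ (-Complex.I • χ t) S t

/-- A limit solution with initial value in the domain is a strong solution, with an exponential bound
of the energy in both time directions. -/
theorem IsLimitSolution.exists_isStrongSolution {L : ℝ} (hL : 0 < L)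
    (h : InvertibleFamily (Set.Icc 0 L) β A A' R) {ψ : ℝ → E}
    (hψ : IsLimitSolution (Set.Icc 0 L) R ψ) {s : ℝ} (hs : s ∈ Set.Icc 0 L) {x : E}
    (hx : ψ s = R s x) :
    ∃ χ : ℝ → E, IsStrongSolution (Set.Icc 0 L) R ψ χ ∧
      ∀ t ∈ Set.Icc 0 L, ∀ r ∈ Set.Icc 0 L, ‖χ t‖ ≤ Real.exp (β * |t - r|) * ‖χ r‖ := by
  have hδ : ∀ k : ℕ, (0 : ℝ) < 1 / ((k : ℝ) + 1) := fun k => Nat.one_div_pos_of_nat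
  have hex : ∀ t ∈ Set.Icc 0 L, ∃ z, ψ t = R t z := fun t ht =>
    (hψ.exists_eq_inv_apply hL.le h hs ht hx).imp fun _ hz => hz.1
  choose! χ hχ using hex
  have hbound : ∀ t ∈ Set.Icc 0 L, ∀ r ∈ Set.Icc 0 L,
      ‖χ t‖ ≤ Real.exp (β * |t - r|) * ‖χ r‖ := fun t ht r hr => by
    obtain ⟨z, hz, hz'⟩ := hψ.exists_eq_inv_apply hL.le h hr ht (hχ r hr)
    have : z = χ t := h.injective_inv ht (hz.symm.trans (hχ t ht))
    rwa [this] at hz'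
  have hs0 : (0 : ℝ) ∈ Set.Icc 0 L := ⟨le_rfl, hL.le⟩
  have hχy : ∀ t ∈ Set.Icc 0 L, ∀ y : D, ⟪(y : E), χ t⟫_ℂ = ⟪A t y, ψ t⟫_ℂ := fun t ht y => by
    rw [hχ t ht, ← inner_apply_left_of_isPositive (h.pos t ht), h.left t ht]
  -- the solutions of the approximating equations with the same initial value at time `0`
  choose u hu0 hu using fun k : ℕ => exists_isApproxSolution hL.le h (hδ k) hs0 (ψ 0)
  have hulim : ∀ t ∈ Set.Icc 0 L, Tendsto (fun k => u k t) atTop (𝓝 (ψ t)) := by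
    obtain ⟨v, hv, hvlim⟩ := hψ
    intro t ht
    have h1 : Tendsto (fun k => u k t - v k t) atTop (𝓝 0) := by
      have h2 := tendsto_iff_norm_sub_tendsto_zero.1 (hvlim 0 hs0)
      refine squeeze_zero_norm (fun k => le_of_eq ?_) h2
      have := norm_eq_of_isApproxSolution (convex_Icc 0 L) h (hδ k)
        ((hu k).sub (hv k)) hs0 ht
      simp only [Pi.sub_apply] at this
      rw [this, hu0, norm_sub_rev]
    simpa using h1.add (hvlim t ht)
  set C := Real.exp (|β| * L) * ‖χ 0‖ with hC
  have hC0 : 0 ≤ C := by positivity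
  have hχC : ∀ t ∈ Set.Icc 0 L, ‖χ t‖ ≤ C := fun t ht => by
    refine (hbound t ht 0 hs0).trans ?_
    exact mul_le_mul_of_nonneg_right (exp_le_exp_of_mem_Icc hs0 ht) (norm_nonneg _)
  have hb : ∀ k : ℕ, ∀ t ∈ Set.Icc 0 L, ‖yosida (1 / ((k : ℝ) + 1)) (R t) (u k t)‖ ≤ C :=
    fun k t ht => by
      refine (norm_yosida_apply_le (convex_Icc 0 L) h (hδ k) (hu k) hs0 ht).trans ?_
      rw [hu0, hχ 0 hs0, yosida_comm (h.pos 0 hs0) (hδ k), hC]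
      gcongr ?_ * ?_
      · exact exp_le_exp_of_mem_Icc hs0 ht
      · exact norm_apply_yosida_le (h.pos 0 hs0) (hδ k) _
  have hψc : ContinuousOn ψ (Set.Icc 0 L) := by
    have hlip : ∀ t ∈ Set.Icc 0 L, ∀ r ∈ Set.Icc 0 L, ‖ψ t - ψ r‖ ≤ C * ‖t - r‖ :=
      fun t ht r hr => by
        refine le_of_tendsto ((hulim t ht).sub (hulim r hr)).norm (Eventually.of_forall fun k => ?_)
        refine Convex.norm_image_sub_le_of_norm_hasDerivWithin_le (hu k) (fun w hw => ?_)
          (convex_Icc 0 L) hr ht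
        rw [norm_smul, norm_neg, Complex.norm_I, one_mul]
        exact hb k w hw
    refine LipschitzOnWith.continuousOn (K := C.toNNReal) (LipschitzOnWith.of_dist_le_mul ?_)
    intro t ht r hr
    rw [dist_eq_norm, dist_eq_norm, Real.coe_toNNReal _ hC0]
    exact hlip t ht r hr
  have hweak : ∀ t ∈ Set.Icc 0 L, ∀ y : E,
      ContinuousWithinAt (fun r => ⟪y, χ r⟫_ℂ) (Set.Icc 0 L) t := fun t ht y => by
    refine tendsto_inner_of_dense h.dense (C := C)
      (by filter_upwards [self_mem_nhdsWithin] with r hr using hχC r hr) (fun y hy => ?_) y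
    have h1 : ContinuousWithinAt (fun r => ⟪A r ⟨y, hy⟩, ψ r⟫_ℂ) (Set.Icc 0 L) t :=
      (h.deriv t ht ⟨y, hy⟩).continuousWithinAt.inner (hψc t ht)
    exact h1.congr (fun r hr => hχy r hr ⟨y, hy⟩) (hχy t ht ⟨y, hy⟩)
  -- the bound holds for both orders of the times, so the norms converge along with the weak limits
  have hχc : ContinuousOn χ (Set.Icc 0 L) := fun t ht => by
    refine tendsto_of_tendsto_inner_of_norm_le (hweak t ht (χ t))
      (g := fun r => Real.exp (β * |r - t|) * ‖χ t‖)
      (by filter_upwards [self_mem_nhdsWithin] with r hr using hbound r hr t ht) ?_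
    have : Continuous fun r => Real.exp (β * |r - t|) * ‖χ t‖ := by fun_prop
    have h2 := (this.tendsto t).mono_left (nhdsWithin_le_nhds (s := Set.Icc 0 L))
    simpa using h2
  have hcont : ∀ k : ℕ, ContinuousOn (fun r => yosida (1 / ((k : ℝ) + 1)) (R r) (u k r))
      (Set.Icc 0 L) := fun k r hr =>
    tendsto_clm_apply_of_norm_le (C := (1 / ((k : ℝ) + 1))⁻¹)
      (by filter_upwards [self_mem_nhdsWithin] with w hw z using
        norm_yosida_le (h.pos w hw) (hδ k) z)
      (h.continuousWithinAt_yosida (hδ k) hr _) (hu k r hr).continuousWithinAt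
  -- the integrated equation, as the weak limit of the integrated approximating equations
  have hint : ∀ t ∈ Set.Icc 0 L, ψ t = ψ 0 + ∫ r in (0 : ℝ)..t, -Complex.I • χ r := by
    intro t ht
    have hsub : Set.uIcc 0 t ⊆ Set.Icc 0 L := by
      rw [Set.uIcc_of_le ht.1]; exact Set.Icc_subset_Icc_right ht.2
    have hsub' : Set.uIoc 0 t ⊆ Set.Icc 0 L := Set.uIoc_subset_uIcc.trans hsub
    have hchi : IntervalIntegrable (fun r => -Complex.I • χ r) MeasureTheory.volume 0 t :=
      ((hχc.mono hsub).const_smul _).intervalIntegrable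
    refine h.dense.eq_of_inner_right ℂ fun y hy => ?_
    have hk : ∀ k : ℕ, ∫ r in (0 : ℝ)..t,
        ⟪y, -Complex.I • yosida (1 / ((k : ℝ) + 1)) (R r) (u k r)⟫_ℂ
          = ⟪y, u k t⟫_ℂ - ⟪y, u k 0⟫_ℂ := fun k => by
      have hd : ∀ r ∈ Set.Icc 0 L, HasDerivWithinAt (fun r => ⟪y, u k r⟫_ℂ)
          ⟪y, -Complex.I • yosida (1 / ((k : ℝ) + 1)) (R r) (u k r)⟫_ℂ (Set.Icc 0 L) r :=
        fun r hr => by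
          simpa using (hasDerivWithinAt_const r (Set.Icc 0 L) y).inner ℂ (hu k r hr)
      refine intervalIntegral.integral_eq_sub_of_hasDerivAt_of_le ht.1
        (fun r hr => ((hd r (Set.Icc_subset_Icc_right ht.2 hr)).continuousWithinAt.mono
          (Set.Icc_subset_Icc_right ht.2)))
        (fun r hr => (hd r ⟨hr.1.le, hr.2.le.trans ht.2⟩).hasDerivAt
          (Icc_mem_nhds hr.1 (hr.2.trans_le ht.2))) ?_
      exact (continuousOn_const.inner (((hcont k).mono hsub).const_smul _)).intervalIntegrable
    have hlim1 : Tendsto (fun k : ℕ => ∫ r in (0 : ℝ)..t,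
        ⟪y, -Complex.I • yosida (1 / ((k : ℝ) + 1)) (R r) (u k r)⟫_ℂ) atTop
        (𝓝 (∫ r in (0 : ℝ)..t, ⟪y, -Complex.I • χ r⟫_ℂ)) := by
      refine intervalIntegral.tendsto_integral_filter_of_dominated_convergence (fun _ => ‖y‖ * C)
        ?_ ?_ intervalIntegrable_const ?_
      · refine Eventually.of_forall fun k => ?_
        exact (continuousOn_const.inner (((hcont k).mono hsub').const_smul _)).aestronglyMeasurable
          measurableSet_uIoc
      · refine Eventually.of_forall fun k => Eventually.of_forall fun r hr => ?_
        refine (norm_inner_le_norm _ _).trans ?_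
        rw [norm_smul, norm_neg, Complex.norm_I, one_mul]
        gcongr
        exact hb k r (hsub' hr)
      · refine Eventually.of_forall fun r hr => ?_
        simp only [inner_smul_right]
        refine Tendsto.const_mul _ ?_
        have hr' := hsub' hr
        rw [hχy r hr' ⟨y, hy⟩]
        have h0 : Tendsto (fun k : ℕ => ((1 / ((k : ℝ) + 1) : ℝ) : ℂ) •
            yosida (1 / ((k : ℝ) + 1)) (R r) (u k r)) atTop (𝓝 0) := by
          have h0 := (tendsto_one_div_add_atTop_nhds_zero_nat (𝕜 := ℝ)).mul_const C
          rw [zero_mul] at h0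
          refine squeeze_zero_norm (fun k => ?_) h0
          rw [norm_smul, Complex.norm_real, Real.norm_eq_abs, abs_of_pos (hδ k)]
          gcongr
          exact hb k r hr'
        have h1 := (tendsto_const_nhds (x := A r ⟨y, hy⟩)).inner ((hulim r hr').sub h0)
          (𝕜 := ℂ)
        rw [sub_zero] at h1
        refine h1.congr fun k => ?_
        have h2 : u k r - ((1 / ((k : ℝ) + 1) : ℝ) : ℂ) •
            yosida (1 / ((k : ℝ) + 1)) (R r) (u k r)
            = R r (yosida (1 / ((k : ℝ) + 1)) (R r) (u k r)) := by
          rw [sub_eq_iff_eq_add]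
          exact (apply_yosida_add (h.pos r hr') (hδ k) _).symm
        rw [h2, ← inner_apply_left_of_isPositive (h.pos r hr'), h.left r hr']
    have hlim2 : Tendsto (fun k : ℕ => ∫ r in (0 : ℝ)..t,
        ⟪y, -Complex.I • yosida (1 / ((k : ℝ) + 1)) (R r) (u k r)⟫_ℂ) atTop
        (𝓝 (⟪y, ψ t⟫_ℂ - ⟪y, ψ 0⟫_ℂ)) := by
      simp only [hk]
      exact (tendsto_const_nhds.inner (hulim t ht)).sub (tendsto_const_nhds.inner (hulim 0 hs0))
    have heq := tendsto_nhds_unique hlim1 hlim2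
    have hcomm := (innerSL ℂ y).intervalIntegral_comp_comm hchi
    simp only [innerSL_apply_apply] at hcomm
    rw [inner_add_right, ← hcomm, heq]
    ring
  refine ⟨χ, ⟨hχ, fun t ht => ?_⟩, hbound⟩
  have hsub : Set.uIcc 0 t ⊆ Set.Icc 0 L := by
    rw [Set.uIcc_of_le ht.1]; exact Set.Icc_subset_Icc_right ht.2
  have hco : ContinuousOn (fun r => -Complex.I • χ r) (Set.Icc 0 L) := hχc.const_smul _
  have : Fact (t ∈ Set.Icc 0 L) := ⟨ht⟩
  have h1 : HasDerivWithinAt (fun t => ∫ r in (0 : ℝ)..t, -Complex.I • χ r) (-Complex.I • χ t)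
      (Set.Icc 0 L) t :=
    intervalIntegral.integral_hasDerivWithinAt_right (hco.mono hsub).intervalIntegrable
      (hco.stronglyMeasurableAtFilter_nhdsWithin measurableSet_Icc t) (hco t ht)
  exact (h1.const_add (ψ 0)).congr_of_mem (fun r hr => hint r hr) ht

end InvertibleFamily

/-! ### Evolution operators -/

/-- A linear isometry defined on a dense subspace extends to the whole space. -/
theorem exists_isometric_extension {E : Type*} [NormedAddCommGroup E] [InnerProductSpace ℂ E]
    [CompleteSpace E] {D : Submodule ℂ E} (hD : Dense (D : Set E)) (f : D →ₗ[ℂ] E)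
    (hf : ∀ φ : D, ‖f φ‖ = ‖(φ : E)‖) :
    ∃ U : E →L[ℂ] E, (∀ φ : D, U φ = f φ) ∧ ∀ x, ‖U x‖ = ‖x‖ := by
  let g : D →L[ℂ] E := f.mkContinuous 1 (fun φ => by rw [one_mul, hf]; rfl)
  have hdr : DenseRange D.subtypeL := by
    simpa [DenseRange] using hD
  have hui : IsUniformInducing D.subtypeL := isUniformEmbedding_subtype_val.isUniformInducing
  have h1 : ∀ φ : D, g.extend D.subtypeL φ = f φ := fun φ => g.extend_eq hdr hui φ
  refine ⟨g.extend D.subtypeL, h1, fun x => ?_⟩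
  refine hD.induction (P := fun x => ‖g.extend D.subtypeL x‖ = ‖x‖) (fun y hy => ?_) ?_ x
  · rw [← hf ⟨y, hy⟩, ← h1]
  · exact isClosed_eq (g.extend D.subtypeL).continuous.norm continuous_norm

namespace InvertibleFamily

variable {E : Type*} [NormedAddCommGroup E] [InnerProductSpace ℂ E]
  {D : Submodule ℂ E} {S J : Set ℝ} {β : ℝ} {A : ℝ → D →ₗ[ℂ] E} {A' : ℝ → D → E}
  {R : ℝ → E →L[ℂ] E}

namespace IsStrongSolution

variable {ψ χ ψ' χ' : ℝ → E}

theorem mono {S' : Set ℝ} (h : IsStrongSolution S R ψ χ) (hS : S' ⊆ S) :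
    IsStrongSolution S' R ψ χ :=
  ⟨fun t ht => h.1 t (hS ht), fun t ht => (h.2 t (hS ht)).mono hS⟩

theorem add (h : IsStrongSolution S R ψ χ) (h' : IsStrongSolution S R ψ' χ') :
    IsStrongSolution S R (ψ + ψ') (χ + χ') :=
  ⟨fun t ht => by simp [h.1 t ht, h'.1 t ht], fun t ht => by
    simpa only [Pi.add_apply, smul_add] using (h.2 t ht).add (h'.2 t ht)⟩

theorem const_smul (h : IsStrongSolution S R ψ χ) (c : ℂ) :
    IsStrongSolution S R (c • ψ) (c • χ) :=
  ⟨fun t ht => by simp [h.1 t ht], fun t ht => by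
    have := (h.2 t ht).const_smul c
    rwa [smul_comm] at this⟩

theorem norm_eq (hS : Convex ℝ S) (hA : InvertibleFamily S β A A' R)
    (h : IsStrongSolution S R ψ χ) {s t : ℝ} (hs : s ∈ S) (ht : t ∈ S) : ‖ψ t‖ = ‖ψ s‖ :=
  norm_eq_of_re_inner_deriv_eq_zero hS h.2 (fun r hr => by
    rw [h.1 r hr, inner_apply_left_of_isPositive (hA.pos r hr), map_smul]
    exact re_inner_neg_I_smul_eq_zero (inner_apply_left_of_isPositive (hA.pos r hr)) _) hs ht

theorem unique (hS : Convex ℝ S) (hA : InvertibleFamily S β A A' R)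
    (h : IsStrongSolution S R ψ χ) (h' : IsStrongSolution S R ψ' χ') {s t : ℝ} (hs : s ∈ S)
    (ht : t ∈ S) (he : ψ s = ψ' s) : ψ t = ψ' t := by
  have := norm_eq hS hA (h.add (h'.const_smul (-1))) hs ht
  simp only [Pi.add_apply, Pi.neg_apply, he, neg_smul, one_smul, add_neg_cancel, norm_zero,
    norm_eq_zero] at this
  rwa [add_neg_eq_zero] at this

theorem eq_snd (hA : InvertibleFamily S β A A' R) {S' : Set ℝ}
    (h : IsStrongSolution S R ψ χ) (h' : IsStrongSolution S' R ψ' χ') {t : ℝ} (ht : t ∈ S)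
    (ht' : t ∈ S') (he : ψ t = ψ' t) : χ t = χ' t := by
  rw [h.1 t ht, h'.1 t ht'] at he
  exact hA.injective_inv ht he

end IsStrongSolution

variable [CompleteSpace E]

/-- Strong solutions on a half-open interval `J` that starts at `0`, with their energy bound. -/
theorem exists_isStrongSolution (hJ0 : ∀ t ∈ J, 0 ≤ t) (hJ : ∀ t ∈ J, Set.Icc 0 t ⊆ J)
    (hJn : ∀ t ∈ J, ∃ L ∈ J, t < L) (h : InvertibleFamily J β A A' R) {s : ℝ} (hs : s ∈ J)
    (φ : D) :
    ∃ ψ χ : ℝ → E, ψ s = φ ∧ IsStrongSolution J R ψ χ ∧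
      ∀ t ∈ J, ∀ r ∈ J, ‖χ t‖ ≤ Real.exp (β * |t - r|) * ‖χ r‖ := by
  have hmax : ∀ {a b : ℝ}, a ∈ J → b ∈ J → max a b ∈ J := fun {a b} ha hb => by
    rcases max_choice a b with e | e <;> rwa [e]
  -- solutions on compact intervals `[0, L]` agree where they are both defined, and `g t` is an
  -- admissible end point beyond `t`
  have hloc : ∀ L, ∃ ψ χ : ℝ → E, L ∈ J → s < L → ψ s = φ ∧ IsStrongSolution (Set.Icc 0 L) R ψ χ ∧
      ∀ t ∈ Set.Icc 0 L, ∀ r ∈ Set.Icc 0 L, ‖χ t‖ ≤ Real.exp (β * |t - r|) * ‖χ r‖ := by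
    intro L
    by_cases hL : L ∈ J ∧ s < L
    swap
    · exact ⟨0, 0, fun h1 h2 => absurd ⟨h1, h2⟩ hL⟩
    have hL0 : 0 < L := (hJ0 s hs).trans_lt hL.2
    have hA := h.mono (hJ L hL.1)
    have hs' : s ∈ Set.Icc 0 L := ⟨hJ0 s hs, hL.2.le⟩
    obtain ⟨ψ, hψs, hψ⟩ := exists_isLimitSolution hL0.le hA hs' φ
    obtain ⟨χ, hχ⟩ := hψ.exists_isStrongSolution hL0 hA hs' (x := A s φ)
      (by rw [hψs, hA.left s hs'])
    exact ⟨ψ, χ, fun _ _ => ⟨hψs, hχ⟩⟩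
  choose ψ χ hψ using hloc
  have hg : ∀ t, ∃ L, t ∈ J → L ∈ J ∧ s < L ∧ t < L := fun t => by
    by_cases ht : t ∈ J
    · obtain ⟨L, hL, hlt⟩ := hJn _ (hmax hs ht)
      exact ⟨L, fun _ => ⟨hL, (le_max_left _ _).trans_lt hlt, (le_max_right _ _).trans_lt hlt⟩⟩
    · exact ⟨0, fun h => absurd h ht⟩
  choose g hg using hg
  have hagree : ∀ L ∈ J, s < L → ∀ L' ∈ J, s < L' → ∀ t ∈ Set.Icc 0 L, t ≤ L' →
      ψ L t = ψ L' t ∧ χ L t = χ L' t := by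
    intro L hL hsL L' hL' hsL' t ht htL'
    obtain ⟨e, hst, -⟩ := hψ L hL hsL
    obtain ⟨e', hst', -⟩ := hψ L' hL' hsL'
    have h1 := hst.mono (Set.Icc_subset_Icc_right (min_le_left L L'))
    have h2 := hst'.mono (Set.Icc_subset_Icc_right (min_le_right L L'))
    have hA := h.mono ((Set.Icc_subset_Icc_right (min_le_left L L')).trans (hJ L hL))
    have ht' : t ∈ Set.Icc 0 (min L L') := ⟨ht.1, le_min ht.2 htL'⟩
    have e3 := h1.unique (convex_Icc _ _) hA h2 ⟨hJ0 s hs, le_min hsL.le hsL'.le⟩ ht'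
      (e.trans e'.symm)
    exact ⟨e3, h1.eq_snd hA h2 ht' ht' e3⟩
  refine ⟨fun t => ψ (g t) t, fun t => χ (g t) t, ?_, ⟨fun t ht => ?_, fun t ht => ?_⟩,
    fun t ht r hr => ?_⟩
  · obtain ⟨h1, h2, -⟩ := hg s hs
    exact (hψ _ h1 h2).1
  · obtain ⟨h1, h2, h3⟩ := hg t ht
    exact (hψ _ h1 h2).2.1.1 t ⟨hJ0 t ht, h3.le⟩
  · obtain ⟨h1, h2, h3⟩ := hg t ht
    have hd := (hψ _ h1 h2).2.1.2 t ⟨hJ0 t ht, h3.le⟩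
    have hmem : Set.Icc 0 (g t) ∈ 𝓝[J] t := by
      filter_upwards [self_mem_nhdsWithin, mem_nhdsWithin_of_mem_nhds (Iio_mem_nhds h3)] with r hr hr'
      exact ⟨hJ0 r hr, le_of_lt hr'⟩
    refine (hd.mono_of_mem_nhdsWithin hmem).congr_of_eventuallyEq ?_ rfl
    filter_upwards [hmem, self_mem_nhdsWithin] with r hr hrJ
    obtain ⟨h1', h2', h3'⟩ := hg r hrJ
    exact (hagree _ h1' h2' _ h1 h2 r ⟨hr.1, h3'.le⟩ hr.2).1
  · obtain ⟨h1, h2, h3⟩ := hg _ (hmax ht hr)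
    obtain ⟨h1t, h2t, h3t⟩ := hg t ht
    obtain ⟨h1r, h2r, h3r⟩ := hg r hr
    have htL : t ≤ g (max t r) := (le_max_left _ _).trans h3.le
    have hrL : r ≤ g (max t r) := (le_max_right _ _).trans h3.le
    simp only
    rw [(hagree _ h1t h2t _ h1 h2 t ⟨hJ0 t ht, h3t.le⟩ htL).2,
      (hagree _ h1r h2r _ h1 h2 r ⟨hJ0 r hr, h3r.le⟩ hrL).2]
    exact (hψ _ h1 h2).2.2 t ⟨hJ0 t ht, htL⟩ r ⟨hJ0 r hr, hrL⟩

/-- The evolution operators `U t s`, for times `s`, `t ∈ J` in any order. -/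
theorem exists_evolution (hJ0 : ∀ t ∈ J, 0 ≤ t) (hJ : ∀ t ∈ J, Set.Icc 0 t ⊆ J)
    (hJn : ∀ t ∈ J, ∃ L ∈ J, t < L) (h : InvertibleFamily J β A A' R) :
    ∃ U : ℝ → ℝ → E →L[ℂ] E, (∀ s ∈ J, ∀ t ∈ J, ∀ x, ‖U t s x‖ = ‖x‖) ∧
      (∀ t ∈ J, U t t = 1) ∧ (∀ s ∈ J, ∀ r ∈ J, ∀ t ∈ J, U t r * U r s = U t s) ∧
      ∀ s ∈ J, ∀ φ : D, ∃ χ : ℝ → E, IsStrongSolution J R (fun t => U t s φ) χ ∧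
        ∀ t ∈ J, ∀ r ∈ J, ‖χ t‖ ≤ Real.exp (β * |t - r|) * ‖χ r‖ := by
  have hJc : Convex ℝ J :=
    Set.OrdConnected.convex ⟨fun x hx y hy z hz => hJ y hy ⟨(hJ0 x hx).trans hz.1, hz.2⟩⟩
  have hex : ∀ s, ∀ φ : D, ∃ ψ χ : ℝ → E, s ∈ J → ψ s = φ ∧ IsStrongSolution J R ψ χ ∧
      ∀ t ∈ J, ∀ r ∈ J, ‖χ t‖ ≤ Real.exp (β * |t - r|) * ‖χ r‖ := fun s φ => by
    by_cases hs : s ∈ J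
    · obtain ⟨ψ, χ, hψ⟩ := exists_isStrongSolution hJ0 hJ hJn h hs φ
      exact ⟨ψ, χ, fun _ => hψ⟩
    · exact ⟨0, 0, fun h => absurd h hs⟩
  choose ψ χ hψ using hex
  have hop : ∀ t s, ∃ U : E →L[ℂ] E, s ∈ J → t ∈ J →
      (∀ φ : D, U φ = ψ s φ t) ∧ ∀ x, ‖U x‖ = ‖x‖ := fun t s => by
    by_cases hst : s ∈ J ∧ t ∈ J
    swap
    · exact ⟨0, fun h1 h2 => absurd ⟨h1, h2⟩ hst⟩
    obtain ⟨hs, ht⟩ := hst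
    let f : D →ₗ[ℂ] E :=
      { toFun := fun φ => ψ s φ t
        map_add' := fun φ φ' => by
          refine (hψ s (φ + φ') hs).2.1.unique hJc h
            ((hψ s φ hs).2.1.add (hψ s φ' hs).2.1) hs ht ?_
          simp [(hψ s _ hs).1]
        map_smul' := fun c φ => by
          refine (hψ s (c • φ) hs).2.1.unique hJc h
            ((hψ s φ hs).2.1.const_smul c) hs ht ?_
          simp [(hψ s _ hs).1] }
    obtain ⟨U, hU, hU'⟩ := exists_isometric_extension h.dense f (fun φ => by
      have := (hψ s φ hs).2.1.norm_eq hJc h hs ht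
      rwa [(hψ s φ hs).1] at this)
    exact ⟨U, fun _ _ => ⟨hU, hU'⟩⟩
  choose U hU using hop
  have hext : ∀ B B' : E →L[ℂ] E, (∀ φ : D, B φ = B' φ) → B = B' := fun B B' hB =>
    DFunLike.coe_injective
      (Continuous.ext_on h.dense B.continuous B'.continuous fun y hy => hB ⟨y, hy⟩)
  refine ⟨U, fun s hs t ht => (hU t s hs ht).2, fun t ht => hext _ _ fun φ => ?_,
    fun s hs r hr t ht => hext _ _ fun φ => ?_, fun s hs φ => ⟨χ s φ, ?_, (hψ s φ hs).2.2⟩⟩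
  · rw [(hU t t ht ht).1, (hψ t φ ht).1]; rfl
  · have h1 := (hψ s φ hs).2.1
    have hmem : ψ s φ r ∈ D := by rw [h1.1 r hr]; exact h.mem r hr _
    change U t r (U r s φ) = _
    rw [(hU r s hs hr).1, (hU t s hs ht).1,
      (hU t r hr ht).1 ⟨_, hmem⟩]
    exact (hψ r ⟨_, hmem⟩ hr).2.1.unique hJc h h1 hr ht (hψ r ⟨_, hmem⟩ hr).1
  · have h1 := (hψ s φ hs).2.1
    exact ⟨fun t ht => by rw [(hU t s hs ht).1]; exact h1.1 t ht,
      fun t ht => (h1.2 t ht).congr_of_mem (fun r hr => (hU r s hs hr).1 φ) ht⟩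

end InvertibleFamily

/-- An isometric evolution that is strongly continuous in the first time on a dense set is jointly
strongly continuous. -/
theorem continuousOn_evolution {E : Type*} [NormedAddCommGroup E] [InnerProductSpace ℂ E]
    {D : Set E} (hD : Dense D) {J : Set ℝ} {U : ℝ → ℝ → E →L[ℂ] E}
    (hn : ∀ s ∈ J, ∀ t ∈ J, ∀ x, ‖U t s x‖ = ‖x‖) (h1 : ∀ t ∈ J, U t t = 1)
    (hc : ∀ s ∈ J, ∀ r ∈ J, ∀ t ∈ J, U t r * U r s = U t s)
    (hU : ∀ s ∈ J, ∀ φ ∈ D, ContinuousOn (fun t => U t s φ) J) (x : E) :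
    ContinuousOn (fun p : ℝ × ℝ => U p.1 p.2 x) (J ×ˢ J) := by
  have hU' : ∀ s ∈ J, ∀ x, ContinuousOn (fun t => U t s x) J := fun s hs x t ht => by
    rw [Metric.continuousWithinAt_iff']
    intro e he
    obtain ⟨z, hzD, hz⟩ := hD.exists_dist_lt x (show 0 < e / 3 by positivity)
    filter_upwards [self_mem_nhdsWithin,
      Metric.continuousWithinAt_iff'.1 (hU s hs z hzD t ht) (e / 3) (by positivity)] with r hr hrz
    have e1 : dist (U r s x) (U r s z) = dist x z := by
      rw [dist_eq_norm, dist_eq_norm, ← map_sub, hn s hs r hr]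
    have e2 : dist (U t s z) (U t s x) = dist x z := by
      rw [dist_comm, dist_eq_norm, dist_eq_norm, ← map_sub, hn s hs t ht]
    have := dist_triangle4 (U r s x) (U r s z) (U t s z) (U t s x)
    linarith
  rintro ⟨t, s⟩ ⟨ht, hs⟩
  rw [ContinuousWithinAt, tendsto_iff_norm_sub_tendsto_zero]
  have hf1 : Tendsto (fun p : ℝ × ℝ => U p.1 s x - U t s x) (𝓝[J ×ˢ J] (t, s)) (𝓝 0) := by
    have h2 : Tendsto (fun p : ℝ × ℝ => U p.1 s x) (𝓝[J ×ˢ J] (t, s)) (𝓝 (U t s x)) :=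
      (hU' s hs x t ht).tendsto.comp (tendsto_nhdsWithin_iff.2
        ⟨(continuous_fst.tendsto (t, s)).mono_left nhdsWithin_le_nhds,
          by filter_upwards [self_mem_nhdsWithin] with p hp using hp.1⟩)
    simpa using h2.sub_const (U t s x)
  have hf2 : Tendsto (fun p : ℝ × ℝ => U p.2 s x - x) (𝓝[J ×ˢ J] (t, s)) (𝓝 0) := by
    have h2 : Tendsto (fun p : ℝ × ℝ => U p.2 s x) (𝓝[J ×ˢ J] (t, s)) (𝓝 (U s s x)) :=
      (hU' s hs x s hs).tendsto.comp (tendsto_nhdsWithin_iff.2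
        ⟨(continuous_snd.tendsto (t, s)).mono_left nhdsWithin_le_nhds,
          by filter_upwards [self_mem_nhdsWithin] with p hp using hp.2⟩)
    rw [h1 s hs] at h2
    simpa using h2.sub_const x
  have hsum := hf1.norm.add hf2.norm
  rw [norm_zero, add_zero] at hsum
  refine squeeze_zero' (Eventually.of_forall fun _ => norm_nonneg _) ?_ hsum
  filter_upwards [self_mem_nhdsWithin] with p hp
  have e1 : ‖U p.1 p.2 x - U p.1 s x‖ = ‖U p.2 s x - x‖ := by
    have : U p.1 p.2 (U p.2 s x) = U p.1 s x := by
      rw [← hc s hs p.2 hp.2 p.1 hp.1]; rfl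
    rw [← this, ← map_sub, hn p.2 hp.2 p.1 hp.1, norm_sub_rev]
  calc ‖U p.1 p.2 x - U t s x‖
      = ‖(U p.1 s x - U t s x) + (U p.1 p.2 x - U p.1 s x)‖ := by congr 1; abel
    _ ≤ ‖U p.1 s x - U t s x‖ + ‖U p.2 s x - x‖ := by
        rw [← e1]; exact norm_add_le _ _

theorem mem_unitary_of_norm_eq {E : Type*} [NormedAddCommGroup E] [InnerProductSpace ℂ E]
    [CompleteSpace E] {U V : E →L[ℂ] E} (hU : ∀ x, ‖U x‖ = ‖x‖) (h : U * V = 1) :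
    U ∈ unitary (E →L[ℂ] E) := by
  have h1 : star U * U = 1 := (ContinuousLinearMap.norm_map_iff_adjoint_comp_self U).1 hU
  have h2 : star U = V := by
    calc star U = star U * (U * V) := by rw [h, mul_one]
      _ = V := by rw [← mul_assoc, h1, one_mul]
  exact Unitary.mem_iff.2 ⟨h1, by rw [h2, h]⟩

/-! ### The propagator generated by `H(ε t)` -/

section Hamiltonian

variable {E : Type*} [NormedAddCommGroup E] [InnerProductSpace ℂ E]
  {D : Submodule ℂ E} {H : ℝ → D →ₗ[ℂ] E} {T : ℝ}

/-- The derivatives are linear, so that `hamDeriv` does not take its default value. -/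
theorem hamDeriv_apply {n l : ℕ} (hl : l ≤ n)
    (h : ∀ φ : D, ContDiffOn ℝ n (fun s => H s φ) (Set.Ico 0 T)) {s : ℝ} (hs : s ∈ Set.Ico 0 T)
    (φ : D) : hamDeriv H T l s φ = iteratedDerivWithin l (fun r => H r φ) (Set.Ico 0 T) s := by
  have hlin : IsLinearMap ℂ
      (fun φ : D => iteratedDerivWithin l (fun r => H r φ) (Set.Ico 0 T) s) := by
    have hc : ∀ φ : D, ContDiffWithinAt ℝ l (fun s => H s φ) (Set.Ico 0 T) s := fun φ =>
      (h φ s hs).of_le (by exact_mod_cast hl)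
    constructor
    · intro φ φ'
      have := iteratedDerivWithin_add hs (uniqueDiffOn_Ico 0 T) (hc φ) (hc φ')
      rw [← this]
      congr 1
      funext r
      simp
    · intro c φ
      have := iteratedDerivWithin_const_smul hs (uniqueDiffOn_Ico 0 T) c (hc φ)
      rw [← this]
      congr 1
      funext r
      simp
  have h1 : (hamDeriv H T l s).toFun = hlin.mk' _ := dif_pos hlin
  exact LinearMap.congr_fun h1 φ

variable [CompleteSpace E]

theorem isBoundedInverse_ham (hsa : ∀ s ∈ Set.Ico 0 T, IsSelfAdjoint (ham H s)) (h1 : HypH1 H T)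
    {s : ℝ} (hs : s ∈ Set.Ico 0 T) : IsBoundedInverse (ham H s) (boundedInverse (ham H s)) := by
  obtain ⟨R, hR⟩ := exists_isBoundedInverse (hsa s hs) (h1 s hs)
  rwa [boundedInverse_eq hR]

/-- The definition of `α_l` in terms of vectors of the domain: `‖H^{(l)}(s) φ‖ ≤ α_l ‖H(s) φ‖`. -/
theorem norm_iteratedDerivWithin_le (hsa : ∀ s ∈ Set.Ico 0 T, IsSelfAdjoint (ham H s))
    (h1 : HypH1 H T) {n : ℕ} (h2 : HypH2 H T n) {l : ℕ} (hl1 : 1 ≤ l) (hl : l ≤ n) {s : ℝ}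
    (hs : s ∈ Set.Ico 0 T) (φ : D) :
    ‖iteratedDerivWithin l (fun r => H r φ) (Set.Ico 0 T) s‖
      ≤ (alpha H T l).toReal * ‖H s φ‖ := by
  have hR := isBoundedInverse_ham hsa h1 hs
  have hle : opENorm (mul (hamDeriv H T l s) (ofBounded (boundedInverse (ham H s))))
      ≤ alpha H T l :=
    le_iSup₂_of_le (f := fun (s : ℝ) (_ : s ∈ Set.Ico 0 T) =>
      opENorm (mul (hamDeriv H T l s) (ofBounded (boundedInverse (ham H s))))) s hs le_rfl
  have hmem : boundedInverse (ham H s) (H s φ) ∈ D := (hR.1 _).1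
  have hdom : H s φ ∈ (mul (hamDeriv H T l s) (ofBounded (boundedInverse (ham H s)))).domain :=
    mem_mul_ofBounded_domain.2 hmem
  have h3 := norm_le_of_opENorm_lt_top (h2.2 l hl1 hl).2 hle ⟨_, hdom⟩
  have h4 : mul (hamDeriv H T l s) (ofBounded (boundedInverse (ham H s))) ⟨_, hdom⟩
      = hamDeriv H T l s φ := by
    rw [mul_apply hdom trivial hmem]
    congr 1
    exact Subtype.ext (hR.2 φ)
  rwa [h4, hamDeriv_apply hl h2.1 hs] at h3

theorem invertibleFamily_ham (hsa : ∀ s ∈ Set.Ico 0 T, IsSelfAdjoint (ham H s)) (hT : 0 < T)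
    (h1 : HypH1 H T) {n : ℕ} (hn : 1 ≤ n) (h2 : HypH2 H T n) :
    InvertibleFamily (Set.Ico 0 T) (alpha H T 1).toReal H
      (fun s φ => derivWithin (fun r => H r φ) (Set.Ico 0 T) s)
      (fun s => boundedInverse (ham H s)) where
  dense := (hsa 0 ⟨le_rfl, hT⟩).dense_domain
  mem s hs x := ((isBoundedInverse_ham hsa h1 hs).1 x).1
  right s hs x h := ((isBoundedInverse_ham hsa h1 hs).1 x).2
  left s hs φ := (isBoundedInverse_ham hsa h1 hs).2 φ
  pos s hs := by
    have hR := isBoundedInverse_ham hsa h1 hs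
    refine ⟨fun x y => ?_, fun x => ?_⟩
    · obtain ⟨hx, ex⟩ := hR.1 x
      obtain ⟨hy, ey⟩ := hR.1 y
      have := inner_apply_left_of_isSelfAdjoint (hsa s hs) ⟨_, hx⟩ ⟨_, hy⟩
      rw [ex, ey] at this
      exact this.symm
    · obtain ⟨hx, ex⟩ := hR.1 x
      have := h1 s hs ⟨_, hx⟩
      rw [show H s ⟨_, hx⟩ = x from ex] at this
      exact (sq_nonneg _).trans this
  norm_le s hs x := by
    have hR := isBoundedInverse_ham hsa h1 hs
    obtain ⟨hx, ex⟩ := hR.1 x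
    have h3 := h1 s hs ⟨_, hx⟩
    rw [show H s ⟨_, hx⟩ = x from ex] at h3
    have h4 := h3.trans ((Complex.re_le_norm _).trans (norm_inner_le_norm _ _))
    rcases (norm_nonneg (boundedInverse (ham H s) x)).eq_or_lt with h0 | h0
    · rw [← h0]; positivity
    · rw [sq] at h4
      exact le_of_mul_le_mul_left h4 h0
  deriv s hs φ := ((h2.1 φ).differentiableOn (by exact_mod_cast (by omega : n ≠ 0)) s
    hs).hasDerivWithinAt
  bound s hs φ := by
    have := norm_iteratedDerivWithin_le hsa h1 h2 le_rfl hn hs φ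
    rwa [iteratedDerivWithin_one] at this

end Hamiltonian

namespace InvertibleFamily

variable {E : Type*} [NormedAddCommGroup E] [InnerProductSpace ℂ E]
  {D : Submodule ℂ E} {S : Set ℝ} {β : ℝ} {A : ℝ → D →ₗ[ℂ] E} {A' : ℝ → D → E}
  {R : ℝ → E →L[ℂ] E}

theorem comp_mul (h : InvertibleFamily S β A A' R) {ε : ℝ} (hε : 0 ≤ ε) {J : Set ℝ}
    (hJ : ∀ t ∈ J, ε * t ∈ S) :
    InvertibleFamily J (β * ε) (fun t => A (ε * t)) (fun t φ => ε • A' (ε * t) φ)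
      (fun t => R (ε * t)) where
  dense := h.dense
  mem t ht := h.mem _ (hJ t ht)
  right t ht := h.right _ (hJ t ht)
  left t ht := h.left _ (hJ t ht)
  pos t ht := h.pos _ (hJ t ht)
  norm_le t ht := h.norm_le _ (hJ t ht)
  deriv t ht φ := by
    have h1 : HasDerivWithinAt (fun t => ε * t) ε J t := by
      simpa using (hasDerivWithinAt_id t J).const_mul ε
    exact (h.deriv _ (hJ t ht) φ).scomp t h1 (fun r hr => hJ r hr)
  bound t ht φ := by
    rw [norm_smul, Real.norm_eq_abs, abs_of_nonneg hε, mul_comm β ε, mul_assoc]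
    exact mul_le_mul_of_nonneg_left (h.bound _ (hJ t ht) φ) hε

end InvertibleFamily

section Propagator

variable {E : Type*} [NormedAddCommGroup E] [InnerProductSpace ℂ E] [CompleteSpace E]
  {D : Submodule ℂ E} {H : ℝ → D →ₗ[ℂ] E} {T ε : ℝ}

/-- Uniqueness of the propagator. -/
theorem IsPropagator.eq {β : ℝ} {A' : ℝ → D → E} {R : ℝ → E →L[ℂ] E}
    (hε : 0 ≤ ε) (hA : InvertibleFamily (Set.Ico 0 T) β H A' R)
    {U V : ℝ → ℝ → E →L[ℂ] E} (hU : IsPropagator H T ε U) (hV : IsPropagator H T ε V) {t' t : ℝ}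
    (ht' : 0 ≤ t') (htt : t' ≤ t) (ht : ε * t < T) : U t t' = V t t' := by
  have hlt : ∀ r ≤ t, ε * r < T := fun r hr => (mul_le_mul_of_nonneg_left hr hε).trans_lt ht
  have hA1 := hA.comp_mul hε (J := Set.Icc t' t) (fun r hr =>
    ⟨mul_nonneg hε (ht'.trans hr.1), hlt r hr.2⟩)
  have hsol : ∀ W : ℝ → ℝ → E →L[ℂ] E, IsPropagator H T ε W → ∀ φ : D, ∃ χ,
      InvertibleFamily.IsStrongSolution (Set.Icc t' t) (fun t => R (ε * t))
        (fun τ => W τ t' φ) χ := by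
    intro W hW φ
    have hex : ∀ r : ℝ, ∃ z, r ∈ Set.Icc t' t → W r t' φ = R (ε * r) z ∧
        HasDerivWithinAt (fun τ => W τ t' φ) (-Complex.I • z) (Set.Icc t' t) r := by
      intro r
      by_cases hr : r ∈ Set.Icc t' t
      · obtain ⟨hmem, hd⟩ := hW.schrodinger t' r ht' hr.1 (hlt r hr.2) φ
        refine ⟨H (ε * r) ⟨_, hmem⟩, fun _ => ⟨(hA1.left r hr ⟨_, hmem⟩).symm, ?_⟩⟩
        exact hd.mono fun w hw => ⟨hw.1, hlt w hw.2⟩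
      · exact ⟨0, fun h => absurd h hr⟩
    choose χ hχ using hex
    exact ⟨χ, ⟨fun r hr => (hχ r hr).1, fun r hr => (hχ r hr).2⟩⟩
  refine DFunLike.coe_injective
    (Continuous.ext_on hA.dense (U t t').continuous (V t t').continuous fun y hy => ?_)
  obtain ⟨χ, hχ⟩ := hsol U hU ⟨y, hy⟩
  obtain ⟨χ', hχ'⟩ := hsol V hV ⟨y, hy⟩
  have hself : ε * t' < T := hlt t' htt
  exact hχ.unique (convex_Icc _ _) hA1 hχ' ⟨le_rfl, htt⟩ ⟨htt, le_rfl⟩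
    (by simp [hU.apply_self t' ht' hself, hV.apply_self t' ht' hself])

/-- Existence of the propagator, together with its exponential bound in the graph norm. -/
theorem exists_isPropagator {β : ℝ} {A' : ℝ → D → E} {R : ℝ → E →L[ℂ] E}
    (hε : 0 ≤ ε) (hA : InvertibleFamily (Set.Ico 0 T) β H A' R) :
    ∃ U : ℝ → ℝ → E →L[ℂ] E, IsPropagator H T ε U ∧
      ∀ t' t, 0 ≤ t' → t' ≤ t → ε * t < T → ∀ φ : D, ∃ h : U t t' φ ∈ D,
        ‖H (ε * t) ⟨U t t' φ, h⟩‖ ≤ Real.exp (β * ε * (t - t')) * ‖H (ε * t') φ‖ := by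
  set J : Set ℝ := {t | 0 ≤ t ∧ ε * t < T} with hJdef
  have hlt : ∀ {r t : ℝ}, ε * t < T → r ≤ t → ε * r < T := fun ht hr =>
    (mul_le_mul_of_nonneg_left hr hε).trans_lt ht
  have hJn : ∀ t ∈ J, ∃ L ∈ J, t < L := by
    intro t ht
    have hopen : IsOpen {r : ℝ | ε * r < T} := isOpen_lt (by fun_prop) continuous_const
    obtain ⟨L, hL, hL'⟩ := exists_Ico_subset_of_mem_nhds (hopen.mem_nhds ht.2) (exists_gt t)
    have hm : (t + L) / 2 ∈ Set.Ico t L := ⟨by linarith, by linarith⟩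
    exact ⟨(t + L) / 2, ⟨by linarith [ht.1], hL' hm⟩, by linarith⟩
  have hJ : ∀ t ∈ J, Set.Icc 0 t ⊆ J := fun t ht r hr => ⟨hr.1, hlt ht.2 hr.2⟩
  have hAJ := hA.comp_mul hε (J := J) (fun r hr => ⟨mul_nonneg hε hr.1, hr.2⟩)
  obtain ⟨U, hn, h1, hc, hs⟩ :=
    InvertibleFamily.exists_evolution (fun t ht => ht.1) hJ hJn hAJ
  have hmemD : ∀ {t' t : ℝ}, t' ∈ J → t ∈ J → ∀ φ : D, U t t' φ ∈ D := fun ht' ht φ => by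
    obtain ⟨χ, hχ, -⟩ := hs _ ht' φ
    rw [hχ.1 _ ht]
    exact hAJ.mem _ ht _
  have hHchi : ∀ {t : ℝ} (_ : t ∈ J) {x z : E} (hx : x ∈ D), x = R (ε * t) z →
      H (ε * t) ⟨x, hx⟩ = z := fun ht x z hx e => by
    subst e
    exact hAJ.right _ ht z hx
  refine ⟨U, ⟨fun t' t h0 h01 ht => ?_, fun t h0 ht => h1 t ⟨h0, ht⟩,
    fun t' r t h0 h01 h12 ht => hc t' ⟨h0, hlt ht (h01.trans h12)⟩ r
      ⟨h0.trans h01, hlt ht h12⟩ t ⟨h0.trans (h01.trans h12), ht⟩, fun x => ?_,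
    fun t' t h0 h01 ht φ => ?_⟩, fun t' t h0 h01 ht φ => ?_⟩
  · have ht'J : t' ∈ J := ⟨h0, hlt ht h01⟩
    have htJ : t ∈ J := ⟨h0.trans h01, ht⟩
    exact mem_unitary_of_norm_eq (hn t' ht'J t htJ) ((hc t htJ t' ht'J t htJ).trans (h1 t htJ))
  · refine (continuousOn_evolution hA.dense hn h1 hc (fun s hs' φ hφ t ht => ?_) x).mono ?_
    · obtain ⟨χ, hχ, -⟩ := hs s hs' ⟨φ, hφ⟩
      exact (hχ.2 t ht).continuousWithinAt
    · rintro ⟨t, t'⟩ ⟨h0, h01, ht⟩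
      exact ⟨⟨h0.trans h01, ht⟩, ⟨h0, hlt ht h01⟩⟩
  · have ht'J : t' ∈ J := ⟨h0, hlt ht h01⟩
    have htJ : t ∈ J := ⟨h0.trans h01, ht⟩
    obtain ⟨χ, hχ, -⟩ := hs t' ht'J φ
    refine ⟨hmemD ht'J htJ φ, ?_⟩
    rw [hHchi htJ _ (hχ.1 t htJ)]
    exact (hχ.2 t htJ).mono fun r hr => ⟨h0.trans hr.1, hr.2⟩
  · have ht'J : t' ∈ J := ⟨h0, hlt ht h01⟩
    have htJ : t ∈ J := ⟨h0.trans h01, ht⟩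
    obtain ⟨χ, hχ, hb⟩ := hs t' ht'J φ
    refine ⟨hmemD ht'J htJ φ, ?_⟩
    rw [hHchi htJ _ (hχ.1 t htJ)]
    have h3 := hb t htJ t' ht'J
    have h4 : H (ε * t') φ = χ t' := by
      refine hHchi ht'J φ.2 ?_
      have := hχ.1 t' ht'J
      simp only [h1 t' ht'J] at this
      exact this
    rwa [abs_of_nonneg (sub_nonneg.2 h01), ← h4] at h3

end Propagator

/-! ### Bounds of the propagator, and interpolation -/

section Heinz

variable {E : Type*} [NormedAddCommGroup E] [InnerProductSpace ℂ E] [CompleteSpace E]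

theorem cfc_sqrt_apply_apply {R : E →L[ℂ] E} (hR : R.IsPositive) (x : E) :
    cfc Real.sqrt R (cfc Real.sqrt R x) = R x := by
  have hsa : IsSelfAdjoint R := hR.isSelfAdjoint
  have h1 : cfc Real.sqrt R * cfc Real.sqrt R = R := by
    rw [← cfc_mul Real.sqrt Real.sqrt R]
    nth_rw 2 [← cfc_id ℝ R]
    refine cfc_congr fun x hx => ?_
    exact Real.mul_self_sqrt (spectrum_nonneg_of_nonneg
      ((ContinuousLinearMap.nonneg_iff_isPositive R).2 hR) hx)
  exact congrArg (fun B : E →L[ℂ] E => B x) h1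

theorem inner_cfc_sqrt_left (R : E →L[ℂ] E) (x y : E) :
    ⟪cfc Real.sqrt R x, y⟫_ℂ = ⟪x, cfc Real.sqrt R y⟫_ℂ := by
  have h : IsSelfAdjoint (cfc Real.sqrt R) := cfc_predicate _ _
  exact h.isSymmetric x y

theorem norm_sq_cfc_sqrt_apply {R : E →L[ℂ] E} (hR : R.IsPositive) (x : E) :
    ‖cfc Real.sqrt R x‖ ^ 2 = (⟪x, R x⟫_ℂ).re := by
  rw [← cfc_sqrt_apply_apply hR, ← inner_cfc_sqrt_left]
  exact norm_sq_eq_re_inner (𝕜 := ℂ) _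

/-- Operator monotonicity of the square root (Löwner-Heinz), as a comparison of norms. -/
theorem re_inner_le_of_norm_le {A B : E →L[ℂ] E} (hA : A.IsPositive) (hB : B.IsPositive)
    (h : ∀ x, ‖A x‖ ≤ ‖B x‖) (x : E) : (⟪x, A x⟫_ℂ).re ≤ (⟪x, B x⟫_ℂ).re := by
  have hA0 := (ContinuousLinearMap.nonneg_iff_isPositive A).2 hA
  have hB0 := (ContinuousLinearMap.nonneg_iff_isPositive B).2 hB
  have hsq : ∀ {C : E →L[ℂ] E} (_ : C.IsPositive) (x : E), ⟪(C * C) x, x⟫_ℂ = ((‖C x‖ ^ 2 : ℝ) : ℂ) :=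
    fun hC x => by
      rw [mul_apply_eq_comp, inner_apply_left_of_isPositive hC,
        inner_self_eq_norm_sq_to_K]
      simp
  have h1 : A * A ≤ B * B := by
    rw [ContinuousLinearMap.le_def]
    have hsa : IsSelfAdjoint (B * B - A * A) := by
      have e1 := hA.isSelfAdjoint
      have e2 := hB.isSelfAdjoint
      refine IsSelfAdjoint.sub ?_ ?_ <;> simp [IsSelfAdjoint, star_mul, e1.star_eq, e2.star_eq]
    refine ⟨hsa.isSymmetric, fun y => ?_⟩
    rw [ContinuousLinearMap.reApplyInnerSelf_apply, sub_apply, inner_sub_left,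
      hsq hA, hsq hB, ← Complex.ofReal_sub]
    have : ‖A y‖ ^ 2 ≤ ‖B y‖ ^ 2 := by gcongr; exact h y
    change 0 ≤ ((‖B y‖ ^ 2 - ‖A y‖ ^ 2 : ℝ) : ℂ).re
    rw [Complex.ofReal_re]
    linarith
  have h2 := CFC.sqrt_le_sqrt _ _ h1
  rw [CFC.sqrt_mul_self A hA0, CFC.sqrt_mul_self B hB0, ContinuousLinearMap.le_def] at h2
  have h3 := h2.re_inner_nonneg_right x
  rw [sub_apply, inner_sub_right] at h3
  have h4 : 0 ≤ (⟪x, B x⟫_ℂ).re - (⟪x, A x⟫_ℂ).re := h3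
  linarith

/-- Interpolation: if `R⁻¹ U R'` is bounded by `c`, then `R^{-1/2} U R'^{1/2}` is bounded
by `√c`. -/
theorem exists_cfc_sqrt_apply_eq {R R' U : E →L[ℂ] E} (hR : R.IsPositive)
    (hinj : Function.Injective R) (hR' : R'.IsPositive) (hU : U ∈ unitary (E →L[ℂ] E)) {c : ℝ}
    (hc : 0 ≤ c) (h : ∀ x, ∃ z, U (R' x) = R z ∧ ‖z‖ ≤ c * ‖x‖) (x : E) :
    ∃ z, U (cfc Real.sqrt R' x) = cfc Real.sqrt R z ∧ ‖z‖ ≤ √c * ‖x‖ := by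
  have hUU : ∀ x, star U (U x) = x := fun x =>
    congrArg (fun B : E →L[ℂ] E => B x) (Unitary.star_mul_self_of_mem hU)
  have hUU' : ∀ x, U (star U x) = x := fun x =>
    congrArg (fun B : E →L[ℂ] E => B x) (Unitary.mul_star_self_of_mem hU)
  have hUadj : ∀ x y, ⟪star U x, y⟫_ℂ = ⟪x, U y⟫_ℂ := fun x y =>
    ContinuousLinearMap.adjoint_inner_left U y x
  have hUadj' : ∀ x y, ⟪U x, y⟫_ℂ = ⟪x, star U y⟫_ℂ := fun x y =>
    (ContinuousLinearMap.adjoint_inner_right U x y).symm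
  have hUn : ∀ x, ‖star U x‖ = ‖x‖ := fun x => by
    have h1 : ⟪star U x, star U x⟫_ℂ = ⟪x, x⟫_ℂ := by rw [hUadj, hUU']
    rw [inner_self_eq_norm_sq_to_K, inner_self_eq_norm_sq_to_K] at h1
    have h2 : ‖star U x‖ ^ 2 = ‖x‖ ^ 2 := by exact_mod_cast h1
    exact (sq_eq_sq₀ (norm_nonneg _) (norm_nonneg _)).1 h2
  -- the hypothesis gives `R'² ≤ B²` for `B = c U* R U`, hence `R' ≤ B` by monotonicity
  set B : E →L[ℂ] E := (c : ℂ) • (star U * R * U) with hB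
  have hBx : ∀ x, B x = (c : ℂ) • star U (R (U x)) := fun x => rfl
  have hBpos : B.IsPositive := by
    refine ⟨fun x y => ?_, fun x => ?_⟩
    · change ⟪B x, y⟫_ℂ = ⟪x, B y⟫_ℂ
      rw [hBx, hBx, inner_smul_left, inner_smul_right, hUadj, inner_apply_left_of_isPositive hR,
        hUadj']
      simp
    · rw [ContinuousLinearMap.reApplyInnerSelf_apply, hBx, inner_smul_left, hUadj]
      have h1 : 0 ≤ (⟪R (U x), U x⟫_ℂ).re := hR.re_inner_nonneg_left _
      change 0 ≤ (_ : ℂ).re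
      rw [Complex.conj_ofReal, Complex.re_ofReal_mul]
      exact mul_nonneg hc h1
  have hle : ∀ x, ‖R' x‖ ≤ ‖B x‖ := fun x => by
    obtain ⟨z, hz, hzn⟩ := h (R' x)
    have h1 : ⟪R' x, R' x⟫_ℂ = ⟪R (U x), z⟫_ℂ := by
      rw [inner_apply_left_of_isPositive hR', inner_apply_left_of_isPositive hR, ← hz, hUadj',
        hUU]
    have h2 : ‖R' x‖ ^ 2 ≤ ‖R (U x)‖ * (c * ‖R' x‖) := by
      rw [norm_sq_eq_re_inner (𝕜 := ℂ), h1]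
      refine (Complex.re_le_norm _).trans ((norm_inner_le_norm _ _).trans ?_)
      gcongr
    rw [hBx, norm_smul, hUn, Complex.norm_real, Real.norm_eq_abs, abs_of_nonneg hc]
    rcases (norm_nonneg (R' x)).eq_or_lt with h0 | h0
    · rw [← h0]; positivity
    · refine le_of_mul_le_mul_left (a := ‖R' x‖) ?_ h0
      nlinarith
  have hsqrt : ∀ y, ‖cfc Real.sqrt R' y‖ ≤ √c * ‖cfc Real.sqrt R (U y)‖ := fun y => by
    have h1 := re_inner_le_of_norm_le hR' hBpos hle y
    rw [hBx, inner_smul_right, ← hUadj', Complex.re_ofReal_mul, ← norm_sq_cfc_sqrt_apply hR',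
      ← norm_sq_cfc_sqrt_apply hR] at h1
    refine le_of_sq_le_sq ?_ (by positivity)
    rwa [mul_pow, Real.sq_sqrt hc]
  have hinj' : Function.Injective (cfc Real.sqrt R : E →L[ℂ] E) := fun y y' hyy => hinj <| by
    rw [← cfc_sqrt_apply_apply hR, hyy, cfc_sqrt_apply_apply hR]
  obtain ⟨z, hz, hze⟩ := exists_adjoint_apply_eq (cfc Real.sqrt R) hinj'
    (C := √c * ‖x‖) (by positivity) (U (cfc Real.sqrt R' x)) (fun w => by
      rw [hUadj', inner_cfc_sqrt_left]
      refine (norm_inner_le_norm _ _).trans ?_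
      have := hsqrt (star U w)
      rw [hUU'] at this
      calc ‖x‖ * ‖cfc Real.sqrt R' (star U w)‖ ≤ ‖x‖ * (√c * ‖cfc Real.sqrt R w‖) := by gcongr
        _ = _ := by ring)
  have hsa : IsSelfAdjoint (cfc Real.sqrt R) := cfc_predicate _ _
  rw [hsa.adjoint_eq] at hze
  exact ⟨z, hze.symm, hz⟩

end Heinz

section Bounds

variable {E : Type*} [NormedAddCommGroup E] [InnerProductSpace ℂ E] [CompleteSpace E]
  {D : Submodule ℂ E} {H : ℝ → D →ₗ[ℂ] E} {T ε : ℝ}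

theorem sqrtOp_apply {A : E →ₗ.[ℂ] E} (hinj : Function.Injective (invSqrt A)) (z : E) :
    ∃ h : invSqrt A z ∈ (sqrtOp A).domain, sqrtOp A ⟨invSqrt A z, h⟩ = z := by
  have hker : (ofBounded (invSqrt A)).toFun.ker = ⊥ := by
    rw [LinearMap.ker_eq_bot]
    intro x y hxy
    exact Subtype.ext (hinj hxy)
  have hmem : invSqrt A z ∈ (sqrtOp A).domain := by
    rw [sqrtOp, LinearPMap.inverse_domain]
    exact ⟨⟨z, trivial⟩, rfl⟩
  exact ⟨hmem, LinearPMap.inverse_apply_eq hker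
    (x := (⟨z, trivial⟩ : (ofBounded (invSqrt A)).domain)) rfl⟩

/-- The bounds of the propagator in the norms of the domain and of the form domain. By uniqueness, it
is enough to have them for the propagator that was constructed. -/
theorem IsPropagator.opENorm_le (hsa : ∀ s ∈ Set.Ico 0 T, IsSelfAdjoint (ham H s)) (hT : 0 < T)
    (h1 : HypH1 H T) {n : ℕ} (hn : 1 ≤ n) (h2 : HypH2 H T n) (hε : 0 ≤ ε)
    {U : ℝ → ℝ → E →L[ℂ] E} (hU : IsPropagator H T ε U) {t' t : ℝ} (h0 : 0 ≤ t') (h01 : t' ≤ t)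
    (ht : ε * t < T) :
    opENorm (mul (mul (ham H (ε * t)) (ofBounded (U t t')))
        (ofBounded (boundedInverse (ham H (ε * t'))))) ≤
      ENNReal.ofReal (Real.exp ((alpha H T 1).toReal * ε * (t - t'))) ∧
    opENorm (mul (mul (sqrtOp (ham H (ε * t))) (ofBounded (U t t')))
        (ofBounded (invSqrt (ham H (ε * t'))))) ≤
      ENNReal.ofReal (Real.exp ((alpha H T 1).toReal * ε * (t - t') / 2)) := by
  have hA := invertibleFamily_ham hsa hT h1 hn h2
  obtain ⟨V, hV, hb⟩ := exists_isPropagator hε hA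
  have hUV := hU.eq hε hA hV h0 h01 ht
  have hb' := hb t' t h0 h01 ht
  rw [← hUV] at hb'
  have hs : ε * t ∈ Set.Ico 0 T := ⟨mul_nonneg hε (h0.trans h01), ht⟩
  have hs' : ε * t' ∈ Set.Ico 0 T :=
    ⟨mul_nonneg hε h0, (mul_le_mul_of_nonneg_left h01 hε).trans_lt ht⟩
  have hmem' : ∀ x, boundedInverse (ham H (ε * t')) x ∈ D := hA.mem _ hs'
  constructor
  · refine opENorm_le_ofReal (Real.exp_pos _).le fun x => ?_
    obtain ⟨hm, hle⟩ := hb' ⟨_, hmem' x⟩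
    rw [hA.right _ hs'] at hle
    have hx1 : boundedInverse (ham H (ε * t')) x ∈
        (mul (ham H (ε * t)) (ofBounded (U t t'))).domain := mem_mul_ofBounded_domain.2 hm
    refine ⟨mem_mul_ofBounded_domain.2 hx1, ?_⟩
    rw [mul_apply (mem_mul_ofBounded_domain.2 hx1) trivial hx1]
    exact hle
  · refine opENorm_le_ofReal (Real.exp_pos _).le fun x => ?_
    obtain ⟨z, hz, hzn⟩ := exists_cfc_sqrt_apply_eq (hA.pos _ hs) (hA.injective_inv hs)
      (hA.pos _ hs') (hU.unitary_mem t' t h0 h01 ht)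
      (Real.exp_pos ((alpha H T 1).toReal * ε * (t - t'))).le (fun y => by
        obtain ⟨hm, hle⟩ := hb' ⟨_, hmem' y⟩
        rw [hA.right _ hs'] at hle
        exact ⟨_, (hA.left _ hs ⟨_, hm⟩).symm, hle⟩) x
    rw [← Real.exp_half] at hzn
    have hinj : Function.Injective (invSqrt (ham H (ε * t))) := fun y y' hyy =>
      hA.injective_inv hs <| by
        rw [← cfc_sqrt_apply_apply (hA.pos _ hs)]
        change invSqrt (ham H (ε * t)) (invSqrt (ham H (ε * t)) y) = _
        rw [hyy]
        exact cfc_sqrt_apply_apply (hA.pos _ hs) y'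
    obtain ⟨hdom, hval⟩ := sqrtOp_apply hinj z
    have hz' : U t t' (invSqrt (ham H (ε * t')) x) = invSqrt (ham H (ε * t)) z := hz
    have hdom' : U t t' (invSqrt (ham H (ε * t')) x) ∈ (sqrtOp (ham H (ε * t))).domain := by
      rw [hz']; exact hdom
    have hx1 : invSqrt (ham H (ε * t')) x ∈
        (mul (sqrtOp (ham H (ε * t))) (ofBounded (U t t'))).domain :=
      mem_mul_ofBounded_domain.2 hdom'
    refine ⟨mem_mul_ofBounded_domain.2 hx1, ?_⟩
    have e : mul (mul (sqrtOp (ham H (ε * t))) (ofBounded (U t t')))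
        (ofBounded (invSqrt (ham H (ε * t')))) ⟨x, mem_mul_ofBounded_domain.2 hx1⟩ = z := by
      rw [mul_apply (mem_mul_ofBounded_domain.2 hx1) trivial hx1]
      refine Eq.trans ?_ hval
      change sqrtOp (ham H (ε * t)) ⟨U t t' (invSqrt (ham H (ε * t')) x), hdom'⟩ = _
      congr 1
      exact Subtype.ext hz'
    rw [e]
    exact hzn

end Bounds

/-! ### The commutator equation for a gap projection -/

section Sylvester

variable {𝔸 : Type*} [NormedRing 𝔸]

theorem eq_zero_of_eq_mul_mul {K G X : 𝔸} (hK : ‖K‖ * ‖G‖ < 1) (hX : X = K * X * G) : X = 0 := by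
  by_contra hne
  have hpos : 0 < ‖X‖ := norm_pos_iff.2 hne
  have h1 : ‖X‖ ≤ ‖K‖ * ‖X‖ * ‖G‖ := by
    nth_rw 1 [hX]
    exact (norm_mul_le _ _).trans (mul_le_mul_of_nonneg_right (norm_mul_le _ _) (norm_nonneg _))
  nlinarith

/-- The off-diagonal part of `X` is off-diagonal. -/
theorem off_mul_eq {P : 𝔸} (hP : P * P = P) (X Y : 𝔸) :
    P * X * (1 - P) + (1 - P) * X * P = Y → P * Y * P = 0 ∧ (1 - P) * Y * (1 - P) = 0 := by
  have h1 : (1 - P) * P = 0 := by rw [sub_mul, one_mul, hP, sub_self]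
  have h2 : P * (1 - P) = 0 := by rw [mul_sub, mul_one, hP, sub_self]
  rintro rfl
  constructor
  · simp only [mul_add, add_mul, mul_assoc, h1, mul_zero, zero_add]
    simp only [← mul_assoc, h2, zero_mul]
  · simp only [mul_add, add_mul, mul_assoc, h2, mul_zero, add_zero]
    simp only [← mul_assoc, h1, zero_mul]

theorem off_add_diag (P X : 𝔸) : P * X * (1 - P) + (1 - P) * X * P + P * X * P
    + (1 - P) * X * (1 - P) = X := by
  noncomm_ring

variable [NormedAlgebra ℂ 𝔸]

/-- `P` is a spectral projector of `R`, for a part of the spectrum in the ball of radius `r` around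
`c`, the rest being at distance at least `r' > r` from `c`; `G` is the reduced inverse of `R - c`
on the range of `1 - P`. -/
structure IsGapProjection (R P G : 𝔸) (c r r' : ℝ) : Prop where
  idem : P * P = P
  comm : R * P = P * R
  mul_right : G * P = 0
  mul_left : P * G = 0
  inv_mul : G * (R - algebraMap ℝ 𝔸 c) = 1 - P
  mul_inv : (R - algebraMap ℝ 𝔸 c) * G = 1 - P
  norm_le : ‖(R - algebraMap ℝ 𝔸 c) * P‖ ≤ r
  norm_inv_le : ‖G‖ ≤ r'⁻¹
  lt : r < r'

namespace IsGapProjection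

variable {R P G : 𝔸} {c r r' : ℝ}

theorem comm_sub (h : IsGapProjection R P G c r r') :
    (R - algebraMap ℝ 𝔸 c) * P = P * (R - algebraMap ℝ 𝔸 c) := by
  rw [sub_mul, mul_sub, h.comm, Algebra.commutes]

theorem nonneg (h : IsGapProjection R P G c r r') : 0 ≤ r := (norm_nonneg _).trans h.norm_le

theorem norm_mul_lt (h : IsGapProjection R P G c r r') :
    ‖(R - algebraMap ℝ 𝔸 c) * P‖ * ‖G‖ < 1 := by
  have hr' : 0 < r' := h.nonneg.trans_lt h.lt
  calc ‖(R - algebraMap ℝ 𝔸 c) * P‖ * ‖G‖ ≤ r * r'⁻¹ :=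
        mul_le_mul h.norm_le h.norm_inv_le (norm_nonneg _) h.nonneg
    _ < 1 := by rw [← div_eq_mul_inv, div_lt_one hr']; exact h.lt

theorem exists_sub_mul_mul_eq [CompleteSpace 𝔸] {K G : 𝔸} (hK : ‖K‖ * ‖G‖ < 1) (C : 𝔸) :
    ∃ X : 𝔸, X = K * X * G + C := by
  let Φ : 𝔸 →L[ℂ] 𝔸 := ContinuousLinearMap.mulLeftRight ℂ 𝔸 K G
  have hΦ : ‖Φ‖ < 1 := (ContinuousLinearMap.opNorm_mulLeftRight_apply_apply_le ℂ 𝔸 K G).trans_lt hK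
  obtain ⟨u, hu⟩ := isUnit_one_sub_of_norm_lt_one hΦ
  refine ⟨(↑u⁻¹ : 𝔸 →L[ℂ] 𝔸) C, ?_⟩
  have h1 : (1 - Φ) ((↑u⁻¹ : 𝔸 →L[ℂ] 𝔸) C) = C := by
    rw [← hu]
    exact congrArg (fun B : 𝔸 →L[ℂ] 𝔸 => B C) u.mul_inv
  have h2 : (1 - Φ) ((↑u⁻¹ : 𝔸 →L[ℂ] 𝔸) C)
      = (↑u⁻¹ : 𝔸 →L[ℂ] 𝔸) C - K * (↑u⁻¹ : 𝔸 →L[ℂ] 𝔸) C * G := rfl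
  rw [h2] at h1
  exact sub_eq_iff_eq_add'.1 h1

theorem eq_zero_of_commute_upper (h : IsGapProjection R P G c r r') {X : 𝔸} (h1 : P * X = X)
    (h2 : X * P = 0) (hX : R * X = X * R) : X = 0 := by
  refine eq_zero_of_eq_mul_mul h.norm_mul_lt ?_
  have h3 : (R - algebraMap ℝ 𝔸 c) * X = X * (R - algebraMap ℝ 𝔸 c) := by
    rw [sub_mul, mul_sub, hX, Algebra.commutes]
  rw [mul_assoc _ P X, h1, h3, mul_assoc, h.mul_inv, mul_sub, mul_one, h2, sub_zero]

theorem eq_zero_of_commute_lower (h : IsGapProjection R P G c r r') {X : 𝔸} (h1 : P * X = 0)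
    (h2 : X * P = X) (hX : R * X = X * R) : X = 0 := by
  refine eq_zero_of_eq_mul_mul (K := G) (G := (R - algebraMap ℝ 𝔸 c) * P)
    (by rw [mul_comm]; exact h.norm_mul_lt) ?_
  have h3 : (R - algebraMap ℝ 𝔸 c) * X = X * (R - algebraMap ℝ 𝔸 c) := by
    rw [sub_mul, mul_sub, hX, Algebra.commutes]
  rw [← mul_assoc, mul_assoc G X, ← h3, ← mul_assoc, h.inv_mul, mul_assoc, h2, sub_mul, h1,
    one_mul, sub_zero]

variable [CompleteSpace 𝔸]

theorem exists_commutator_eq_upper (h : IsGapProjection R P G c r r') (C : 𝔸) :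
    ∃ X : 𝔸, P * X = X ∧ X * P = 0 ∧ R * X - X * R = P * C * (1 - P) := by
  obtain ⟨X, hX⟩ := exists_sub_mul_mul_eq h.norm_mul_lt (-(P * C * (1 - P) * G))
  set K := (R - algebraMap ℝ 𝔸 c) * P with hK
  have hPK : P * K = K := by rw [hK, h.comm_sub, ← mul_assoc, h.idem]
  have h1 : P * X = X := by
    nth_rw 1 [hX]
    rw [mul_add, mul_neg, ← mul_assoc, ← mul_assoc, hPK]
    simp only [← mul_assoc]
    rw [h.idem]
    simp only [mul_assoc] at hX ⊢
    exact hX.symm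
  have h2 : X * P = 0 := by
    rw [hX, add_mul, neg_mul, mul_assoc _ G P, mul_assoc _ G P, h.mul_right]
    simp
  refine ⟨X, h1, h2, ?_⟩
  have h3 : R * X - X * R
      = (R - algebraMap ℝ 𝔸 c) * X - X * (R - algebraMap ℝ 𝔸 c) := by
    rw [sub_mul, mul_sub, Algebra.commutes c X]; abel
  have h4 : X * (R - algebraMap ℝ 𝔸 c) = (R - algebraMap ℝ 𝔸 c) * X - P * C * (1 - P) := by
    nth_rw 1 [hX]
    rw [add_mul, neg_mul, mul_assoc _ G, mul_assoc _ G, h.inv_mul, mul_sub (K * X), mul_one,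
      mul_assoc K X P, h2, mul_zero, sub_zero, hK, mul_assoc _ P X, h1]
    have : (1 - P) * (1 - P) = 1 - P := by
      rw [mul_sub, mul_one, sub_mul, one_mul, h.idem, sub_self, sub_zero]
    rw [mul_assoc (P * C), this, ← sub_eq_add_neg]
  rw [h3, h4]; abel

theorem exists_commutator_eq_lower (h : IsGapProjection R P G c r r') (C : 𝔸) :
    ∃ X : 𝔸, P * X = 0 ∧ X * P = X ∧ R * X - X * R = (1 - P) * C * P := by
  obtain ⟨X, hX⟩ := exists_sub_mul_mul_eq (K := G) (G := (R - algebraMap ℝ 𝔸 c) * P)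
    (by rw [mul_comm]; exact h.norm_mul_lt) (G * ((1 - P) * C * P))
  set K := (R - algebraMap ℝ 𝔸 c) * P with hK
  have hKP : K * P = K := by rw [hK, mul_assoc, h.idem]
  have h1 : P * X = 0 := by
    rw [hX, mul_add]
    simp only [← mul_assoc, h.mul_left, zero_mul, add_zero]
  have h2 : X * P = X := by
    nth_rw 1 [hX]
    rw [add_mul]
    simp only [mul_assoc, hKP, h.idem]
    simpa only [mul_assoc] using hX.symm
  refine ⟨X, h1, h2, ?_⟩
  have h3 : R * X - X * R
      = (R - algebraMap ℝ 𝔸 c) * X - X * (R - algebraMap ℝ 𝔸 c) := by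
    rw [sub_mul, mul_sub, Algebra.commutes c X]; abel
  have h4 : (R - algebraMap ℝ 𝔸 c) * X = X * (R - algebraMap ℝ 𝔸 c) + (1 - P) * C * P := by
    nth_rw 1 [hX]
    have hQ : (1 - P) * (1 - P) = 1 - P := by
      rw [mul_sub, mul_one, sub_mul, one_mul, h.idem, sub_self, sub_zero]
    have e1 : (R - algebraMap ℝ 𝔸 c) * (G * X * K) = X * (R - algebraMap ℝ 𝔸 c) := by
      rw [mul_assoc G, ← mul_assoc _ G, h.mul_inv, sub_mul, one_mul, ← mul_assoc P, h1, zero_mul,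
        sub_zero, hK, h.comm_sub, ← mul_assoc, h2]
    have e2 : (R - algebraMap ℝ 𝔸 c) * (G * ((1 - P) * C * P)) = (1 - P) * C * P := by
      rw [← mul_assoc, h.mul_inv, ← mul_assoc, ← mul_assoc, hQ]
    rw [mul_add, e1, e2]
  rw [h3, h4]; abel

end IsGapProjection

/-- The map `B ↦ [R, P B Q + Q B P] + P B P' + Q B Q'` with `Q = 1 - P`: for `P' = P` and `Q' = Q`
it is the commutator with `R` on off-diagonal elements, and the identity on diagonal ones. -/
noncomputable def sylvester (R P P' Q' : 𝔸) : 𝔸 →L[ℂ] 𝔸 :=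
  (ContinuousLinearMap.mul ℂ 𝔸 R - (ContinuousLinearMap.mul ℂ 𝔸).flip R) *
    (ContinuousLinearMap.mulLeftRight ℂ 𝔸 P (1 - P) +
      ContinuousLinearMap.mulLeftRight ℂ 𝔸 (1 - P) P) +
    ContinuousLinearMap.mulLeftRight ℂ 𝔸 P P' +
    ContinuousLinearMap.mulLeftRight ℂ 𝔸 (1 - P) Q'

theorem sylvester_apply (R P P' Q' B : 𝔸) :
    sylvester R P P' Q' B = R * (P * B * (1 - P) + (1 - P) * B * P)
      - (P * B * (1 - P) + (1 - P) * B * P) * R + P * B * P' + (1 - P) * B * Q' := rfl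

/-- For an off-diagonal right hand side, the equation of `sylvester` is the commutator equation
restricted to off-diagonal elements. -/
theorem sylvester_eq_iff {R P B C : 𝔸} (hP : P * P = P) (hc : R * P = P * R)
    (hC1 : P * C * P = 0) (hC2 : (1 - P) * C * (1 - P) = 0) :
    sylvester R P P (1 - P) B = C ↔
      (P * B * P = 0 ∧ (1 - P) * B * (1 - P) = 0) ∧ R * B - B * R = C := by
  have hc' : R * (1 - P) = (1 - P) * R := by rw [mul_sub, sub_mul, mul_one, one_mul, hc]
  have hQ : (1 - P) * (1 - P) = 1 - P := by
    rw [mul_sub, mul_one, sub_mul, one_mul, hP, sub_self, sub_zero]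
  constructor
  · intro h
    rw [sylvester_apply] at h
    set O := P * B * (1 - P) + (1 - P) * B * P with hO
    obtain ⟨hO1, hO2⟩ := off_mul_eq hP B O hO.symm
    have h1 : (1 - P) * P = 0 := by rw [sub_mul, one_mul, hP, sub_self]
    have h2 : P * (1 - P) = 0 := by rw [mul_sub, mul_one, hP, sub_self]
    have e1 : P * B * P = 0 := by
      have a1 : P * (R * O) * P = 0 := by
        rw [← mul_assoc, ← hc, mul_assoc R, mul_assoc R, hO1, mul_zero]
      have a2 : P * (O * R) * P = 0 := by
        rw [mul_assoc, mul_assoc O, hc, ← mul_assoc O, ← mul_assoc, ← mul_assoc, hO1, zero_mul]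
      have a3 : P * (P * B * P) * P = P * B * P := by
        simp only [mul_assoc, hP]
        simp only [← mul_assoc, hP]
      have a4 : P * ((1 - P) * B * (1 - P)) * P = 0 := by
        rw [mul_assoc, mul_assoc _ (1 - P) P, h1]; simp
      have : P * (R * O - O * R + P * B * P + (1 - P) * B * (1 - P)) * P = 0 := by
        rw [h, hC1]
      rw [mul_add, mul_add, mul_sub, add_mul, add_mul, sub_mul, a1, a2, a3, a4] at this
      simpa using this
    have e2 : (1 - P) * B * (1 - P) = 0 := by
      have a1 : (1 - P) * (R * O) * (1 - P) = 0 := by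
        rw [← mul_assoc, ← hc', mul_assoc R, mul_assoc R, hO2, mul_zero]
      have a2 : (1 - P) * (O * R) * (1 - P) = 0 := by
        rw [mul_assoc, mul_assoc O, hc', ← mul_assoc O, ← mul_assoc, ← mul_assoc, hO2, zero_mul]
      have a3 : (1 - P) * ((1 - P) * B * (1 - P)) * (1 - P) = (1 - P) * B * (1 - P) := by
        simp only [mul_assoc, hQ]
        simp only [← mul_assoc, hQ]
      have : (1 - P) * (R * O - O * R + P * B * P + (1 - P) * B * (1 - P)) * (1 - P) = 0 := by
        rw [h, hC2]
      rw [e1, add_zero, mul_add, mul_sub (1 - P) (R * O), add_mul, sub_mul _ _ (1 - P), a1, a2,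
        a3] at this
      simpa using this
    refine ⟨⟨e1, e2⟩, ?_⟩
    have hB := off_add_diag P B
    rw [e1, e2, add_zero, add_zero, ← hO] at hB
    rw [e1, e2, add_zero, add_zero, hB] at h
    exact h
  · rintro ⟨⟨e1, e2⟩, h⟩
    have hB := off_add_diag P B
    rw [e1, e2, add_zero, add_zero] at hB
    rw [sylvester_apply, hB, e1, e2, add_zero, add_zero, h]

/-- On each off-diagonal block, the commutator equation is solved by a Neumann series. -/
theorem IsGapProjection.isUnit_sylvester [CompleteSpace 𝔸] {R P G : 𝔸} {c r r' : ℝ}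
    (h : IsGapProjection R P G c r r') : IsUnit (sylvester R P P (1 - P)) := by
  rw [ContinuousLinearMap.isUnit_iff_bijective]
  have h1 : (1 - P) * P = 0 := by rw [sub_mul, one_mul, h.idem, sub_self]
  have h2 : P * (1 - P) = 0 := by rw [mul_sub, mul_one, h.idem, sub_self]
  have hQ : (1 - P) * (1 - P) = 1 - P := by
    rw [mul_sub, mul_one, sub_mul, one_mul, h.idem, sub_self, sub_zero]
  constructor
  · rw [injective_iff_map_eq_zero]
    intro B hB
    obtain ⟨⟨e1, e2⟩, e3⟩ := (sylvester_eq_iff h.idem h.comm (C := 0) (by simp) (by simp)).1 hB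
    have hc' : R * (1 - P) = (1 - P) * R := by rw [mul_sub, sub_mul, mul_one, one_mul, h.comm]
    have e4 : R * B = B * R := sub_eq_zero.1 e3
    have u1 : P * B * (1 - P) = 0 := by
      refine h.eq_zero_of_commute_upper ?_ ?_ ?_
      · rw [← mul_assoc, ← mul_assoc, h.idem]
      · rw [mul_assoc, h1, mul_zero]
      · rw [← mul_assoc, ← mul_assoc, h.comm, mul_assoc P R B, e4, mul_assoc _ (1 - P) R, ← hc']
        simp only [mul_assoc]
    have u2 : (1 - P) * B * P = 0 := by
      refine h.eq_zero_of_commute_lower ?_ ?_ ?_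
      · rw [← mul_assoc, ← mul_assoc, h2, zero_mul, zero_mul]
      · rw [mul_assoc, h.idem]
      · rw [← mul_assoc, ← mul_assoc, hc', mul_assoc (1 - P) R B, e4, mul_assoc _ P R, ← h.comm]
        simp only [mul_assoc]
    rw [← off_add_diag P B, e1, e2, u1, u2]
    simp
  · intro C
    -- `C` is split in two off-diagonal parts and a diagonal one, on which the map is the identity
    obtain ⟨X, hX1, hX2, hX3⟩ := h.exists_commutator_eq_upper C
    obtain ⟨Y, hY1, hY2, hY3⟩ := h.exists_commutator_eq_lower C
    refine ⟨X + Y + (P * C * P + (1 - P) * C * (1 - P)), ?_⟩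
    have eX : sylvester R P P (1 - P) X = P * C * (1 - P) := by
      rw [sylvester_apply, hX1, mul_assoc (1 - P) X P, hX2, mul_sub X, hX2, sub_mul 1 P X, hX1]
      simp [hX3]
    have eY : sylvester R P P (1 - P) Y = (1 - P) * C * P := by
      rw [sylvester_apply, hY1, mul_assoc (1 - P) Y P, hY2, sub_mul 1 P Y, hY1, zero_mul, zero_mul,
        one_mul, sub_zero, mul_sub, mul_one, hY2]
      simp [hY3]
    have eD : sylvester R P P (1 - P) (P * C * P + (1 - P) * C * (1 - P))
        = P * C * P + (1 - P) * C * (1 - P) := by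
      set Dg := P * C * P + (1 - P) * C * (1 - P) with hDg
      have d1 : P * Dg = P * C * P := by
        rw [hDg, mul_add, ← mul_assoc, ← mul_assoc, h.idem, ← mul_assoc, ← mul_assoc, h2]
        simp
      have d2 : (1 - P) * Dg = (1 - P) * C * (1 - P) := by
        rw [hDg, mul_add, ← mul_assoc, ← mul_assoc, h1, ← mul_assoc, ← mul_assoc, hQ]
        simp
      rw [sylvester_apply, d1, d2, mul_assoc _ P (1 - P), h2, mul_assoc _ (1 - P) P, h1,
        mul_assoc _ P P, h.idem, mul_assoc _ (1 - P) (1 - P), hQ]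
      simp [hDg]
    rw [map_add, map_add, eX, eY, eD, ← add_assoc]
    exact off_add_diag P C

end Sylvester

/-! ### Differentiability of gap projections -/

section Smoothness

variable {𝔸 : Type*} [NormedRing 𝔸] [NormedAlgebra ℂ 𝔸]

theorem sylvester_eq (R P P' Q' : 𝔸) : sylvester R P P' Q' =
    (ContinuousLinearMap.mul ℂ 𝔸 R - (ContinuousLinearMap.mul ℂ 𝔸).flip R) *
    (ContinuousLinearMap.mul ℂ 𝔸 P * (ContinuousLinearMap.mul ℂ 𝔸).flip (1 - P) +
      ContinuousLinearMap.mul ℂ 𝔸 (1 - P) * (ContinuousLinearMap.mul ℂ 𝔸).flip P) +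
    ContinuousLinearMap.mul ℂ 𝔸 P * (ContinuousLinearMap.mul ℂ 𝔸).flip P' +
    ContinuousLinearMap.mul ℂ 𝔸 (1 - P) * (ContinuousLinearMap.mul ℂ 𝔸).flip Q' := by
  ext B
  simp [sylvester_apply, mul_assoc]
  noncomm_ring

theorem continuous_sylvester : Continuous fun p : 𝔸 × 𝔸 × 𝔸 × 𝔸 =>
    sylvester p.1 p.2.1 p.2.2.1 p.2.2.2 := by
  simp only [sylvester_eq]
  fun_prop

theorem contDiffOn_sylvester {S : Set ℝ} {R P : ℝ → 𝔸} (hR : ContDiffOn ℝ 1 R S)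
    (hP : ContDiffOn ℝ 1 P S) :
    ContDiffOn ℝ 1 (fun s => sylvester (R s) (P s) (P s) (1 - P s)) S := by
  have hl : ∀ {f : ℝ → 𝔸}, ContDiffOn ℝ 1 f S →
      ContDiffOn ℝ 1 (fun s => ContinuousLinearMap.mul ℂ 𝔸 (f s)) S := fun hf =>
    ((ContinuousLinearMap.mul ℂ 𝔸).restrictScalars ℝ).contDiff.comp_contDiffOn hf
  have hr : ∀ {f : ℝ → 𝔸}, ContDiffOn ℝ 1 f S →
      ContDiffOn ℝ 1 (fun s => (ContinuousLinearMap.mul ℂ 𝔸).flip (f s)) S := fun hf =>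
    (((ContinuousLinearMap.mul ℂ 𝔸).flip).restrictScalars ℝ).contDiff.comp_contDiffOn hf
  have hQ : ContDiffOn ℝ 1 (fun s => 1 - P s) S := contDiffOn_const.sub hP
  simp only [sylvester_eq]
  exact ((((hl hR).sub (hr hR)).mul (((hl hP).mul (hr hQ)).add ((hl hQ).mul (hr hP)))).add
    ((hl hP).mul (hr hP))).add ((hl hQ).mul (hr hQ))

/-- The exact equation for a difference of projectors. The diagonal blocks of `P - P₀` are of second
order in it; writing them as products turns the equation into a linear one, whose operator depends
on `P - P₀` and tends to `sylvester R₀ P₀ P₀ (1 - P₀)` as `P → P₀`. -/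
theorem sylvester_sub_apply {R R₀ P P₀ : 𝔸} (hP : P * P = P) (hP₀ : P₀ * P₀ = P₀)
    (hc : R * P = P * R) (hc₀ : R₀ * P₀ = P₀ * R₀) :
    sylvester R₀ P₀ ((1 + (P - P₀)) * P₀) ((1 - (P - P₀)) * (1 - P₀)) (P - P₀)
      = P₀ * (P * (R - R₀) - (R - R₀) * P) * (1 - P₀)
        + (1 - P₀) * (P * (R - R₀) - (R - R₀) * P) * P₀ := by
  have h1 : (1 - P₀) * P₀ = 0 := by rw [sub_mul, one_mul, hP₀, sub_self]
  have h2 : P₀ * (1 - P₀) = 0 := by rw [mul_sub, mul_one, hP₀, sub_self]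
  have hc' : R₀ * (1 - P₀) = (1 - P₀) * R₀ := by rw [mul_sub, sub_mul, mul_one, one_mul, hc₀]
  have hsq : (P - P₀) * (P - P₀) = P + P₀ - P * P₀ - P₀ * P := by
    rw [mul_sub, sub_mul, sub_mul, hP, hP₀]; abel
  have e1 : P₀ * (P - P₀) * ((1 + (P - P₀)) * P₀) = 0 := by
    have : P₀ * (P - P₀) * ((1 + (P - P₀)) * P₀)
        = P₀ * (P - P₀) * P₀ + P₀ * ((P - P₀) * (P - P₀)) * P₀ := by noncomm_ring
    rw [this, hsq, ← add_mul, ← mul_add,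
      show P - P₀ + (P + P₀ - P * P₀ - P₀ * P) = P * (1 - P₀) + (1 - P₀) * P by noncomm_ring,
      mul_add, add_mul, mul_assoc P₀ _ P₀, mul_assoc P _ P₀, h1, ← mul_assoc P₀ (1 - P₀), h2]
    simp
  have e2 : (1 - P₀) * (P - P₀) * ((1 - (P - P₀)) * (1 - P₀)) = 0 := by
    have : (1 - P₀) * (P - P₀) * ((1 - (P - P₀)) * (1 - P₀))
        = (1 - P₀) * ((P - P₀) - (P - P₀) * (P - P₀)) * (1 - P₀) := by noncomm_ring
    rw [this, hsq,
      show P - P₀ - (P + P₀ - P * P₀ - P₀ * P) = -((1 - P) * P₀ + P₀ * (1 - P)) by noncomm_ring,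
      mul_neg, neg_mul, mul_add, add_mul, mul_assoc (1 - P₀) _ (1 - P₀), mul_assoc (1 - P) P₀, h2,
      ← mul_assoc (1 - P₀) P₀, h1]
    simp
  have e3 : P * (R - R₀) - (R - R₀) * P = R₀ * (P - P₀) - (P - P₀) * R₀ := by
    rw [mul_sub, sub_mul, hc, mul_sub, sub_mul, hc₀]; abel
  rw [sylvester_apply, e1, e2, add_zero, add_zero, e3]
  have a1 : R₀ * (P₀ * (P - P₀) * (1 - P₀)) = P₀ * (R₀ * (P - P₀)) * (1 - P₀) := by
    rw [← mul_assoc, ← mul_assoc, hc₀, mul_assoc P₀ R₀]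
  have a2 : R₀ * ((1 - P₀) * (P - P₀) * P₀) = (1 - P₀) * (R₀ * (P - P₀)) * P₀ := by
    rw [← mul_assoc, ← mul_assoc, hc', mul_assoc (1 - P₀) R₀]
  have a3 : P₀ * (P - P₀) * (1 - P₀) * R₀ = P₀ * ((P - P₀) * R₀) * (1 - P₀) := by
    rw [mul_assoc, ← hc']; simp only [mul_assoc]
  have a4 : (1 - P₀) * (P - P₀) * P₀ * R₀ = (1 - P₀) * ((P - P₀) * R₀) * P₀ := by
    rw [mul_assoc, ← hc₀]; simp only [mul_assoc]
  rw [mul_add, add_mul, a1, a2, a3, a4, mul_sub P₀, mul_sub (1 - P₀) (R₀ * _), sub_mul _ _ (1 - P₀),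
    sub_mul _ _ P₀]
  abel

variable [CompleteSpace 𝔸]

/-- A norm continuous family of projectors that commute with `R s` is differentiable if `R` is. -/
theorem hasDerivWithinAt_projection {S : Set ℝ} {R P : ℝ → 𝔸} {R' : 𝔸} {s₀ : ℝ} (hs₀ : s₀ ∈ S)
    (hR : HasDerivWithinAt R R' S s₀) (hP : ContinuousWithinAt P S s₀)
    (hPP : ∀ s ∈ S, P s * P s = P s) (hc : ∀ s ∈ S, R s * P s = P s * R s)
    (hu : IsUnit (sylvester (R s₀) (P s₀) (P s₀) (1 - P s₀))) :
    HasDerivWithinAt P (Ring.inverse (sylvester (R s₀) (P s₀) (P s₀) (1 - P s₀))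
      (P s₀ * R' - R' * P s₀)) S s₀ := by
  set P₀ := P s₀ with hP₀
  set R₀ := R s₀ with hR₀
  -- the difference `P s - P₀` solves a linear equation with operator `L s`, and right hand side of
  -- first order in `R s - R₀`
  let L : ℝ → 𝔸 →L[ℂ] 𝔸 := fun s =>
    sylvester R₀ P₀ ((1 + (P s - P₀)) * P₀) ((1 - (P s - P₀)) * (1 - P₀))
  have hL : Tendsto L (𝓝[S] s₀) (𝓝 (sylvester R₀ P₀ P₀ (1 - P₀))) := by
    have h1 : ContinuousWithinAt (fun s => (R₀, P₀, (1 + (P s - P₀)) * P₀,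
        (1 - (P s - P₀)) * (1 - P₀))) S s₀ := by
      have h2 : ContinuousWithinAt (fun s => P s - P₀) S s₀ := hP.sub continuousWithinAt_const
      exact continuousWithinAt_const.prodMk (continuousWithinAt_const.prodMk
        (((continuousWithinAt_const.add h2).mul continuousWithinAt_const).prodMk
          ((continuousWithinAt_const.sub h2).mul continuousWithinAt_const)))
    have h3 := (continuous_sylvester (𝔸 := 𝔸)).continuousAt.comp_continuousWithinAt h1
    have h4 : L s₀ = sylvester R₀ P₀ P₀ (1 - P₀) := by
      simp only [L, ← hP₀, sub_self, add_zero, sub_zero, one_mul]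
    rw [← h4]
    exact h3
  have hinv : Tendsto (fun s => Ring.inverse (L s)) (𝓝[S] s₀)
      (𝓝 (Ring.inverse (sylvester R₀ P₀ P₀ (1 - P₀)))) := by
    obtain ⟨u, hu'⟩ := hu
    rw [← hu'] at hL ⊢
    exact (NormedRing.inverse_continuousAt u).tendsto.comp hL
  have hunit : ∀ᶠ s in 𝓝[S] s₀, IsUnit (L s) := by
    obtain ⟨u, hu'⟩ := hu
    rw [← hu'] at hL
    exact hL.eventually (Units.isOpen.mem_nhds u.isUnit)
  rw [hasDerivWithinAt_iff_tendsto_slope] at hR ⊢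
  have hmono : 𝓝[S \ {s₀}] s₀ ≤ 𝓝[S] s₀ := nhdsWithin_mono _ Set.sdiff_subset
  let W : 𝔸 → 𝔸 → 𝔸 := fun X Y => P₀ * (X * Y - Y * X) * (1 - P₀) + (1 - P₀) * (X * Y - Y * X) * P₀
  have hW0 : W P₀ R' = P₀ * R' - R' * P₀ := by
    have hPP₀ : P₀ * P₀ = P₀ := hPP s₀ hs₀
    simp only [W, mul_sub, sub_mul, mul_one, one_mul, mul_assoc, hPP₀]
    simp only [← mul_assoc, hPP₀]
    abel
  have hWlim : Tendsto (fun s => W (P s) (slope R s₀ s)) (𝓝[S \ {s₀}] s₀) (𝓝 (W P₀ R')) := by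
    have h1 : Tendsto P (𝓝[S \ {s₀}] s₀) (𝓝 P₀) := hP.tendsto.mono_left hmono
    have h2 := (h1.mul hR).sub (hR.mul h1)
    exact (((h2.const_mul P₀).mul_const (1 - P₀)).add ((h2.const_mul (1 - P₀)).mul_const P₀))
  have hfin : Tendsto (fun s => Ring.inverse (L s) (W (P s) (slope R s₀ s))) (𝓝[S \ {s₀}] s₀)
      (𝓝 (Ring.inverse (sylvester R₀ P₀ P₀ (1 - P₀)) (W P₀ R'))) :=
    (isBoundedBilinearMap_apply (𝕜 := ℂ).continuous.tendsto _).comp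
      ((hinv.mono_left hmono).prodMk_nhds hWlim)
  rw [hW0] at hfin
  refine hfin.congr' ?_
  filter_upwards [hmono hunit, self_mem_nhdsWithin] with s hus hs
  have h1 : L s (P s - P₀) = W (P s) (R s - R₀) :=
    sylvester_sub_apply (hPP s hs.1) (hPP s₀ hs₀) (hc s hs.1) (hc s₀ hs₀)
  have h2 : L s (slope P s₀ s) = W (P s) (slope R s₀ s) := by
    rw [slope_def_module, slope_def_module, (L s).map_smul_of_tower, h1]
    simp only [W, mul_smul_comm, smul_mul_assoc, ← smul_sub, ← smul_add]
    rfl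
  rw [← h2]
  exact congrArg (fun B : 𝔸 →L[ℂ] 𝔸 => B (slope P s₀ s)) (Ring.inverse_mul_cancel _ hus)

theorem contDiffOn_inverse_sylvester_apply {S : Set ℝ} {R P C : ℝ → 𝔸} (hR : ContDiffOn ℝ 1 R S)
    (hP : ContDiffOn ℝ 1 P S) (hC : ContDiffOn ℝ 1 C S)
    (hu : ∀ s ∈ S, IsUnit (sylvester (R s) (P s) (P s) (1 - P s))) :
    ContDiffOn ℝ 1 (fun s => Ring.inverse (sylvester (R s) (P s) (P s) (1 - P s)) (C s)) S := by
  have h1 : ContDiffOn ℝ 1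
      (fun s => Ring.inverse (sylvester (R s) (P s) (P s) (1 - P s))) S := fun s hs => by
    obtain ⟨u, hu'⟩ := hu s hs
    have h2 := contDiffAt_ringInverse ℝ (n := 1) u
    rw [hu'] at h2
    exact h2.comp_contDiffWithinAt s (contDiffOn_sylvester hR hP s hs)
  have h3 : ContDiffOn ℝ 1 (fun s => (ContinuousLinearMap.restrictScalarsL ℂ 𝔸 𝔸 ℝ ℝ)
      (Ring.inverse (sylvester (R s) (P s) (P s) (1 - P s)))) S :=
    (ContinuousLinearMap.restrictScalarsL ℂ 𝔸 𝔸 ℝ ℝ).contDiff.comp_contDiffOn h1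
  exact h3.clm_apply hC

/-- The derivative of `P` is the off-diagonal solution of `[R, P'] = [P, R']`. -/
theorem contDiffOn_projection {S : Set ℝ} (hS : UniqueDiffOn ℝ S) {R P : ℝ → 𝔸}
    (hR : ContDiffOn ℝ 1 R S) (hP : ContinuousOn P S) (hPP : ∀ s ∈ S, P s * P s = P s)
    (hc : ∀ s ∈ S, R s * P s = P s * R s)
    (hu : ∀ s ∈ S, IsUnit (sylvester (R s) (P s) (P s) (1 - P s))) :
    ContDiffOn ℝ 1 P S ∧ ∀ s ∈ S, derivWithin P S s =
      Ring.inverse (sylvester (R s) (P s) (P s) (1 - P s))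
        (P s * derivWithin R S s - derivWithin R S s * P s) := by
  rw [contDiffOn_one_iff_derivWithin hS] at hR ⊢
  have hd := fun s (hs : s ∈ S) => hasDerivWithinAt_projection hs (hR.1 s hs).hasDerivWithinAt
    (hP s hs) hPP hc (hu s hs)
  have he := fun s (hs : s ∈ S) => (hd s hs).derivWithin (hS s hs)
  refine ⟨⟨fun s hs => (hd s hs).differentiableWithinAt, fun s hs => ?_⟩, he⟩
  refine ContinuousWithinAt.congr (f := fun s =>
    Ring.inverse (sylvester (R s) (P s) (P s) (1 - P s))
      (P s * derivWithin R S s - derivWithin R S s * P s)) ?_ he (he s hs)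
  have hRc := hR.1.continuousOn s hs
  have h1 : ContinuousWithinAt (fun s => sylvester (R s) (P s) (P s) (1 - P s)) S s :=
    (continuous_sylvester (𝔸 := 𝔸)).continuousAt.comp_continuousWithinAt
      (f := fun s => (R s, P s, P s, 1 - P s))
      (hRc.prodMk ((hP s hs).prodMk ((hP s hs).prodMk (continuousWithinAt_const.sub (hP s hs)))))
  have h2 : ContinuousWithinAt (fun s => Ring.inverse (sylvester (R s) (P s) (P s) (1 - P s)))
      S s := by
    obtain ⟨u, hu'⟩ := hu s hs
    have h3 := NormedRing.inverse_continuousAt u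
    rw [hu'] at h3
    exact h3.comp_continuousWithinAt
      (f := fun s => sylvester (R s) (P s) (P s) (1 - P s)) h1
  exact h2.clm_apply (((hP s hs).mul (hR.2 s hs)).sub ((hR.2 s hs).mul (hP s hs)))

end Smoothness

/-! ### Finite rank operators and strong differentiability -/

section FiniteRank

variable {E : Type*} [NormedAddCommGroup E] [InnerProductSpace ℂ E]

/-- The composition `K ↦ K * F` with a finite rank operator `F` only depends on finitely many values
of `K`; hence it turns strong convergence into norm convergence. -/
theorem exists_mul_eq_sum_of_finiteDimensional_range (F : E →L[ℂ] E)
    [FiniteDimensional ℂ (LinearMap.range (F : E →ₗ[ℂ] E))] :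
    ∃ (m : ℕ) (f : Fin m → StrongDual ℂ E) (e : Fin m → E), ∀ K : E →L[ℂ] E,
      K * F = ∑ j, ContinuousLinearMap.smulRightL ℂ E E (f j) (K (e j)) := by
  let V := LinearMap.range (F : E →ₗ[ℂ] E)
  let b := Module.finBasis ℂ V
  let F' : E →L[ℂ] V := F.codRestrict V (fun x => ⟨x, rfl⟩)
  refine ⟨Module.finrank ℂ V, fun j => (LinearMap.toContinuousLinearMap (b.coord j)).comp F',
    fun j => (b j : E), fun K => ?_⟩
  ext x
  have h1 : F x = ∑ j, b.coord j (F' x) • (b j : E) := by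
    have h2 := congrArg (Subtype.val) (b.sum_repr (F' x))
    rw [AddSubmonoidClass.coe_finsetSum] at h2
    exact h2.symm
  rw [mul_apply_eq_comp, h1, map_sum, sum_apply]
  refine Finset.sum_congr rfl fun j _ => ?_
  rw [map_smul]
  rfl

variable (F : E →L[ℂ] E) [FiniteDimensional ℂ (LinearMap.range (F : E →ₗ[ℂ] E))]

theorem tendsto_mul_of_finiteDimensional_range {ι : Type*} {l : Filter ι} {K : ι → E →L[ℂ] E}
    {K₀ : E →L[ℂ] E} (h : ∀ x, Tendsto (fun i => K i x) l (𝓝 (K₀ x))) :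
    Tendsto (fun i => K i * F) l (𝓝 (K₀ * F)) := by
  obtain ⟨m, f, e, hF⟩ := exists_mul_eq_sum_of_finiteDimensional_range F
  simp only [hF]
  exact tendsto_finsetSum _ fun j _ =>
    ((ContinuousLinearMap.smulRightL ℂ E E (f j)).continuous.tendsto _).comp (h (e j))

theorem hasDerivWithinAt_mul_of_finiteDimensional_range {K : ℝ → E →L[ℂ] E} {K' : E →L[ℂ] E}
    {S : Set ℝ} {s : ℝ} (h : ∀ x, HasDerivWithinAt (fun r => K r x) (K' x) S s) :
    HasDerivWithinAt (fun r => K r * F) (K' * F) S s := by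
  obtain ⟨m, f, e, hF⟩ := exists_mul_eq_sum_of_finiteDimensional_range F
  simp only [hF]
  exact HasDerivWithinAt.fun_sum fun j _ =>
    (((ContinuousLinearMap.smulRightL ℂ E E (f j)).restrictScalars ℝ).hasFDerivAt
      ).comp_hasDerivWithinAt s (h (e j))

end FiniteRank

section StrongToNorm

variable {E : Type*} [NormedAddCommGroup E] [InnerProductSpace ℂ E] {S : Set ℝ}

/-- A uniformly bounded strong derivative gives Lipschitz continuity in norm. -/
theorem norm_sub_le_of_strong_deriv (hS : Convex ℝ S) {K K' : ℝ → E →L[ℂ] E} {C : ℝ}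
    (h : ∀ s ∈ S, ∀ x, HasDerivWithinAt (fun r => K r x) (K' s x) S s)
    (hC : ∀ s ∈ S, ∀ x, ‖K' s x‖ ≤ C * ‖x‖) {s t : ℝ} (hs : s ∈ S) (ht : t ∈ S) :
    ‖K t - K s‖ ≤ |C| * |t - s| := by
  refine ContinuousLinearMap.opNorm_le_bound _ (by positivity) fun x => ?_
  have h1 := Convex.norm_image_sub_le_of_norm_hasDerivWithin_le (fun r hr => h r hr x)
    (fun r hr => (hC r hr x).trans (mul_le_mul_of_nonneg_right (le_abs_self C) (norm_nonneg x)))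
    hS hs ht
  rw [sub_apply]
  refine h1.trans (le_of_eq ?_)
  rw [Real.norm_eq_abs]
  ring

/-- A strongly differentiable family whose derivative is Lipschitz continuous in norm is
differentiable in norm. -/
theorem hasDerivWithinAt_of_strong_deriv (hS : Convex ℝ S) {K K' : ℝ → E →L[ℂ] E} {C : ℝ}
    (h : ∀ s ∈ S, ∀ x, HasDerivWithinAt (fun r => K r x) (K' s x) S s)
    (hC0 : 0 ≤ C) (hC : ∀ s ∈ S, ∀ t ∈ S, ‖K' t - K' s‖ ≤ C * |t - s|) {s : ℝ} (hs : s ∈ S) :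
    HasDerivWithinAt K (K' s) S s := by
  rw [hasDerivWithinAt_iff_isLittleO]
  have hb : (fun t => K t - K s - (t - s) • K' s) =O[𝓝[S] s] fun t => (t - s) ^ 2 := by
    refine Asymptotics.IsBigO.of_bound C ?_
    filter_upwards [self_mem_nhdsWithin] with t ht
    rw [Real.norm_eq_abs, abs_of_nonneg (sq_nonneg _)]
    refine ContinuousLinearMap.opNorm_le_bound _ (by positivity) fun x => ?_
    have hsub : Set.uIcc s t ⊆ S := by
      rw [← segment_eq_uIcc]
      exact hS.segment_subset hs ht
    have hd : ∀ r ∈ Set.uIcc s t, HasDerivWithinAt (fun r => K r x - r • K' s x)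
        (K' r x - K' s x) (Set.uIcc s t) r := fun r hr => by
      have h2 := ((hasDerivWithinAt_id r (Set.uIcc s t)).smul_const (K' s x))
      rw [one_smul] at h2
      exact ((h r (hsub hr) x).mono hsub).sub h2
    have hbd : ∀ r ∈ Set.uIcc s t, ‖K' r x - K' s x‖ ≤ C * |t - s| * ‖x‖ := fun r hr => by
      rw [← sub_apply]
      refine (ContinuousLinearMap.le_opNorm _ _).trans ?_
      gcongr
      refine (hC s hs r (hsub hr)).trans ?_
      exact mul_le_mul_of_nonneg_left (Set.abs_sub_left_of_mem_uIcc hr) hC0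
    have h3 := Convex.norm_image_sub_le_of_norm_hasDerivWithin_le hd hbd (convex_uIcc s t)
      Set.left_mem_uIcc Set.right_mem_uIcc
    have e : (K t - K s - (t - s) • K' s) x = K t x - t • K' s x - (K s x - s • K' s x) := by
      simp only [sub_apply, smul_apply]
      module
    rw [e]
    refine h3.trans (le_of_eq ?_)
    rw [Real.norm_eq_abs, ← sq_abs (t - s)]
    ring
  refine hb.trans_isLittleO ?_
  have h4 : (fun t : ℝ => t - s) =o[𝓝[S] s] fun _ => (1 : ℝ) := by
    rw [Asymptotics.isLittleO_one_iff]
    have : Continuous fun t : ℝ => t - s := by fun_prop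
    have h5 := (this.tendsto s).mono_left (nhdsWithin_le_nhds (s := S))
    simpa using h5
  simpa [sq] using h4.mul_isBigO (Asymptotics.isBigO_refl (fun t : ℝ => t - s) (𝓝[S] s))

/-- Product rule in norm for a family that is only strongly differentiable, times finite rank
operators. -/
theorem hasDerivWithinAt_strong_mul_finite_rank {K P : ℝ → E →L[ℂ] E} {K' P' : E →L[ℂ] E} {s : ℝ}
    [FiniteDimensional ℂ (LinearMap.range (P s : E →ₗ[ℂ] E))]
    (hK : ∀ x, HasDerivWithinAt (fun r => K r x) (K' x) S s) (hKc : ContinuousWithinAt K S s)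
    (hP : HasDerivWithinAt P P' S s) :
    HasDerivWithinAt (fun r => K r * P r) (K' * P s + K s * P') S s := by
  have h1 := hasDerivWithinAt_mul_of_finiteDimensional_range (P s) hK
  have h2 : HasDerivWithinAt (fun r => K r * (P r - P s)) (K s * P') S s := by
    rw [hasDerivWithinAt_iff_tendsto_slope] at hP ⊢
    have e : slope (fun r => K r * (P r - P s)) s = fun r => K r * slope P s r := by
      funext r
      simp [slope_def_module]
    rw [e]
    exact (hKc.tendsto.mono_left (nhdsWithin_mono _ Set.sdiff_subset)).mul hP
  refine (h1.add h2).congr_of_eventuallyEq (Eventually.of_forall fun r => ?_) ?_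
  · simp [mul_sub]
  · simp

theorem continuousWithinAt_strong_mul_finite_rank {K P : ℝ → E →L[ℂ] E} {s C : ℝ}
    [FiniteDimensional ℂ (LinearMap.range (P s : E →ₗ[ℂ] E))]
    (hK : ∀ x, ContinuousWithinAt (fun r => K r x) S s) (hKC : ∀ r ∈ S, ‖K r‖ ≤ C)
    (hP : ContinuousWithinAt P S s) : ContinuousWithinAt (fun r => K r * P r) S s := by
  have h1 := tendsto_mul_of_finiteDimensional_range (P s) (l := 𝓝[S] s) (K := K) (K₀ := K s) hK
  have h2 : Tendsto (fun r => K r * (P r - P s)) (𝓝[S] s) (𝓝 0) := by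
    have h3 := (tendsto_iff_norm_sub_tendsto_zero.1 hP).const_mul C
    rw [mul_zero] at h3
    refine squeeze_zero_norm' ?_ h3
    filter_upwards [self_mem_nhdsWithin] with r hr
    refine (norm_mul_le _ _).trans ?_
    gcongr
    exact hKC r hr
  have h4 := h1.add h2
  rw [add_zero] at h4
  refine h4.congr fun r => ?_
  rw [mul_sub]; abel

end StrongToNorm

namespace InvertibleFamily

variable {E : Type*} [NormedAddCommGroup E] [InnerProductSpace ℂ E]
  {D : Submodule ℂ E} {S : Set ℝ} {β : ℝ} {A : ℝ → D →ₗ[ℂ] E} {A' : ℝ → D → E}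
  {R : ℝ → E →L[ℂ] E}

/-- The operators `B t = C t (A t)⁻¹`, for a family `C t` that is bounded relative to `A t`. -/
structure IsRelative (h : InvertibleFamily S β A A' R) (C : ℝ → D →ₗ[ℂ] E) (γ : ℝ)
    (B : ℝ → E →L[ℂ] E) : Prop where
  apply_eq : ∀ t (ht : t ∈ S) x, B t x = C t ⟨R t x, h.mem t ht x⟩
  norm_le : ∀ t ∈ S, ∀ x, ‖B t x‖ ≤ γ * ‖x‖

theorem exists_isRelative (h : InvertibleFamily S β A A' R) {C : ℝ → D →ₗ[ℂ] E} {γ : ℝ}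
    (hC : ∀ t ∈ S, ∀ φ : D, ‖C t φ‖ ≤ γ * ‖A t φ‖) : ∃ B, h.IsRelative C γ B := by
  have hex : ∀ t, ∃ B : E →L[ℂ] E, ∀ ht : t ∈ S, ∀ x, B x = C t ⟨R t x, h.mem t ht x⟩ := by
    intro t
    by_cases ht : t ∈ S
    · refine ⟨LinearMap.mkContinuous
        (C t ∘ₗ (LinearMap.codRestrict D (R t : E →ₗ[ℂ] E) (h.mem t ht))) γ (fun x => ?_),
        fun _ x => rfl⟩
      have := hC t ht ⟨R t x, h.mem t ht x⟩
      rwa [h.right t ht] at this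
    · exact ⟨0, fun h => absurd h ht⟩
  choose B hB using hex
  refine ⟨B, ⟨hB, fun t ht x => ?_⟩⟩
  have := hC t ht ⟨R t x, h.mem t ht x⟩
  rwa [h.right t ht, ← hB t ht] at this

namespace IsRelative

variable {h : InvertibleFamily S β A A' R} {C C' : ℝ → D →ₗ[ℂ] E} {γ γ' : ℝ}
  {B B' : ℝ → E →L[ℂ] E}

theorem apply_eq_sub (hB : h.IsRelative C γ B) {t r : ℝ} (ht : t ∈ S) (hr : r ∈ S) (x : E) :
    B r x = C r ⟨R t x, h.mem t ht x⟩
      - B r (A r ⟨R t x, h.mem t ht x⟩ - A t ⟨R t x, h.mem t ht x⟩) := by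
  rw [hB.apply_eq r hr, hB.apply_eq r hr, ← map_sub]
  congr 1
  refine Subtype.ext ?_
  have := h.resolvent_sub ht hr x
  rw [sub_eq_iff_eq_add] at this
  change R r x = R t x - R r _
  rw [this]; abel

theorem continuousWithinAt (hB : h.IsRelative C γ B) {t : ℝ} (ht : t ∈ S)
    (hC : ∀ φ : D, ContinuousWithinAt (fun r => C r φ) S t) (x : E) :
    ContinuousWithinAt (fun r => B r x) S t := by
  set ρ : D := ⟨R t x, h.mem t ht x⟩ with hρ
  have h1 : Tendsto (fun r => B r (A r ρ - A t ρ)) (𝓝[S] t) (𝓝 0) := by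
    have h2 := (tendsto_iff_norm_sub_tendsto_zero.1
      (h.deriv t ht ρ).continuousWithinAt.tendsto).const_mul γ
    rw [mul_zero] at h2
    refine squeeze_zero_norm' ?_ h2
    filter_upwards [self_mem_nhdsWithin] with r hr using hB.norm_le r hr _
  have h3 := (hC ρ).tendsto.sub h1
  rw [sub_zero, ← hB.apply_eq t ht] at h3
  refine h3.congr' ?_
  filter_upwards [self_mem_nhdsWithin] with r hr using (hB.apply_eq_sub ht hr x).symm

theorem hasDerivWithinAt (hB : h.IsRelative C γ B) (hB' : h.IsRelative C' γ' B') {t : ℝ}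
    (ht : t ∈ S) (hC : ∀ φ : D, HasDerivWithinAt (fun r => C r φ) (C' t φ) S t) (x : E) :
    HasDerivWithinAt (fun r => B r x) (B' t x - B t (A' t ⟨R t x, h.mem t ht x⟩)) S t := by
  have h1 := hasDerivWithinAt_clm_apply_sub hB.norm_le
    (hB.continuousWithinAt ht (fun φ => (hC φ).continuousWithinAt) _)
    (h.deriv t ht ⟨R t x, h.mem t ht x⟩)
  have h2 := (hC ⟨R t x, h.mem t ht x⟩).sub h1
  rw [← hB'.apply_eq t ht] at h2
  exact h2.congr_of_mem (fun r hr => hB.apply_eq_sub ht hr x) ht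

/-- If `A t φ` is twice strongly continuously differentiable, with relatively bounded derivatives,
then the inverses `R t` are differentiable in norm, with a derivative that is itself strongly
continuously differentiable. -/
theorem exists_second_deriv (hS : Convex ℝ S) (hB : h.IsRelative C γ B)
    (hB' : h.IsRelative C' γ' B') (hCA : ∀ t ∈ S, ∀ φ, C t φ = A' t φ)
    (hC : ∀ t ∈ S, ∀ φ : D, HasDerivWithinAt (fun r => C r φ) (C' t φ) S t)
    (hC' : ∀ t ∈ S, ∀ φ : D, ContinuousWithinAt (fun r => C' r φ) S t) :
    ∃ (R' R'' : ℝ → E →L[ℂ] E) (K : ℝ), (∀ t ∈ S, HasDerivWithinAt R (R' t) S t) ∧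
      ContinuousOn R' S ∧ (∀ t ∈ S, ∀ x, HasDerivWithinAt (fun r => R' r x) (R'' t x) S t) ∧
      (∀ t ∈ S, ∀ x, ContinuousWithinAt (fun r => R'' r x) S t) ∧ ∀ t ∈ S, ‖R'' t‖ ≤ K := by
  have hR1 : ∀ r ∈ S, ∀ x, ‖R r x‖ ≤ 1 * ‖x‖ := fun r hr x => by simpa using h.norm_le r hr x
  have hcomp : ∀ {F G : ℝ → E →L[ℂ] E} {c : ℝ}, (∀ r ∈ S, ∀ x, ‖F r x‖ ≤ c * ‖x‖) →
      (∀ t ∈ S, ∀ x, ContinuousWithinAt (fun r => F r x) S t) →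
      (∀ t ∈ S, ∀ x, ContinuousWithinAt (fun r => G r x) S t) →
      ∀ t ∈ S, ∀ x, ContinuousWithinAt (fun r => F r (G r x)) S t :=
    fun hb hF hG t ht x => tendsto_clm_apply_of_norm_le
      (by filter_upwards [self_mem_nhdsWithin] with r hr z using hb r hr z) (hF t ht _) (hG t ht x)
  have hBc : ∀ t ∈ S, ∀ x, ContinuousWithinAt (fun r => B r x) S t := fun t ht x =>
    hB.continuousWithinAt ht (fun φ => (hC t ht φ).continuousWithinAt) x
  have hB'c : ∀ t ∈ S, ∀ x, ContinuousWithinAt (fun r => B' r x) S t := fun t ht x =>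
    hB'.continuousWithinAt ht (hC' t ht) x
  have hRc : ∀ t ∈ S, ∀ x, ContinuousWithinAt (fun r => R r x) S t := fun t ht x =>
    h.continuousWithinAt_inv ht x
  let R' : ℝ → E →L[ℂ] E := fun t => -(R t * B t)
  let R'' : ℝ → E →L[ℂ] E := fun t => (2 : ℂ) • (R t * (B t * B t)) - R t * B' t
  have hd1 : ∀ t ∈ S, ∀ x, HasDerivWithinAt (fun r => R r x) (R' t x) S t := fun t ht x => by
    have := h.hasDerivWithinAt_inv ht x
    rw [← hCA t ht, ← hB.apply_eq t ht] at this
    exact this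
  have hd2 : ∀ t ∈ S, ∀ x, HasDerivWithinAt (fun r => R' r x) (R'' t x) S t := fun t ht x => by
    have h1 := hB.hasDerivWithinAt hB' ht (hC t ht) x
    rw [← hCA t ht, ← hB.apply_eq t ht] at h1
    have h2 := (hasDerivWithinAt_strong_clm_apply hR1 (hRc t ht _) (hd1 t ht (B t x)) h1).neg
    refine h2.congr_deriv ?_
    simp only [R', R'', sub_apply, neg_apply, smul_apply, mul_apply_eq_comp, map_sub]
    module
  have hbound : ∀ t ∈ S, ∀ x, ‖R'' t x‖ ≤ (2 * (γ * γ) + γ') * ‖x‖ := fun t ht x => by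
    simp only [R'', sub_apply, smul_apply, mul_apply_eq_comp]
    have b1 : ‖R t (B t (B t x))‖ ≤ γ * γ * ‖x‖ := by
      by_cases hγ : 0 ≤ γ
      · calc ‖R t (B t (B t x))‖ ≤ ‖B t (B t x)‖ := h.norm_le t ht _
          _ ≤ γ * ‖B t x‖ := hB.norm_le t ht _
          _ ≤ γ * (γ * ‖x‖) := by gcongr; exact hB.norm_le t ht _
          _ = γ * γ * ‖x‖ := by ring
      · have h0 : B t x = 0 := by
          have h1 := hB.norm_le t ht x
          have h2 := norm_nonneg (B t x)
          have h3 := norm_nonneg x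
          exact norm_le_zero_iff.1 (h1.trans (mul_nonpos_of_nonpos_of_nonneg (by linarith) h3))
        rw [h0, map_zero, map_zero, norm_zero]
        exact mul_nonneg (mul_self_nonneg γ) (norm_nonneg x)
    have b2 : ‖R t (B' t x)‖ ≤ γ' * ‖x‖ := (h.norm_le t ht _).trans (hB'.norm_le t ht x)
    refine (norm_sub_le _ _).trans ?_
    rw [norm_smul, Complex.norm_two]
    linarith
  have hlip : ∀ s ∈ S, ∀ t ∈ S, ‖R' t - R' s‖ ≤ |2 * (γ * γ) + γ'| * |t - s| :=
    fun s hs t ht => norm_sub_le_of_strong_deriv hS hd2 hbound hs ht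
  refine ⟨R', R'', |2 * (γ * γ) + γ'|, fun t ht =>
    hasDerivWithinAt_of_strong_deriv hS hd1 (abs_nonneg _) hlip ht, ?_, hd2, fun t ht x => ?_,
    fun t ht => ContinuousLinearMap.opNorm_le_bound _ (abs_nonneg _) fun x =>
      (hbound t ht x).trans (mul_le_mul_of_nonneg_right (le_abs_self _) (norm_nonneg x))⟩
  · refine LipschitzOnWith.continuousOn (K := Real.toNNReal |2 * (γ * γ) + γ'|)
      (LipschitzOnWith.of_dist_le_mul fun t ht s hs => ?_)
    rw [dist_eq_norm, Real.dist_eq, Real.coe_toNNReal _ (abs_nonneg _)]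
    exact hlip s hs t ht
  · have c1 := hcomp (G := fun r => B r * B r) hR1 hRc
      (fun t ht x => hcomp hB.norm_le hBc hBc t ht x) t ht x
    have c2 := hcomp hR1 hRc hB'c t ht x
    exact (c1.const_smul (2 : ℂ)).sub c2

end IsRelative

end InvertibleFamily

/-! ### Spectral projectors in terms of the bounded inverse -/

section Spectrum

variable {E : Type*} [NormedAddCommGroup E] [InnerProductSpace ℂ E]

/-- Spectral mapping for the inverse. -/
theorem inv_mem_opSpectrum {T : E →ₗ.[ℂ] E} {R : E →L[ℂ] E} (hR : IsBoundedInverse T R) {μ : ℝ}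
    (hμ : μ ∈ spectrum ℝ R) (h0 : μ ≠ 0) : ((μ⁻¹ : ℝ) : ℂ) ∈ opSpectrum T := by
  rintro ⟨Q, hQ⟩
  apply spectrum.mem_iff.1 hμ
  have h0' : (μ : ℂ) ≠ 0 := by exact_mod_cast h0
  have hz : ((μ⁻¹ : ℝ) : ℂ) * (μ : ℂ) = 1 := by
    rw [Complex.ofReal_inv]; exact inv_mul_cancel₀ h0'
  set z : ℂ := ((μ⁻¹ : ℝ) : ℂ) with hzdef
  have happ : ∀ x, (algebraMap ℝ (E →L[ℂ] E) μ - R) x = (μ : ℂ) • x - R x := fun x => by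
    simp [Algebra.algebraMap_eq_smul_one]
  have h1 : ∀ x, R (z • Q x - x) = Q x := fun x => by
    obtain ⟨hm, he⟩ := hQ.1 x
    have he' : z • Q x - T ⟨Q x, hm⟩ = x := he
    have h2 := hR.2 ⟨Q x, hm⟩
    have h3 := congrArg (fun w => z • Q x - w) he'
    simp only [sub_sub_cancel] at h3
    rw [← h3]
    exact h2
  have h2 : ∀ x, Q ((μ : ℂ) • x - R x) = -((μ : ℂ) • R x) := fun x => by
    obtain ⟨hm, he⟩ := hR.1 x
    have h3 := hQ.2 ⟨R x, hm⟩
    have h4 : shift z T ⟨R x, hm⟩ = z • R x - x := by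
      change z • R x - T ⟨R x, hm⟩ = _
      rw [he]
    rw [h4] at h3
    have h5 : (μ : ℂ) • x - R x = -((μ : ℂ) • (z • R x - x)) := by
      rw [smul_sub, smul_smul, mul_comm, hz, one_smul]; abel
    rw [h5, map_neg, map_smul, h3]
  -- `(μ - R)⁻¹ = z - z² (z - T)⁻¹` with `z = 1 / μ`
  let W : E →L[ℂ] E := -(z • (z • Q - 1))
  have hW : ∀ x, W x = -(z • (z • Q x - x)) := fun x => rfl
  refine isUnit_iff_exists.2 ⟨W, ?_, ?_⟩
  · ext x
    rw [mul_apply_eq_comp, happ, hW, smul_neg, smul_smul, mul_comm, hz, one_smul, map_neg, map_smul,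
      h1]
    simp
  · ext x
    rw [mul_apply_eq_comp, happ, hW, h2, smul_neg, smul_smul, hz, one_smul]
    rw [show -R x - ((μ : ℂ) • x - R x) = -((μ : ℂ) • x) by abel, smul_neg, neg_neg, smul_smul, hz]
    simp

theorem exists_pos_le_of_gap_pos {T : E →ₗ.[ℂ] E} {I : Set ℝ} (h : 0 < gap T I) :
    ∃ d : ℝ, 0 < d ∧ ∀ x ∈ I, ∀ y : ℝ, (y : ℂ) ∈ opSpectrum T → y ∉ I → d ≤ |x - y| := by
  have htop : gap T I ≠ ⊤ := ((min_le_left _ _).trans_lt ENNReal.one_lt_top).ne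
  refine ⟨(gap T I).toReal, ENNReal.toReal_pos h.ne' htop, fun x hx y hy hyI => ?_⟩
  have hmem : (y : ℂ) ∈ opSpectrum T \ (opSpectrum T ∩ (fun y : ℝ => (y : ℂ)) '' I) := by
    refine ⟨hy, fun hy' => ?_⟩
    obtain ⟨w, hw, hwe⟩ := hy'.2
    rw [Complex.ofReal_inj] at hwe
    exact hyI (hwe ▸ hw)
  have h1 : gap T I ≤ edist (x : ℂ) (y : ℂ) :=
    (min_le_right _ _).trans ((iInf₂_le x hx).trans (Metric.infEDist_le_edist_of_mem hmem))
  have h2 := ENNReal.toReal_mono (edist_ne_top _ _) h1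
  rw [edist_dist, ENNReal.toReal_ofReal dist_nonneg, dist_eq_norm, ← Complex.ofReal_sub,
    Complex.norm_real, Real.norm_eq_abs] at h2
  exact h2

variable [CompleteSpace E]

/-- A function `f` that is `1` on the part of the spectrum in the ball of radius `r` around `c` and
`0` on the rest, at distance at least `r' > r` from `c`, defines a gap projection. -/
theorem isGapProjection_cfc {R : E →L[ℂ] E} (hR : IsSelfAdjoint R) {f : ℝ → ℝ} {c r r' : ℝ}
    (hr : 0 ≤ r) (hrr : r < r') (hf : ∀ μ ∈ spectrum ℝ R,
      (f μ = 1 ∧ |μ - c| ≤ r) ∨ (f μ = 0 ∧ r' ≤ |μ - c|)) :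
    IsSelfAdjoint (cfc f R) ∧ ∃ G, IsGapProjection R (cfc f R) G c r r' := by
  have hr' : 0 < r' := hr.trans_lt hrr
  -- continuous functions that agree with `f` and with the reduced inverse on the spectrum
  let g : ℝ → ℝ := fun μ => max 0 (min 1 ((r' - |μ - c|) / (r' - r)))
  let k : ℝ → ℝ := fun μ => (1 - g μ) * ((μ - c) / max ((μ - c) ^ 2) (r' ^ 2))
  have hgc : Continuous g := by fun_prop
  have hkc : Continuous k := by
    refine (continuous_const.sub hgc).mul (Continuous.div (by fun_prop) (by fun_prop) fun μ => ?_)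
    exact (lt_max_of_lt_right (by positivity)).ne'
  have hg1 : ∀ μ, |μ - c| ≤ r → g μ = 1 := fun μ hμ => by
    have : 1 ≤ (r' - |μ - c|) / (r' - r) := by rw [le_div_iff₀ (by linarith)]; linarith
    simp only [g, min_eq_left this]
    norm_num
  have hg0 : ∀ μ, r' ≤ |μ - c| → g μ = 0 := fun μ hμ => by
    have h1 : (r' - |μ - c|) / (r' - r) ≤ 0 :=
      div_nonpos_of_nonpos_of_nonneg (by linarith) (by linarith)
    simp only [g]
    rw [max_eq_left]
    exact (min_le_right _ _).trans h1
  have hfg : (spectrum ℝ R).EqOn f g := fun μ hμ => by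
    rcases hf μ hμ with ⟨h1, h2⟩ | ⟨h1, h2⟩
    · rw [h1, hg1 μ h2]
    · rw [h1, hg0 μ h2]
  have hcfc : cfc f R = cfc g R := cfc_congr hfg
  rw [hcfc]
  have hgcases : ∀ μ ∈ spectrum ℝ R,
      (g μ = 1 ∧ |μ - c| ≤ r) ∨ (g μ = 0 ∧ r' ≤ |μ - c|) := fun μ hμ => by
    rcases hf μ hμ with ⟨-, h2⟩ | ⟨-, h2⟩
    · exact Or.inl ⟨hg1 μ h2, h2⟩
    · exact Or.inr ⟨hg0 μ h2, h2⟩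
  have hsub : R - algebraMap ℝ (E →L[ℂ] E) c = cfc (fun μ => μ - c) R := by
    rw [cfc_sub (fun μ => μ) (fun _ => c) R (by fun_prop) (by fun_prop), cfc_id' ℝ R,
      cfc_const c R]
  have hone : 1 - cfc g R = cfc (fun μ => 1 - g μ) R := by
    rw [cfc_sub (fun _ => 1) g R (by fun_prop) hgc.continuousOn, cfc_const_one ℝ R]
  have hkval : ∀ μ ∈ spectrum ℝ R, (μ - c) * k μ = 1 - g μ ∧ k μ * g μ = 0 ∧ |k μ| ≤ r'⁻¹ := by
    intro μ hμ
    rcases hgcases μ hμ with ⟨h1, h2⟩ | ⟨h1, h2⟩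
    · simp only [k, h1, sub_self, zero_mul, mul_zero, abs_zero]
      exact ⟨trivial, trivial, by positivity⟩
    · have hne : μ - c ≠ 0 := fun h0 => by
        rw [h0, abs_zero] at h2; linarith
      have hsq : r' ^ 2 ≤ (μ - c) ^ 2 := by
        rw [← sq_abs (μ - c)]; gcongr
      have hk : k μ = (μ - c)⁻¹ := by
        simp only [k, h1, sub_zero, one_mul, max_eq_left hsq]
        rw [sq, div_mul_cancel_left₀ hne]
      rw [hk, h1]
      refine ⟨by rw [mul_inv_cancel₀ hne, sub_zero], mul_zero _, ?_⟩
      rw [abs_inv]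
      exact inv_anti₀ hr' h2
  refine ⟨cfc_predicate g R, cfc k R, ?_, ?_, ?_, ?_, ?_, ?_, ?_, ?_, hrr⟩
  · rw [← cfc_mul g g R hgc.continuousOn hgc.continuousOn]
    refine cfc_congr fun μ hμ => ?_
    rcases hgcases μ hμ with ⟨h1, -⟩ | ⟨h1, -⟩ <;> simp [h1]
  · have h := (cfc_commute_cfc (fun μ => μ) g R).eq
    rwa [cfc_id' ℝ R] at h
  · rw [← cfc_mul k g R hkc.continuousOn hgc.continuousOn, ← cfc_zero ℝ R]
    exact cfc_congr fun μ hμ => (hkval μ hμ).2.1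
  · rw [← cfc_mul g k R hgc.continuousOn hkc.continuousOn, ← cfc_zero ℝ R]
    exact cfc_congr fun μ hμ => (mul_comm _ _).trans (hkval μ hμ).2.1
  · rw [hsub, hone, ← cfc_mul k (fun μ => μ - c) R hkc.continuousOn (by fun_prop)]
    exact cfc_congr fun μ hμ => (mul_comm _ _).trans (hkval μ hμ).1
  · rw [hsub, hone, ← cfc_mul (fun μ => μ - c) k R (by fun_prop) hkc.continuousOn]
    exact cfc_congr fun μ hμ => (hkval μ hμ).1
  · rw [hsub, ← cfc_mul (fun μ => μ - c) g R (by fun_prop) hgc.continuousOn]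
    refine norm_cfc_le hr fun μ hμ => ?_
    rcases hgcases μ hμ with ⟨h1, h2⟩ | ⟨h1, -⟩
    · simpa [h1] using h2
    · simpa [h1] using hr
  · exact norm_cfc_le (by positivity) fun μ hμ => (hkval μ hμ).2.2

theorem spectrum_subset_Icc {R : E →L[ℂ] E} (hR : R.IsPositive) (hn : ∀ x, ‖R x‖ ≤ ‖x‖) :
    spectrum ℝ R ⊆ Set.Icc 0 1 := fun μ hμ => by
  have h0 := spectrum_nonneg_of_nonneg ((ContinuousLinearMap.nonneg_iff_isPositive R).2 hR) hμ
  refine ⟨h0, ?_⟩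
  have hn' : ‖R‖ ≤ 1 := R.opNorm_le_bound zero_le_one fun x => by simpa using hn x
  have : Nontrivial E := by
    by_contra hE
    rw [not_nontrivial_iff_subsingleton] at hE
    have : Subsingleton (E →L[ℂ] E) := ⟨fun x y => by ext z; exact Subsingleton.elim _ _⟩
    simp [spectrum.of_subsingleton] at hμ
  have h1 := spectrum.norm_le_norm_of_mem hμ
  rw [Real.norm_eq_abs, abs_of_nonneg h0] at h1
  exact h1.trans hn'

/-- The part of the spectrum of `T⁻¹` that corresponds to the part of the spectrum of `T` in an
isolated interval `[a, b]` is itself in an isolated interval. -/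
theorem spectralProjector_isGapProjection {T : E →ₗ.[ℂ] E} {R : E →L[ℂ] E}
    (hTR : IsBoundedInverse T R) (hR : R.IsPositive) (hn : ∀ x, ‖R x‖ ≤ ‖x‖) {a b : ℝ} (hab : a ≤ b)
    (hb : 1 ≤ b) (hgap : 0 < gap T (Set.Icc a b)) :
    IsSelfAdjoint (spectralProjector T (Set.Icc a b)) ∧ ∃ G r',
      IsGapProjection R (spectralProjector T (Set.Icc a b)) G (((max a 1)⁻¹ + b⁻¹) / 2)
        (((max a 1)⁻¹ - b⁻¹) / 2) r' := by
  obtain ⟨d, hd, hdist⟩ := exists_pos_le_of_gap_pos hgap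
  set m := max a 1 with hm
  have hm1 : 1 ≤ m := le_max_right _ _
  have hmb : m ≤ b := max_le hab hb
  have hb0 : 0 < b := by linarith
  have hinv : b⁻¹ ≤ m⁻¹ := inv_anti₀ (by linarith) hmb
  -- the two bounds stem from spectrum above `b`, or at infinity, and below `a`; as the spectrum of
  -- `T` lies in `[1, ∞)`, the interval may be replaced by `[max a 1, b]`
  set δ := min (b⁻¹ - (b + d)⁻¹) (d / b ^ 2) with hδ
  have hδ0 : 0 < δ := lt_min (sub_pos.2 (inv_strictAnti₀ hb0 (by linarith))) (by positivity)
  unfold spectralProjector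
  rw [boundedInverse_eq hTR]
  have key := isGapProjection_cfc hR.isSelfAdjoint
    (f := fun μ : ℝ => if μ ≠ 0 ∧ μ⁻¹ ∈ Set.Icc a b then (1 : ℝ) else 0)
    (c := (m⁻¹ + b⁻¹) / 2) (r := (m⁻¹ - b⁻¹) / 2) (r' := (m⁻¹ - b⁻¹) / 2 + δ)
    (by linarith) (by linarith) (fun μ hμ => ?_)
  · obtain ⟨hsa, G, hG⟩ := key
    refine ⟨?_, G, (m⁻¹ - b⁻¹) / 2 + δ, ?_⟩
    · convert hsa
    · convert hG
  · have hμI := spectrum_subset_Icc hR hn hμ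
    by_cases hI : μ ≠ 0 ∧ μ⁻¹ ∈ Set.Icc a b
    · left
      rw [if_pos hI]
      have hμ0 : 0 < μ := lt_of_le_of_ne hμI.1 (Ne.symm hI.1)
      have h1 : b⁻¹ ≤ μ := inv_le_of_inv_le₀ hμ0 hI.2.2
      have h2 : μ ≤ m⁻¹ := by
        rw [le_inv_comm₀ hμ0 (by linarith)]
        exact max_le hI.2.1 ((one_le_inv₀ hμ0).2 hμI.2)
      refine ⟨rfl, abs_le.2 ⟨by linarith, by linarith⟩⟩
    · right
      rw [if_neg hI]
      refine ⟨rfl, ?_⟩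
      rcases hμI.1.eq_or_lt with h0 | h0
      · rw [← h0]
        have h1 : δ ≤ b⁻¹ := (min_le_left _ _).trans
          (sub_le_self _ (inv_nonneg.2 (by linarith)))
        rw [le_abs]
        right; linarith
      · have hnI : μ⁻¹ ∉ Set.Icc a b := fun h => hI ⟨h0.ne', h⟩
        have hsp := inv_mem_opSpectrum hTR hμ h0.ne'
        have hda := hdist a ⟨le_rfl, hab⟩ _ hsp hnI
        have hdb := hdist b ⟨hab, le_rfl⟩ _ hsp hnI
        have hge : 1 ≤ μ⁻¹ := (one_le_inv₀ h0).2 hμI.2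
        rw [Set.mem_Icc, not_and_or, not_le, not_le] at hnI
        rw [le_abs]
        rcases hnI with hlt | hlt
        · left
          rw [abs_of_pos (by linarith)] at hda
          have ham : m = a := max_eq_left (by linarith)
          have ha0 : 0 < a := by linarith
          have h1 : d / b ^ 2 ≤ μ - a⁻¹ := by
            have e : μ - a⁻¹ = (a - μ⁻¹) / (a * μ⁻¹) := by field_simp
            rw [e]
            refine div_le_div₀ (by linarith) hda (by positivity) ?_
            rw [sq]
            have : μ⁻¹ ≤ b := by linarith
            gcongr
          have h2 : δ ≤ d / b ^ 2 := min_le_right _ _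
          rw [ham]
          linarith
        · right
          rw [abs_sub_comm, abs_of_pos (by linarith)] at hdb
          have h1 : μ ≤ (b + d)⁻¹ := by
            rw [le_inv_comm₀ h0 (by linarith)]; linarith
          have h2 : δ ≤ b⁻¹ - (b + d)⁻¹ := min_le_left _ _
          linarith

/-- The spectrum of `T` lies in `[1, ∞)`. -/
theorem spectralProjector_eq_zero {T : E →ₗ.[ℂ] E} {R : E →L[ℂ] E}
    (hTR : IsBoundedInverse T R) (hR : R.IsPositive) (hn : ∀ x, ‖R x‖ ≤ ‖x‖) {a b : ℝ}
    (hb : b < 1) : spectralProjector T (Set.Icc a b) = 0 := by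
  unfold spectralProjector
  rw [boundedInverse_eq hTR, ← cfc_zero ℝ R]
  refine cfc_congr fun μ hμ => ?_
  have hμI := spectrum_subset_Icc hR hn hμ
  refine if_neg fun h => ?_
  have h0 : 0 < μ := lt_of_le_of_ne hμI.1 (Ne.symm h.1)
  have h1 := (one_le_inv₀ h0).2 hμI.2
  linarith [h.2.2]

end Spectrum

section Projections

variable {E : Type*} [NormedAddCommGroup E] [InnerProductSpace ℂ E]

/-- For projections of equal finite rank, smallness of `(1 - P₀) P` implies that of `P - P₀`. -/
theorem norm_projection_sub_le [CompleteSpace E] {P P₀ : E →L[ℂ] E} (hP : P * P = P)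
    (hP₀ : P₀ * P₀ = P₀) (hsa : IsSelfAdjoint P) (hsa₀ : IsSelfAdjoint P₀)
    [FiniteDimensional ℂ (LinearMap.range (P : E →ₗ[ℂ] E))]
    [FiniteDimensional ℂ (LinearMap.range (P₀ : E →ₗ[ℂ] E))]
    (hrank : Module.finrank ℂ (LinearMap.range (P : E →ₗ[ℂ] E))
      = Module.finrank ℂ (LinearMap.range (P₀ : E →ₗ[ℂ] E))) {η : ℝ} (hη : η ≤ 1 / 2)
    (h : ‖(1 - P₀) * P‖ ≤ η) : ‖P - P₀‖ ≤ 3 * η := by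
  have hPx : ∀ x, P (P x) = P x := fun x => congrArg (fun B : E →L[ℂ] E => B x) hP
  have hP₀x : ∀ x, P₀ (P₀ x) = P₀ x := fun x => congrArg (fun B : E →L[ℂ] E => B x) hP₀
  have hη0 : 0 ≤ η := (norm_nonneg _).trans h
  have hy : ∀ y, P y = y → ‖y - P₀ y‖ ≤ η * ‖y‖ := fun y hy => by
    have e : ((1 - P₀) * P) y = y - P₀ y := by
      rw [mul_apply_eq_comp, hy]; rfl
    rw [← e]
    exact ((1 - P₀) * P).le_of_opNorm_le h y
  have hlow : ∀ y, P y = y → ‖y‖ ≤ 2 * ‖P₀ y‖ := fun y hy' => by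
    have h1 := hy y hy'
    have h2 := norm_sub_norm_le y (P₀ y)
    have h3 := norm_nonneg y
    nlinarith
  -- `P₀` is injective from `range P` to `range P₀`, hence surjective, by equality of the dimensions
  let g : LinearMap.range (P : E →ₗ[ℂ] E) →ₗ[ℂ] LinearMap.range (P₀ : E →ₗ[ℂ] E) :=
    (P₀ : E →ₗ[ℂ] E).rangeRestrict ∘ₗ (LinearMap.range (P : E →ₗ[ℂ] E)).subtype
  have hgP : ∀ y : LinearMap.range (P : E →ₗ[ℂ] E), P (y : E) = y := by
    rintro ⟨_, w, rfl⟩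
    exact hPx w
  have hginj : Function.Injective g := by
    rw [injective_iff_map_eq_zero]
    intro y hy0
    have h1 : P₀ (y : E) = 0 := congrArg Subtype.val hy0
    have h2 := hlow y (hgP y)
    rw [h1, norm_zero, mul_zero] at h2
    exact Subtype.ext (norm_le_zero_iff.1 h2)
  have hgsurj : Function.Surjective g :=
    (LinearMap.injective_iff_surjective_of_finrank_eq_finrank hrank).1 hginj
  have h2 : ‖(1 - P) * P₀‖ ≤ 2 * η := by
    refine ContinuousLinearMap.opNorm_le_bound _ (by positivity) fun x => ?_
    obtain ⟨y, hyx⟩ := hgsurj ⟨P₀ x, x, rfl⟩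
    have hyx' : P₀ (y : E) = P₀ x := congrArg Subtype.val hyx
    have hyP := hgP y
    have e : ((1 - P) * P₀) x = (P (y - P₀ (y : E)) - (y - P₀ (y : E))) := by
      rw [mul_apply_eq_comp, ← hyx', map_sub, hyP]
      change P₀ (y : E) - P (P₀ (y : E)) = _
      abel
    have hQ : ∀ w : E, ‖P w - w‖ ≤ ‖w‖ := fun w => by
      have horth : ⟪P w, w - P w⟫_ℂ = 0 := by
        have h3 : ⟪P w, w - P w⟫_ℂ = ⟪w, P (w - P w)⟫_ℂ := hsa.isSymmetric w (w - P w)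
        rw [h3, map_sub, hPx, sub_self, inner_zero_right]
      have h4 := norm_add_sq_eq_norm_sq_add_norm_sq_of_inner_eq_zero (P w) (w - P w) horth
      rw [add_sub_cancel] at h4
      rw [norm_sub_rev]
      nlinarith [norm_nonneg w, norm_nonneg (w - P w), norm_nonneg (P w)]
    have hP₀n : ‖P₀ x‖ ≤ ‖x‖ := by
      have horth : ⟪P₀ x, x - P₀ x⟫_ℂ = 0 := by
        have h3 : ⟪P₀ x, x - P₀ x⟫_ℂ = ⟪x, P₀ (x - P₀ x)⟫_ℂ := hsa₀.isSymmetric x (x - P₀ x)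
        rw [h3, map_sub, hP₀x, sub_self, inner_zero_right]
      have h4 := norm_add_sq_eq_norm_sq_add_norm_sq_of_inner_eq_zero (P₀ x) (x - P₀ x) horth
      rw [add_sub_cancel] at h4
      nlinarith [norm_nonneg x, norm_nonneg (x - P₀ x), norm_nonneg (P₀ x)]
    rw [e]
    calc ‖P (y - P₀ (y : E)) - (y - P₀ (y : E))‖ ≤ ‖(y : E) - P₀ y‖ := hQ _
      _ ≤ η * ‖(y : E)‖ := hy y hyP
      _ ≤ η * (2 * ‖P₀ (y : E)‖) := by gcongr; exact hlow y hyP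
      _ ≤ η * (2 * ‖x‖) := by rw [hyx']; gcongr
      _ = 2 * η * ‖x‖ := by ring
  have e : P - P₀ = (1 - P₀) * P - star ((1 - P) * P₀) := by
    rw [star_mul, star_sub, star_one, hsa.star_eq, hsa₀.star_eq]
    noncomm_ring
  rw [e]
  refine (norm_sub_le _ _).trans ?_
  rw [norm_star]
  linarith

/-- Davis-Kahan type estimate: if `R` is close to `R₀`, and `R` restricted to the range of `P` has its
spectrum away from the part of the spectrum of `R₀` that belongs to `1 - P₀`, then `(1 - P₀) P` is
small. -/
theorem norm_one_sub_mul_le {𝔸 : Type*} [NormedRing 𝔸] [NormedAlgebra ℂ 𝔸]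
    {R R₀ P P₀ G₀ : 𝔸} {c₀ r₀ r₀' ρ : ℝ}
    (h₀ : IsGapProjection R₀ P₀ G₀ c₀ r₀ r₀') (hP : P * P = P) (hc : R * P = P * R)
    (hρ : ‖(R - algebraMap ℝ 𝔸 c₀) * P‖ ≤ ρ) (hlt : ρ < r₀') :
    ‖(1 - P₀) * P‖ ≤ ‖R₀ - R‖ * ‖P‖ * ‖1 - P₀‖ / (r₀' - ρ) := by
  have hr' : 0 < r₀' := h₀.nonneg.trans_lt h₀.lt
  set Y := (1 - P₀) * P with hY
  have hYP : Y * P = Y := by rw [hY, mul_assoc, hP]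
  have hPP₀ : P₀ * (1 - P₀) = 0 := by rw [mul_sub, mul_one, h₀.idem, sub_self]
  have hQY : (1 - P₀) * Y = Y := by
    rw [hY, ← mul_assoc, mul_sub (1 - P₀), mul_one, sub_mul 1 P₀ P₀, one_mul, h₀.idem, sub_self,
      sub_zero]
  have hcomm : (R - algebraMap ℝ 𝔸 c₀) * P = P * (R - algebraMap ℝ 𝔸 c₀) := by
    rw [sub_mul, mul_sub, hc, Algebra.commutes]
  have hcomm₀ : (R₀ - algebraMap ℝ 𝔸 c₀) * (1 - P₀) = (1 - P₀) * (R₀ - algebraMap ℝ 𝔸 c₀) := by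
    rw [mul_sub, sub_mul 1, mul_one, one_mul, h₀.comm_sub]
  have e1 : (R₀ - algebraMap ℝ 𝔸 c₀) * Y
      = Y * ((R - algebraMap ℝ 𝔸 c₀) * P) + (1 - P₀) * ((R₀ - R) * P) := by
    have : (R₀ - R) * P = (R₀ - algebraMap ℝ 𝔸 c₀) * P - (R - algebraMap ℝ 𝔸 c₀) * P := by
      rw [← sub_mul]; congr 1; abel
    rw [this, hY, ← mul_assoc, hcomm₀, mul_sub (1 - P₀) (_ * P), hcomm, mul_assoc (1 - P₀) P,
      ← mul_assoc P P, hP, mul_assoc]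
    abel
  have e2 : Y = G₀ * (Y * ((R - algebraMap ℝ 𝔸 c₀) * P) + (1 - P₀) * ((R₀ - R) * P)) := by
    rw [← e1, ← mul_assoc, h₀.inv_mul, hQY]
  have h1 : ‖Y‖ ≤ r₀'⁻¹ * (‖Y‖ * ρ + ‖R₀ - R‖ * ‖P‖ * ‖1 - P₀‖) := by
    nth_rw 1 [e2]
    refine (norm_mul_le _ _).trans ?_
    refine mul_le_mul h₀.norm_inv_le ?_ (norm_nonneg _) (inv_nonneg.2 hr'.le)
    refine (norm_add_le _ _).trans (add_le_add ?_ ?_)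
    · refine (norm_mul_le _ _).trans ?_
      gcongr
    · refine (norm_mul_le _ _).trans ?_
      rw [mul_comm]
      gcongr
      exact norm_mul_le _ _
  rw [inv_mul_eq_div, le_div_iff₀ hr'] at h1
  rw [le_div_iff₀ (by linarith)]
  linarith

end Projections

/-! ### Regularity of projectors and the partial inverse of the Liouvillian -/

section Corrector

variable {E : Type*} [NormedAddCommGroup E] [InnerProductSpace ℂ E]

/-- The derivative of a projector is off-diagonal. -/
theorem derivWithin_projection_eq {S : Set ℝ} {P : ℝ → E →L[ℂ] E} {P' : E →L[ℂ] E} {s : ℝ}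
    (hs : s ∈ S) (hS : UniqueDiffWithinAt ℝ S s) (hP : HasDerivWithinAt P P' S s)
    (hPP : ∀ r ∈ S, P r * P r = P r) : P' = P' * P s + P s * P' := by
  have h1 : HasDerivWithinAt P (P' * P s + P s * P') S s :=
    (hP.mul hP).congr_of_mem (fun r hr => (hPP r hr).symm) hs
  exact hS.eq_deriv _ hP h1

theorem isOffDiagonal_of_eq {P B : E →L[ℂ] E} (hP : P * P = P) (hB : B = B * P + P * B) :
    IsOffDiagonal P B := by
  have h1 : P * B * P = 0 := by
    have h2 : P * B * P = P * B * P + P * B * P := by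
      nth_rw 1 [hB]
      rw [mul_add, add_mul, mul_assoc P (B * P) P, mul_assoc B P P, hP, ← mul_assoc P P B, hP,
        ← mul_assoc]
    exact left_eq_add.1 h2
  refine ⟨h1, ?_⟩
  have : (1 - P) * B * (1 - P) = B - (B * P + P * B) + P * B * P := by noncomm_ring
  rw [this, h1, ← hB]; simp

theorem IsOffDiagonal.eq_add {P B : E →L[ℂ] E} (h : IsOffDiagonal P B) : B = B * P + P * B := by
  have : (1 - P) * B * (1 - P) = B - (B * P + P * B) + P * B * P := by noncomm_ring
  rw [h.1, h.2, add_zero] at this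
  exact (sub_eq_zero.1 this.symm)

theorem IsOffDiagonal.offDiagonalPart_eq {P B : E →L[ℂ] E} (h : IsOffDiagonal P B) : offDiagonalPart P B = B := by
  have := off_add_diag P B
  rwa [h.1, h.2, add_zero, add_zero] at this

/-- In terms of the bounded inverse `R` of `T`, the equation `[T, B] = C` is `[R, B] = -R C R`. -/
theorem isLiouvillian_iff {T : E →ₗ.[ℂ] E} {R B C : E →L[ℂ] E} (hR : IsBoundedInverse T R) :
    IsLiouvillian T B C ↔ R * B - B * R = -(R * C * R) := by
  constructor
  · intro h
    ext x
    obtain ⟨hx, hTx⟩ := hR.1 x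
    obtain ⟨hB, hBx⟩ := h ⟨R x, hx⟩
    have h1 := congrArg R hBx
    rw [map_sub, hR.2, hTx] at h1
    simp only [sub_apply, neg_apply, mul_apply_eq_comp]
    rw [← h1]
    simp
  · intro h φ
    have h1 := congrArg (fun F : E →L[ℂ] E => F (T φ)) h
    simp only [sub_apply, neg_apply, mul_apply_eq_comp, hR.2] at h1
    have h2 : B φ = R (B (T φ) + C φ) := by
      rw [map_add]
      rw [sub_eq_iff_eq_add] at h1
      rw [h1]; abel
    obtain ⟨hm, he⟩ := hR.1 (B (T φ) + C φ)
    refine ⟨h2 ▸ hm, ?_⟩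
    have h3 : T ⟨B φ, h2 ▸ hm⟩ = T ⟨R (B (T φ) + C φ), hm⟩ := by
      congr 1
      exact Subtype.ext h2
    rw [h3, he]
    abel

variable [CompleteSpace E]

theorem norm_le_one_of_isSelfAdjoint {P : E →L[ℂ] E} (hP : P * P = P) (hsa : IsSelfAdjoint P) :
    ‖P‖ ≤ 1 :=
  IsStarProjection.norm_le P ⟨hP, hsa⟩

/-- The spectral projectors of a norm continuous family, for parts of the spectrum that are enclosed
by continuous discs, are norm continuous if their rank is constant. -/
theorem continuousOn_of_isGapProjection {S : Set ℝ} {R P : ℝ → E →L[ℂ] E} {c r : ℝ → ℝ} {N : ℕ}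
    (hR : ContinuousOn R S) (hc : ContinuousOn c S) (hr : ContinuousOn r S)
    (h : ∀ s ∈ S, ∃ G r', IsGapProjection (R s) (P s) G (c s) (r s) r')
    (hsa : ∀ s ∈ S, IsSelfAdjoint (P s)) (hN : 1 ≤ N)
    (hrank : ∀ s ∈ S, Module.finrank ℂ (LinearMap.range (P s : E →ₗ[ℂ] E)) = N) :
    ContinuousOn P S := by
  intro s₀ hs₀
  obtain ⟨G₀, r₀', h₀⟩ := h s₀ hs₀
  have hfin : ∀ s ∈ S, FiniteDimensional ℂ (LinearMap.range (P s : E →ₗ[ℂ] E)) := fun s hs =>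
    Module.finite_of_finrank_pos (by rw [hrank s hs]; exact hN)
  have hone : ‖1 - P s₀‖ ≤ 1 := norm_le_one_of_isSelfAdjoint
    (by rw [mul_sub, mul_one, sub_mul, one_mul, h₀.idem, sub_self, sub_zero])
    ((IsSelfAdjoint.one _).sub (hsa s₀ hs₀))
  -- a radius strictly between the two parts of the spectrum of `R s₀`
  set ρ := (r s₀ + r₀') / 2 with hρ
  have hlt := h₀.lt
  have hρr : ρ < r₀' := by rw [hρ]; linarith
  have h1 : ∀ᶠ s in 𝓝[S] s₀, r s + |c s - c s₀| < ρ := by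
    have h2 : ContinuousWithinAt (fun s => r s + |c s - c s₀|) S s₀ :=
      (hr s₀ hs₀).add ((hc s₀ hs₀).sub continuousWithinAt_const).abs
    refine h2.eventually (gt_mem_nhds ?_)
    simp only [sub_self, abs_zero, hρ]
    linarith
  have hlim : Tendsto (fun s => ‖R s₀ - R s‖ / (r₀' - ρ)) (𝓝[S] s₀) (𝓝 0) := by
    have h2 : ContinuousWithinAt (fun s => ‖R s₀ - R s‖ / (r₀' - ρ)) S s₀ :=
      (continuousWithinAt_const.sub (hR s₀ hs₀)).norm.div_const _
    have h3 := h2.tendsto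
    rwa [sub_self, norm_zero, zero_div] at h3
  have h3 : ∀ᶠ s in 𝓝[S] s₀, ‖R s₀ - R s‖ / (r₀' - ρ) ≤ 1 / 2 :=
    hlim.eventually (ge_mem_nhds (by norm_num))
  refine tendsto_iff_norm_sub_tendsto_zero.2 ?_
  have hlim3 := hlim.const_mul 3
  rw [mul_zero] at hlim3
  refine squeeze_zero' (Eventually.of_forall fun s => norm_nonneg _) ?_ hlim3
  filter_upwards [h1, h3, self_mem_nhdsWithin] with s hs1 hs3 hs
  obtain ⟨G, r', hg⟩ := h s hs
  have := hfin s hs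
  have := hfin s₀ hs₀
  have hPn := norm_le_one_of_isSelfAdjoint hg.idem (hsa s hs)
  refine norm_projection_sub_le hg.idem h₀.idem (hsa s hs) (hsa s₀ hs₀)
    ((hrank s hs).trans (hrank s₀ hs₀).symm) hs3 ?_
  have hb : ‖(R s - algebraMap ℝ (E →L[ℂ] E) (c s₀)) * P s‖ ≤ ρ := by
    have e : (R s - algebraMap ℝ (E →L[ℂ] E) (c s₀)) * P s
        = (R s - algebraMap ℝ (E →L[ℂ] E) (c s)) * P s + (c s - c s₀) • P s := by
      rw [Algebra.algebraMap_eq_smul_one, Algebra.algebraMap_eq_smul_one, sub_mul, sub_mul,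
        smul_mul_assoc, smul_mul_assoc, one_mul, sub_smul]
      abel
    rw [e]
    refine (norm_add_le _ _).trans (le_trans (add_le_add hg.norm_le ?_) hs1.le)
    rw [norm_smul, Real.norm_eq_abs]
    exact mul_le_of_le_one_right (abs_nonneg _) hPn
  refine (norm_one_sub_mul_le h₀ hg.idem hg.comm hb hρr).trans ?_
  have hpos : 0 < r₀' - ρ := by linarith
  gcongr
  calc ‖R s₀ - R s‖ * ‖P s‖ * ‖1 - P s₀‖ ≤ ‖R s₀ - R s‖ * 1 * 1 := by gcongr
    _ = ‖R s₀ - R s‖ := by ring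

/-- The partial inverse of the Liouvillian, as an inverse in the Banach algebra of bounded
operators. -/
theorem liouvillianInv_eq {T : E →ₗ.[ℂ] E} {R P G : E →L[ℂ] E} {c r r' : ℝ}
    (hR : IsBoundedInverse T R) (hP : IsGapProjection R P G c r r') (A : E →L[ℂ] E) :
    liouvillianInv T P A
        = Ring.inverse (sylvester R P P (1 - P)) (-(R * offDiagonalPart P A * R)) ∧
      IsOffDiagonal P (liouvillianInv T P A) ∧
      IsLiouvillian T (liouvillianInv T P A) (offDiagonalPart P A) := by
  obtain ⟨c1, c2⟩ := off_mul_eq hP.idem A (offDiagonalPart P A) rfl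
  have hc' : R * (1 - P) = (1 - P) * R := by rw [mul_sub, sub_mul, mul_one, one_mul, hP.comm]
  have hsw : ∀ {Q C : E →L[ℂ] E}, R * Q = Q * R → Q * C * Q = 0 → Q * -(R * C * R) * Q = 0 := by
    intro Q C hQ hC
    have : Q * -(R * C * R) * Q = -(Q * R * C * (R * Q)) := by noncomm_ring
    rw [this, ← hQ, hQ, show Q * R * C * (Q * R) = Q * R * C * Q * R by noncomm_ring, ← hQ,
      show R * Q * C * Q * R = R * (Q * C * Q) * R by noncomm_ring, hC]
    simp
  have hu := hP.isUnit_sylvester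
  have key : ∀ B, (IsOffDiagonal P B ∧ IsLiouvillian T B (offDiagonalPart P A)) ↔
      B = Ring.inverse (sylvester R P P (1 - P)) (-(R * offDiagonalPart P A * R)) := fun B => by
    rw [isLiouvillian_iff hR]
    have h1 := sylvester_eq_iff (B := B) hP.idem hP.comm (hsw hP.comm c1) (hsw hc' c2)
    refine Iff.trans h1.symm ⟨fun h => ?_, fun h => ?_⟩
    · rw [← h]
      exact (congrArg (fun F : (E →L[ℂ] E) →L[ℂ] (E →L[ℂ] E) => F B)
        (Ring.inverse_mul_cancel _ hu)).symm
    · rw [h]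
      exact congrArg (fun F : (E →L[ℂ] E) →L[ℂ] (E →L[ℂ] E) =>
        F (-(R * offDiagonalPart P A * R))) (Ring.mul_inverse_cancel _ hu)
  have hex : ∃ B, IsOffDiagonal P B ∧ IsLiouvillian T B (offDiagonalPart P A) :=
    ⟨_, (key _).2 rfl⟩
  have hdef : liouvillianInv T P A = hex.choose := dif_pos hex
  rw [hdef]
  exact ⟨(key _).1 hex.choose_spec, hex.choose_spec⟩

/-- If the resolvent `R` has a strongly continuously differentiable derivative, then its finite rank
spectral projectors are of class `C²` in norm: `[P, R']` only involves `R' P` and its adjoint. -/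
theorem contDiffOn_derivWithin_projection {S : Set ℝ} (hS : UniqueDiffOn ℝ S)
    {R R' R'' P : ℝ → E →L[ℂ] E} {K : ℝ} (hR : ∀ s ∈ S, HasDerivWithinAt R (R' s) S s)
    (hRc : ContinuousOn R' S)
    (hR2 : ∀ s ∈ S, ∀ x, HasDerivWithinAt (fun r => R' r x) (R'' s x) S s)
    (hR2c : ∀ s ∈ S, ∀ x, ContinuousWithinAt (fun r => R'' r x) S s)
    (hK : ∀ s ∈ S, ‖R'' s‖ ≤ K) (hRsa : ∀ s ∈ S, IsSelfAdjoint (R s))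
    (hP : ContinuousOn P S) (hPP : ∀ s ∈ S, P s * P s = P s)
    (hPsa : ∀ s ∈ S, IsSelfAdjoint (P s)) (hc : ∀ s ∈ S, R s * P s = P s * R s)
    (hu : ∀ s ∈ S, IsUnit (sylvester (R s) (P s) (P s) (1 - P s)))
    (hfin : ∀ s ∈ S, FiniteDimensional ℂ (LinearMap.range (P s : E →ₗ[ℂ] E))) :
    ContDiffOn ℝ 1 R S ∧ ContDiffOn ℝ 1 P S ∧ ContDiffOn ℝ 1 (derivWithin P S) S := by
  have hRd : ∀ s ∈ S, derivWithin R S s = R' s := fun s hs => (hR s hs).derivWithin (hS s hs)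
  have hR1 : ContDiffOn ℝ 1 R S := (contDiffOn_one_iff_derivWithin hS).2
    ⟨fun s hs => (hR s hs).differentiableWithinAt, hRc.congr hRd⟩
  obtain ⟨hP1, hP'⟩ := contDiffOn_projection hS hR1 hP hPP hc hu
  refine ⟨hR1, hP1, ?_⟩
  have hP1' := (contDiffOn_one_iff_derivWithin hS).1 hP1
  have hR'sa : ∀ s ∈ S, star (R' s) = R' s := fun s hs => by
    have h1 : HasDerivWithinAt R (star (R' s)) S s :=
      (hR s hs).star.congr_of_mem (fun r hr => (hRsa r hr).symm) hs
    exact (hS s hs).eq_deriv _ h1 (hR s hs)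
  have hW : ContDiffOn ℝ 1 (fun s => R' s * P s) S := by
    have hd : ∀ s ∈ S, HasDerivWithinAt (fun s => R' s * P s)
        (R'' s * P s + R' s * derivWithin P S s) S s := fun s hs => by
      have := hfin s hs
      exact hasDerivWithinAt_strong_mul_finite_rank (hR2 s hs) (hRc s hs)
        (hP1'.1 s hs).hasDerivWithinAt
    refine (contDiffOn_one_iff_derivWithin hS).2
      ⟨fun s hs => (hd s hs).differentiableWithinAt, ?_⟩
    refine ContinuousOn.congr (f := fun s => R'' s * P s + R' s * derivWithin P S s) ?_
      fun s hs => (hd s hs).derivWithin (hS s hs)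
    refine ContinuousOn.add (fun s hs => ?_) (hRc.mul hP1'.2)
    have := hfin s hs
    exact continuousWithinAt_strong_mul_finite_rank (hR2c s hs) hK (hP s hs)
  have hC : ContDiffOn ℝ 1 (fun s => star (R' s * P s) - R' s * P s) S :=
    ((starL' ℝ : (E →L[ℂ] E) ≃L[ℝ] (E →L[ℂ] E)).contDiff.comp_contDiffOn hW).sub hW
  refine (contDiffOn_inverse_sylvester_apply hR1 hP1 hC hu).congr fun s hs => ?_
  rw [hP' s hs, hRd s hs, star_mul, hR'sa s hs, (hPsa s hs).star_eq]

end Corrector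

/-! ### Spectral projectors of the Hamiltonians -/

section FiniteRankAlgebra

variable {E : Type*} [NormedAddCommGroup E] [InnerProductSpace ℂ E]

theorem finiteDimensional_range_mul_left (A B : E →L[ℂ] E)
    (h : FiniteDimensional ℂ (LinearMap.range (B : E →ₗ[ℂ] E))) :
    FiniteDimensional ℂ (LinearMap.range ((A * B : E →L[ℂ] E) : E →ₗ[ℂ] E)) := by
  have e : LinearMap.range ((A * B : E →L[ℂ] E) : E →ₗ[ℂ] E)
      = (LinearMap.range (B : E →ₗ[ℂ] E)).map (A : E →ₗ[ℂ] E) :=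
    LinearMap.range_comp (B : E →ₗ[ℂ] E) (A : E →ₗ[ℂ] E)
  rw [e]
  infer_instance

theorem finiteDimensional_range_mul_right (A B : E →L[ℂ] E)
    (h : FiniteDimensional ℂ (LinearMap.range (A : E →ₗ[ℂ] E))) :
    FiniteDimensional ℂ (LinearMap.range ((A * B : E →L[ℂ] E) : E →ₗ[ℂ] E)) :=
  Submodule.finiteDimensional_of_le
    (LinearMap.range_comp_le_range (B : E →ₗ[ℂ] E) (A : E →ₗ[ℂ] E))

theorem finiteDimensional_range_add (A B : E →L[ℂ] E)
    (hA : FiniteDimensional ℂ (LinearMap.range (A : E →ₗ[ℂ] E)))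
    (hB : FiniteDimensional ℂ (LinearMap.range (B : E →ₗ[ℂ] E))) :
    FiniteDimensional ℂ (LinearMap.range ((A + B : E →L[ℂ] E) : E →ₗ[ℂ] E)) :=
  Submodule.finiteDimensional_of_le
    (LinearMap.range_add_le (A : E →ₗ[ℂ] E) (B : E →ₗ[ℂ] E))

/-- The derivative of a family that is off-diagonal with respect to finite rank projectors has
finite rank. -/
theorem finiteDimensional_range_deriv {S : Set ℝ} {P X : ℝ → E →L[ℂ] E} {P' X' : E →L[ℂ] E}
    {s : ℝ} (hs : s ∈ S) (hS : UniqueDiffWithinAt ℝ S s) (hP : HasDerivWithinAt P P' S s)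
    (hX : HasDerivWithinAt X X' S s) (hPP : ∀ r ∈ S, P r * P r = P r)
    (hXP : ∀ r ∈ S, IsOffDiagonal (P r) (X r))
    (hfin : FiniteDimensional ℂ (LinearMap.range (P s : E →ₗ[ℂ] E))) :
    FiniteDimensional ℂ (LinearMap.range (X' : E →ₗ[ℂ] E)) := by
  have h1 : HasDerivWithinAt X ((X' * P s + X s * P') + (P' * X s + P s * X')) S s :=
    ((hX.mul hP).add (hP.mul hX)).congr_of_mem (fun r hr => (hXP r hr).eq_add) hs
  have hP' : FiniteDimensional ℂ (LinearMap.range (P' : E →ₗ[ℂ] E)) := by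
    rw [derivWithin_projection_eq hs hS hP hPP]
    exact finiteDimensional_range_add _ _ (finiteDimensional_range_mul_left _ _ hfin)
      (finiteDimensional_range_mul_right _ _ hfin)
  rw [hS.eq_deriv _ hX h1]
  exact finiteDimensional_range_add _ _
    (finiteDimensional_range_add _ _ (finiteDimensional_range_mul_left _ _ hfin)
      (finiteDimensional_range_mul_left _ _ hP'))
    (finiteDimensional_range_add _ _ (finiteDimensional_range_mul_right _ _ hP')
      (finiteDimensional_range_mul_right _ _ hfin))

variable [CompleteSpace E]

theorem finiteDimensional_range_star (A : E →L[ℂ] E)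
    (h : FiniteDimensional ℂ (LinearMap.range (A : E →ₗ[ℂ] E))) :
    FiniteDimensional ℂ (LinearMap.range ((star A : E →L[ℂ] E) : E →ₗ[ℂ] E)) := by
  set V := LinearMap.range (A : E →ₗ[ℂ] E)
  refine Submodule.finiteDimensional_of_le (S₂ := V.map ((star A : E →L[ℂ] E) : E →ₗ[ℂ] E)) ?_
  rintro _ ⟨x, rfl⟩
  refine ⟨V.starProjection x, V.starProjection_apply_mem x, ?_⟩
  have h1 : star A (x - V.starProjection x) = 0 := by
    refine ext_inner_right ℂ fun y => ?_
    rw [ContinuousLinearMap.star_eq_adjoint, ContinuousLinearMap.adjoint_inner_left,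
      inner_zero_left]
    exact (Submodule.mem_orthogonal' _ _).1 (V.sub_starProjection_mem_orthogonal x) _ ⟨y, rfl⟩
  rw [map_sub, sub_eq_zero] at h1
  exact h1.symm

end FiniteRankAlgebra

section HamiltonianProjectors

variable {E : Type*} [NormedAddCommGroup E] [InnerProductSpace ℂ E] [CompleteSpace E]
  {D : Submodule ℂ E} {H : ℝ → D →ₗ[ℂ] E} {T : ℝ} {a b : ℝ → ℝ} {M : ℝ} {N : ℕ}

/-- The rank condition forces `b s ≥ 1`, because the spectrum of `H s` lies in `[1, ∞)`. -/
theorem one_le_of_hypH3 (hsa : ∀ s ∈ Set.Ico 0 T, IsSelfAdjoint (ham H s)) (hT : 0 < T)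
    (h1 : HypH1 H T) {n : ℕ} (hn : 1 ≤ n) (h2 : HypH2 H T n) (h3 : HypH3 H T a b M N) {s : ℝ}
    (hs : s ∈ Set.Ico 0 T) : 1 ≤ b s := by
  have hA := invertibleFamily_ham hsa hT h1 hn h2
  by_contra! hb
  have h0 : proj H a b s = 0 := spectralProjector_eq_zero (isBoundedInverse_ham hsa h1 hs)
    (hA.pos s hs) (hA.norm_le s hs) hb
  have hr := (h3.2.2.2.2 s hs).2
  rw [h0] at hr
  have h4 := h3.2.2.2.1
  have h5 : LinearMap.range ((0 : E →L[ℂ] E) : E →ₗ[ℂ] E) = ⊥ := LinearMap.range_zero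
  rw [h5, finrank_bot] at hr
  omega

/-- The gap condition on `H s`, transported to the inverse. The disc that encloses the spectrum is the
one with diameter `[1 / b, 1 / max a 1]`, which is continuous in `s`. -/
theorem proj_isGapProjection (hsa : ∀ s ∈ Set.Ico 0 T, IsSelfAdjoint (ham H s)) (hT : 0 < T)
    (h1 : HypH1 H T) {n : ℕ} (hn : 1 ≤ n) (h2 : HypH2 H T n) (h3 : HypH3 H T a b M N) {s : ℝ}
    (hs : s ∈ Set.Ico 0 T) :
    IsSelfAdjoint (proj H a b s) ∧ ∃ G r', IsGapProjection (boundedInverse (ham H s))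
      (proj H a b s) G (((max (a s) 1)⁻¹ + (b s)⁻¹) / 2) (((max (a s) 1)⁻¹ - (b s)⁻¹) / 2) r' := by
  have hA := invertibleFamily_ham hsa hT h1 hn h2
  exact spectralProjector_isGapProjection (isBoundedInverse_ham hsa h1 hs) (hA.pos s hs)
    (hA.norm_le s hs) (h3.2.2.1 s ⟨hs.1, hs.2.le⟩).2.1 (one_le_of_hypH3 hsa hT h1 hn h2 h3 hs)
    (h3.2.2.2.2 s hs).1

/-- Regularity of the spectral projectors and of the corrector `L⁺ Ṗ`, and the two commutators that
enter the adiabatic expansion. -/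
theorem contDiffOn_proj_and_corrector (hsa : ∀ s ∈ Set.Ico 0 T, IsSelfAdjoint (ham H s))
    (hT : 0 < T) (h1 : HypH1 H T) {n : ℕ} (hn : 2 ≤ n) (h2 : HypH2 H T n)
    (h3 : HypH3 H T a b M N) :
    ContDiffOn ℝ 1 (proj H a b) (Set.Ico 0 T) ∧ ContDiffOn ℝ 1 (corrector H T a b) (Set.Ico 0 T) ∧
    ∀ s ∈ Set.Ico 0 T, IsLiouvillian (ham H s) (proj H a b s) 0 ∧
      IsLiouvillian (ham H s) (corrector H T a b s) (projDeriv H T a b s) ∧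
      FiniteDimensional ℂ (LinearMap.range
        ((derivWithin (corrector H T a b) (Set.Ico 0 T) s : E →L[ℂ] E) : E →ₗ[ℂ] E)) := by
  have hn1 : 1 ≤ n := by omega
  have hA := invertibleFamily_ham hsa hT h1 hn1 h2
  have hS : UniqueDiffOn ℝ (Set.Ico 0 T) := uniqueDiffOn_Ico 0 T
  have hg := fun s hs => proj_isGapProjection hsa hT h1 hn1 h2 h3 (s := s) hs
  have hrel : ∀ l, 1 ≤ l → l ≤ n → ∃ B, hA.IsRelative
      (fun s => (hamDeriv H T l s).toFun) (alpha H T l).toReal B := fun l hl1 hl =>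
    hA.exists_isRelative fun s hs φ => by
      have := norm_iteratedDerivWithin_le hsa h1 h2 hl1 hl hs φ
      rwa [← hamDeriv_apply hl h2.1 hs] at this
  obtain ⟨B, hB⟩ := hrel 1 le_rfl hn1
  obtain ⟨B', hB'⟩ := hrel 2 (by omega) hn
  have hd1 : ∀ s ∈ Set.Ico 0 T, ∀ φ : D, (hamDeriv H T 1 s).toFun φ
      = derivWithin (fun r => H r φ) (Set.Ico 0 T) s := fun s hs φ => by
    rw [← iteratedDerivWithin_one]
    exact hamDeriv_apply hn1 h2.1 hs φ
  have hd2 : ∀ s ∈ Set.Ico 0 T, ∀ φ : D, (hamDeriv H T 2 s).toFun φ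
      = iteratedDerivWithin 2 (fun r => H r φ) (Set.Ico 0 T) s := fun s hs φ =>
    hamDeriv_apply hn h2.1 hs φ
  have hC : ∀ s ∈ Set.Ico 0 T, ∀ φ : D, HasDerivWithinAt (fun r => (hamDeriv H T 1 r).toFun φ)
      ((hamDeriv H T 2 s).toFun φ) (Set.Ico 0 T) s := fun s hs φ => by
    have hdiff := (h2.1 φ).differentiableOn_iteratedDerivWithin (m := 1)
      (by exact_mod_cast hn) hS s hs
    have h5 := hdiff.hasDerivWithinAt
    rw [← iteratedDerivWithin_succ, ← hd2 s hs] at h5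
    exact h5.congr_of_mem (fun r hr => hamDeriv_apply hn1 h2.1 hr φ) hs
  have hC' : ∀ s ∈ Set.Ico 0 T, ∀ φ : D, ContinuousWithinAt
      (fun r => (hamDeriv H T 2 r).toFun φ) (Set.Ico 0 T) s := fun s hs φ =>
    ((h2.1 φ).continuousOn_iteratedDerivWithin (m := 2) (by exact_mod_cast hn) hS).congr
      (fun r hr => hd2 r hr φ) s hs
  obtain ⟨R', R'', K, hR1, hR1c, hR2, hR2c, hK⟩ :=
    hB.exists_second_deriv (convex_Ico 0 T) hB' hd1 hC hC'
  have ha : ContinuousOn a (Set.Ico 0 T) := h3.1.mono Set.Ico_subset_Icc_self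
  have hb : ContinuousOn b (Set.Ico 0 T) := h3.2.1.mono Set.Ico_subset_Icc_self
  have hb1 := fun s hs => one_le_of_hypH3 hsa hT h1 hn1 h2 h3 (s := s) hs
  have hbi : ContinuousOn (fun s => (b s)⁻¹) (Set.Ico 0 T) :=
    hb.inv₀ fun s hs => by linarith [hb1 s hs]
  have hai : ContinuousOn (fun s => (max (a s) 1)⁻¹) (Set.Ico 0 T) :=
    ((continuous_id.max continuous_const).comp_continuousOn ha).inv₀ fun s _ =>
      (zero_lt_one.trans_le (le_max_right (a s) 1)).ne'
  have hrank := fun s hs => (h3.2.2.2.2 s hs).2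
  have hPc : ContinuousOn (proj H a b) (Set.Ico 0 T) :=
    continuousOn_of_isGapProjection (fun s hs => (hR1 s hs).continuousWithinAt)
      ((hai.add hbi).div_const 2) ((hai.sub hbi).div_const 2) (fun s hs => (hg s hs).2)
      (fun s hs => (hg s hs).1) h3.2.2.2.1 hrank
  have hfin : ∀ s ∈ Set.Ico 0 T,
      FiniteDimensional ℂ (LinearMap.range (proj H a b s : E →ₗ[ℂ] E)) := fun s hs =>
    Module.finite_of_finrank_pos (by rw [hrank s hs]; exact h3.2.2.2.1)
  have hPP : ∀ s ∈ Set.Ico 0 T, proj H a b s * proj H a b s = proj H a b s := fun s hs => by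
    obtain ⟨-, G, r', h⟩ := hg s hs
    exact h.idem
  have hcomm : ∀ s ∈ Set.Ico 0 T, boundedInverse (ham H s) * proj H a b s
      = proj H a b s * boundedInverse (ham H s) := fun s hs => by
    obtain ⟨-, G, r', h⟩ := hg s hs
    exact h.comm
  have hu : ∀ s ∈ Set.Ico 0 T, IsUnit (sylvester (boundedInverse (ham H s)) (proj H a b s)
      (proj H a b s) (1 - proj H a b s)) := fun s hs => by
    obtain ⟨-, G, r', h⟩ := hg s hs
    exact h.isUnit_sylvester
  obtain ⟨hR, hP, hP'⟩ := contDiffOn_derivWithin_projection hS hR1 hR1c hR2 hR2c hK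
    (fun s hs => (hA.pos s hs).isSelfAdjoint) hPc hPP (fun s hs => (hg s hs).1) hcomm hu hfin
  have hPd : ∀ s ∈ Set.Ico 0 T, HasDerivWithinAt (proj H a b) (projDeriv H T a b s)
      (Set.Ico 0 T) s := fun s hs => (hP.differentiableOn one_ne_zero s hs).hasDerivWithinAt
  have hoff : ∀ s ∈ Set.Ico 0 T,
      offDiagonalPart (proj H a b s) (projDeriv H T a b s) = projDeriv H T a b s := fun s hs =>
    (isOffDiagonal_of_eq (hPP s hs)
      (derivWithin_projection_eq hs (hS s hs) (hPd s hs) hPP)).offDiagonalPart_eq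
  have hX : ∀ s ∈ Set.Ico 0 T, corrector H T a b s
        = Ring.inverse (sylvester (boundedInverse (ham H s)) (proj H a b s)
          (proj H a b s) (1 - proj H a b s))
          (-(boundedInverse (ham H s) * projDeriv H T a b s * boundedInverse (ham H s))) ∧
      IsOffDiagonal (proj H a b s) (corrector H T a b s) ∧
      IsLiouvillian (ham H s) (corrector H T a b s) (projDeriv H T a b s) := fun s hs => by
    obtain ⟨-, G, r', h⟩ := hg s hs
    have h5 := liouvillianInv_eq (isBoundedInverse_ham hsa h1 hs) h (projDeriv H T a b s)
    rwa [hoff s hs] at h5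
  have hX1 : ContDiffOn ℝ 1 (corrector H T a b) (Set.Ico 0 T) :=
    (contDiffOn_inverse_sylvester_apply hR hP ((hR.mul hP').mul hR).neg hu).congr
      fun s hs => (hX s hs).1
  refine ⟨hP, hX1, fun s hs => ⟨?_, (hX s hs).2.2, ?_⟩⟩
  · rw [isLiouvillian_iff (isBoundedInverse_ham hsa h1 hs), hcomm s hs]
    simp
  · exact finiteDimensional_range_deriv hs (hS s hs) (hPd s hs)
      (hX1.differentiableOn one_ne_zero s hs).hasDerivWithinAt hPP (fun r hr => (hX r hr).2.1)
      (hfin s hs)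

end HamiltonianProjectors

/-! ### Evolution of observables and the adiabatic expansion -/

section Heisenberg

theorem IsLiouvillian.add_smul {E : Type*} [NormedAddCommGroup E] [InnerProductSpace ℂ E]
    {T : E →ₗ.[ℂ] E} {B C B' C' : E →L[ℂ] E} (h : IsLiouvillian T B C)
    (h' : IsLiouvillian T B' C') (c : ℂ) : IsLiouvillian T (B + c • B') (C + c • C') := fun φ => by
  obtain ⟨hm, he⟩ := h φ
  obtain ⟨hm', he'⟩ := h' φ
  refine ⟨T.domain.add_mem hm (T.domain.smul_mem c hm'), ?_⟩
  have e : T ⟨(B + c • B') φ, T.domain.add_mem hm (T.domain.smul_mem c hm')⟩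
      = T ⟨_, hm⟩ + c • T ⟨_, hm'⟩ :=
    (T.map_add ⟨_, hm⟩ (c • ⟨_, hm'⟩)).trans (congrArg (_ + ·) (T.map_smul c ⟨_, hm'⟩))
  rw [e, add_apply, add_apply, smul_apply, smul_apply, ← he, ← he', smul_sub]
  abel

variable {E : Type*} [NormedAddCommGroup E] [InnerProductSpace ℂ E] [CompleteSpace E]
  {D : Submodule ℂ E} {H : ℝ → D →ₗ[ℂ] E} {T ε : ℝ} {U : ℝ → ℝ → E →L[ℂ] E}

/-- Conjugation of a norm continuous family of finite rank operators by a strongly continuous family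
of unitaries is norm continuous. -/
theorem continuousOn_conj {J : Set ℝ} {V F : ℝ → E →L[ℂ] E}
    (hV : ∀ r ∈ J, V r ∈ unitary (E →L[ℂ] E)) (hVc : ∀ x, ContinuousOn (fun r => V r x) J)
    (hF : ContinuousOn F J)
    (hfin : ∀ r ∈ J, FiniteDimensional ℂ (LinearMap.range (F r : E →ₗ[ℂ] E))) :
    ContinuousOn (fun r => V r * F r * star (V r)) J := by
  have hn : ∀ r ∈ J, ‖V r‖ ≤ 1 := fun r hr => by
    have h1 := CStarRing.norm_star_mul_self (x := V r)
    rw [Unitary.star_mul_self_of_mem (hV r hr)] at h1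
    have h2 : ‖(1 : E →L[ℂ] E)‖ ≤ 1 := ContinuousLinearMap.norm_id_le
    nlinarith [norm_nonneg (V r)]
  have h1 : ContinuousOn (fun r => star (V r * F r)) J := fun r hr => by
    have := hfin r hr
    exact (continuousWithinAt_strong_mul_finite_rank (fun x => hVc x r hr) hn (hF r hr)).star
  have h2 : ContinuousOn (fun r => star (V r * star (V r * F r))) J := fun r hr => by
    have : FiniteDimensional ℂ
        (LinearMap.range ((star (V r * F r) : E →L[ℂ] E) : E →ₗ[ℂ] E)) :=
      finiteDimensional_range_star _ (finiteDimensional_range_mul_left _ _ (hfin r hr))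
    exact (continuousWithinAt_strong_mul_finite_rank (fun x => hVc x r hr) hn (h1 r hr)).star
  simpa only [star_mul, star_star] using h2

theorem IsPropagator.continuousOn_conj (hU : IsPropagator H T ε U) (hε : 0 ≤ ε)
    {F : ℝ → E →L[ℂ] E} (hF : ContinuousOn F (Set.Ico 0 T))
    (hfin : ∀ s ∈ Set.Ico 0 T, FiniteDimensional ℂ (LinearMap.range (F s : E →ₗ[ℂ] E))) {t : ℝ}
    (ht : ε * t < T) :
    ContinuousOn (fun r => U t r * F (ε * r) * star (U t r)) (Set.Icc 0 t) := by
  have hmap : ∀ r ∈ Set.Icc 0 t, ε * r ∈ Set.Ico 0 T := fun r hr =>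
    ⟨mul_nonneg hε hr.1, (mul_le_mul_of_nonneg_left hr.2 hε).trans_lt ht⟩
  refine Adiabatic.continuousOn_conj (fun r hr => hU.unitary_mem r t hr.1 hr.2 ht) (fun x => ?_)
    (hF.comp (by fun_prop) hmap) fun r hr => hfin _ (hmap r hr)
  exact (hU.strong_continuous x).comp (f := fun r => (t, r)) (by fun_prop)
    fun r hr => ⟨hr.1, hr.2, ht⟩

/-- Duhamel formula for the Heisenberg evolution of an observable `Y` that depends on time: `Q` is
its total derivative `ε Y' + i [H, Y]`. -/
theorem IsPropagator.sub_conj_eq_integral (hU : IsPropagator H T ε U) (hε : 0 ≤ ε)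
    (hD : Dense (D : Set E))
    (hH : ∀ s ∈ Set.Ico 0 T, ∀ φ ψ : D, ⟪H s φ, (ψ : E)⟫_ℂ = ⟪(φ : E), H s ψ⟫_ℂ)
    {Y Y' C Q : ℝ → E →L[ℂ] E}
    (hY : ∀ s ∈ Set.Ico 0 T, HasDerivWithinAt Y (Y' s) (Set.Ico 0 T) s)
    (hC : ∀ s ∈ Set.Ico 0 T, IsLiouvillian (ham H s) (Y s) (C s))
    (hQ : ∀ s ∈ Set.Ico 0 T, ε • Y' s + Complex.I • C s = Q s)
    (hQc : ContinuousOn Q (Set.Ico 0 T))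
    (hfin : ∀ s ∈ Set.Ico 0 T, FiniteDimensional ℂ (LinearMap.range (Q s : E →ₗ[ℂ] E)))
    {t : ℝ} (h0 : 0 ≤ t) (ht : ε * t < T) :
    Y (ε * t) - U t 0 * Y 0 * star (U t 0)
      = ∫ r in (0 : ℝ)..t, U t r * Q (ε * r) * star (U t r) := by
  have hmap : ∀ r ∈ Set.Icc 0 t, ε * r ∈ Set.Ico 0 T := fun r hr =>
    ⟨mul_nonneg hε hr.1, (mul_le_mul_of_nonneg_left hr.2 hε).trans_lt ht⟩
  have hQcont := hU.continuousOn_conj hε hQc hfin ht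
  have hQint : IntervalIntegrable (fun r => U t r * Q (ε * r) * star (U t r))
      MeasureTheory.volume 0 t :=
    ContinuousOn.intervalIntegrable (by rwa [Set.uIcc_of_le h0])
  set W := U t 0 with hW
  have hWu : W ∈ unitary (E →L[ℂ] E) := hU.unitary_mem 0 t le_rfl h0 ht
  have hadj : ∀ (B : E →L[ℂ] E) (x y : E), ⟪B x, y⟫_ℂ = ⟪x, star B y⟫_ℂ := fun B x y =>
    (ContinuousLinearMap.adjoint_inner_right B x y).symm
  have hUW : ∀ r ∈ Set.Icc 0 t, ∀ x, star (U t r) (W x) = U r 0 x := fun r hr x => by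
    have h1 := hU.comp 0 r t le_rfl hr.1 hr.2 ht
    have h2 := Unitary.star_mul_self_of_mem (hU.unitary_mem r t hr.1 hr.2 ht)
    have h3 : star (U t r) * W = U r 0 := by
      rw [hW, ← h1, ← mul_assoc, h2, one_mul]
    exact congrArg (fun B : E →L[ℂ] E => B x) h3
  have hψ : ∀ φ : D, ∀ r ∈ Set.Icc 0 t, ∃ h : U r 0 φ ∈ D, HasDerivWithinAt (fun τ => U τ 0 φ)
      (-Complex.I • H (ε * r) ⟨U r 0 φ, h⟩) (Set.Icc 0 t) r := fun φ r hr => by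
    obtain ⟨h, hd⟩ := hU.schrodinger 0 r le_rfl hr.1 (hmap r hr).2 φ
    exact ⟨h, hd.mono fun w hw => ⟨hw.1, (hmap w hw).2⟩⟩
  -- the formula in the sense of quadratic forms on the domain
  have hweak : ∀ φ φ' : D, ⟪W φ, Y (ε * t) (W φ')⟫_ℂ - ⟪(φ : E), Y 0 φ'⟫_ℂ
      = ⟪W φ, (∫ r in (0 : ℝ)..t, U t r * Q (ε * r) * star (U t r)) (W φ')⟫_ℂ := by
    intro φ φ'
    let L : (E →L[ℂ] E) →L[ℂ] ℂ :=
      (innerSL ℂ (W φ)).comp (ContinuousLinearMap.apply ℂ E (W φ'))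
    have hL : ∀ B, L B = ⟪W φ, B (W φ')⟫_ℂ := fun B => rfl
    have hLQ : ∀ r ∈ Set.Icc 0 t, L (U t r * Q (ε * r) * star (U t r))
        = ⟪U r 0 φ, Q (ε * r) (U r 0 φ')⟫_ℂ := fun r hr => by
      rw [hL, mul_apply_eq_comp, mul_apply_eq_comp, hUW r hr, ← star_star (U t r), ← hadj,
        hUW r hr]
    have hderiv : ∀ r ∈ Set.Icc 0 t,
        HasDerivWithinAt (fun r => ⟪U r 0 φ, Y (ε * r) (U r 0 φ')⟫_ℂ)
          (L (U t r * Q (ε * r) * star (U t r))) (Set.Icc 0 t) r := fun r hr => by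
      obtain ⟨h1, hd1⟩ := hψ φ r hr
      obtain ⟨h2, hd2⟩ := hψ φ' r hr
      have hYr : HasDerivWithinAt (fun r => Y (ε * r)) (ε • Y' (ε * r)) (Set.Icc 0 t) r := by
        have h3 : HasDerivWithinAt (fun r => ε * r) ε (Set.Icc 0 t) r := by
          simpa using (hasDerivWithinAt_id r (Set.Icc 0 t)).const_mul ε
        exact (hY _ (hmap r hr)).scomp r h3 hmap
      have hYψ : HasDerivWithinAt (fun r => Y (ε * r) (U r 0 φ'))
          ((ε • Y' (ε * r)) (U r 0 φ') + Y (ε * r) (-Complex.I • H (ε * r) ⟨U r 0 φ', h2⟩))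
          (Set.Icc 0 t) r :=
        ((ContinuousLinearMap.restrictScalarsL ℂ E E ℝ ℝ).hasFDerivAt.comp_hasDerivWithinAt r
          hYr).clm_apply hd2
      refine (hd1.inner ℂ hYψ).congr_deriv ?_
      obtain ⟨h4, h5⟩ := hC _ (hmap r hr) ⟨U r 0 φ', h2⟩
      have h6 := hH _ (hmap r hr) ⟨U r 0 φ, h1⟩ ⟨_, h4⟩
      have h7 : C (ε * r) (U r 0 φ') = H (ε * r) ⟨_, h4⟩ - Y (ε * r) (H (ε * r) ⟨U r 0 φ', h2⟩) :=
        h5.symm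
      have h8 : (Complex.I • C (ε * r)) (U r 0 φ') = Complex.I • C (ε * r) (U r 0 φ') := rfl
      rw [hLQ r hr, ← hQ _ (hmap r hr), add_apply, h8, h7, map_smul, inner_smul_left, h6]
      simp only [inner_add_right, inner_smul_right, inner_sub_right, map_neg, Complex.conj_I]
      ring
    have hcont : ContinuousOn (fun r => L (U t r * Q (ε * r) * star (U t r))) (Set.Icc 0 t) :=
      L.continuous.comp_continuousOn hQcont
    have hftc := intervalIntegral.integral_eq_sub_of_hasDeriv_right_of_le h0
      (fun r hr => (hderiv r hr).continuousWithinAt)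
      (fun r hr => ((hderiv r ⟨hr.1.le, hr.2.le⟩).hasDerivAt
        (Icc_mem_nhds hr.1 hr.2)).hasDerivWithinAt)
      (ContinuousOn.intervalIntegrable (by rwa [Set.uIcc_of_le h0]))
    rw [L.intervalIntegral_comp_comm hQint, hL] at hftc
    have hU0 : U 0 0 = 1 := hU.apply_self 0 le_rfl (hmap 0 ⟨le_rfl, h0⟩).2
    rw [hftc, hU0, mul_zero]
    rfl
  have hform : star W * Y (ε * t) * W - Y 0
      = star W * (∫ r in (0 : ℝ)..t, U t r * Q (ε * r) * star (U t r)) * W := by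
    refine DFunLike.coe_injective
      (Continuous.ext_on hD (ContinuousLinearMap.continuous _) (ContinuousLinearMap.continuous _)
        fun y hy => ?_)
    refine hD.eq_of_inner_right ℂ fun x hx => ?_
    have h1 := hweak ⟨x, hx⟩ ⟨y, hy⟩
    simp only [sub_apply, mul_apply_eq_comp, inner_sub_right, ← hadj]
    exact h1
  have hWW : W * star W = 1 := Unitary.mul_star_self_of_mem hWu
  have h1 := congrArg (fun B => W * B * star W) hform
  simp only [mul_sub, sub_mul] at h1
  have h2 : ∀ B : E →L[ℂ] E, W * (star W * B * W) * star W = B := fun B => by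
    rw [show W * (star W * B * W) * star W = (W * star W) * B * (W * star W) by
      simp only [mul_assoc], hWW, one_mul, mul_one]
  rwa [h2, h2] at h1

/-- The first order adiabatic expansion of the evolved projector, from the Duhamel formula for the
observable `P + i ε X`. -/
theorem IsPropagator.adiabatic_expansion (hU : IsPropagator H T ε U) (hε : 0 ≤ ε)
    (hsa : ∀ s ∈ Set.Ico 0 T, IsSelfAdjoint (ham H s)) (hT : 0 < T) (h1 : HypH1 H T) {n : ℕ}
    (hn : 2 ≤ n) (h2 : HypH2 H T n) {a b : ℝ → ℝ} {M : ℝ} {N : ℕ} (h3 : HypH3 H T a b M N) {t : ℝ}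
    (h0 : 0 ≤ t) (ht : ε * t < T) :
    IntervalIntegrable (fun t' => U t t' *
      derivWithin (corrector H T a b) (Set.Ico 0 T) (ε * t') * star (U t t'))
      MeasureTheory.volume 0 t ∧
    U t 0 * proj H a b 0 * star (U t 0) = proj H a b (ε * t)
      + (Complex.I * (ε : ℂ)) • corrector H T a b (ε * t)
      - (Complex.I * (ε : ℂ)) • (U t 0 * corrector H T a b 0 * star (U t 0))
      + (-Complex.I * (ε : ℂ) ^ 2) • ∫ t' in (0 : ℝ)..t, U t t' *
        derivWithin (corrector H T a b) (Set.Ico 0 T) (ε * t') * star (U t t') := by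
  obtain ⟨hP, hX, hcomm⟩ := contDiffOn_proj_and_corrector hsa hT h1 hn h2 h3
  have hS : UniqueDiffOn ℝ (Set.Ico 0 T) := uniqueDiffOn_Ico 0 T
  have hX' := (contDiffOn_one_iff_derivWithin hS).1 hX
  have hXc := hU.continuousOn_conj hε hX'.2 (fun s hs => (hcomm s hs).2.2) ht
  refine ⟨ContinuousOn.intervalIntegrable (by rwa [Set.uIcc_of_le h0]), ?_⟩
  have key := hU.sub_conj_eq_integral hε (hsa 0 ⟨le_rfl, hT⟩).dense_domain
    (fun s hs φ ψ => inner_apply_left_of_isSelfAdjoint (hsa s hs) φ ψ)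
    (Y := fun s => proj H a b s + (Complex.I * (ε : ℂ)) • corrector H T a b s)
    (Y' := fun s => projDeriv H T a b s
      + (Complex.I * (ε : ℂ)) • derivWithin (corrector H T a b) (Set.Ico 0 T) s)
    (C := fun s => (Complex.I * (ε : ℂ)) • projDeriv H T a b s)
    (Q := fun s => (Complex.I * (ε : ℂ) ^ 2) •
      derivWithin (corrector H T a b) (Set.Ico 0 T) s)
    (fun s hs => (hP.differentiableOn one_ne_zero s hs).hasDerivWithinAt.add
      ((hX'.1 s hs).hasDerivWithinAt.fun_const_smul _))
    (fun s hs φ => ?_) (fun s hs => ?_) (hX'.2.fun_const_smul _) (fun s hs => ?_) h0 ht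
  · simp only [mul_smul_comm, smul_mul_assoc, intervalIntegral.integral_smul, mul_add,
      add_mul] at key
    rw [neg_mul, neg_smul, ← key]
    abel
  · have h5 := (hcomm s hs).1.add_smul (hcomm s hs).2.1 (Complex.I * (ε : ℂ)) φ
    rwa [zero_add] at h5
  · have h5 : ∀ B : E →L[ℂ] E, ε • B = (ε : ℂ) • B := fun B => rfl
    simp only [h5, smul_add, smul_smul]
    rw [show Complex.I * (Complex.I * (ε : ℂ)) = -(ε : ℂ) by
      rw [← mul_assoc, Complex.I_mul_I, neg_one_mul],
      show (ε : ℂ) * (Complex.I * ε) = Complex.I * (ε : ℂ) ^ 2 by ring, neg_smul]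
    abel
  · have h6 := finiteDimensional_range_mul_left ((Complex.I * (ε : ℂ) ^ 2) • (1 : E →L[ℂ] E)) _
      (hcomm s hs).2.2
    rwa [smul_mul_assoc, one_mul] at h6

end Heisenberg

end Adiabatic

theorem proposition5 {E : Type*} [NormedAddCommGroup E] [InnerProductSpace ℂ E] [CompleteSpace E]
    (D : Submodule ℂ E) (T : ℝ) (hT : 0 < T) (H : ℝ → D →ₗ[ℂ] E)
    (hsa : ∀ s ∈ Set.Ico 0 T, IsSelfAdjoint (Adiabatic.ham H s))
    (h1 : Adiabatic.HypH1 H T)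
    (n : ℕ) (hn : 1 ≤ n) (h2 : Adiabatic.HypH2 H T n)
    (a b : ℝ → ℝ) (M : ℝ) (N : ℕ) (h3 : Adiabatic.HypH3 H T a b M N)
    (ε : ℝ) (hε : 0 ≤ ε) :
    (∃ U : ℝ → ℝ → E →L[ℂ] E, Adiabatic.IsPropagator H T ε U) ∧
    (∀ U V : ℝ → ℝ → E →L[ℂ] E, Adiabatic.IsPropagator H T ε U → Adiabatic.IsPropagator H T ε V →
      ∀ t' t : ℝ, 0 ≤ t' → t' ≤ t → ε * t < T → U t t' = V t t') ∧
    ∀ U : ℝ → ℝ → E →L[ℂ] E, Adiabatic.IsPropagator H T ε U →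
      (2 ≤ n →
        DifferentiableOn ℝ (Adiabatic.proj H a b) (Set.Ico 0 T) ∧
        DifferentiableOn ℝ (Adiabatic.corrector H T a b) (Set.Ico 0 T) ∧
        ∀ t : ℝ, 0 ≤ t → ε * t < T →
          IntervalIntegrable
            (fun t' => U t t' *
              derivWithin (Adiabatic.corrector H T a b) (Set.Ico 0 T) (ε * t') * star (U t t'))
            MeasureTheory.volume 0 t ∧
          U t 0 * Adiabatic.proj H a b 0 * star (U t 0) =
            Adiabatic.proj H a b (ε * t)
            + (Complex.I * (ε : ℂ)) • Adiabatic.corrector H T a b (ε * t)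
            - (Complex.I * (ε : ℂ)) • (U t 0 * Adiabatic.corrector H T a b 0 * star (U t 0))
            + (-Complex.I * (ε : ℂ) ^ 2) •
              ∫ t' in (0 : ℝ)..t, U t t' *
                derivWithin (Adiabatic.corrector H T a b) (Set.Ico 0 T) (ε * t') *
                star (U t t')) ∧
      ∀ t' t : ℝ, 0 ≤ t' → t' ≤ t → ε * t < T →
        Adiabatic.opENorm
            (Adiabatic.mul
              (Adiabatic.mul (Adiabatic.ham H (ε * t)) (Adiabatic.ofBounded (U t t')))
              (Adiabatic.ofBounded (Adiabatic.boundedInverse (Adiabatic.ham H (ε * t'))))) ≤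
          ENNReal.ofReal (Real.exp ((Adiabatic.alpha H T 1).toReal * ε * (t - t'))) ∧
        Adiabatic.opENorm
            (Adiabatic.mul
              (Adiabatic.mul (Adiabatic.sqrtOp (Adiabatic.ham H (ε * t)))
                (Adiabatic.ofBounded (U t t')))
              (Adiabatic.ofBounded (Adiabatic.invSqrt (Adiabatic.ham H (ε * t'))))) ≤
          ENNReal.ofReal (Real.exp ((Adiabatic.alpha H T 1).toReal * ε * (t - t') / 2)) := by
  have hA := Adiabatic.invertibleFamily_ham hsa hT h1 hn h2
  obtain ⟨U₀, hU₀, -⟩ := Adiabatic.exists_isPropagator hε hA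
  refine ⟨⟨U₀, hU₀⟩, fun U V hU hV t' t h0 h01 ht => hU.eq hε hA hV h0 h01 ht, fun U hU =>
    ⟨fun hn2 => ?_, fun t' t h0 h01 ht => hU.opENorm_le hsa hT h1 hn h2 hε h0 h01 ht⟩⟩
  obtain ⟨hP, hX, -⟩ := Adiabatic.contDiffOn_proj_and_corrector hsa hT h1 hn2 h2 h3
  exact ⟨hP.differentiableOn one_ne_zero, hX.differentiableOn one_ne_zero, fun t h0 ht =>
    hU.adiabatic_expansion hε hsa hT h1 hn2 h2 h3 h0 ht⟩
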